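/- Let $G$ be a simple complex algebraic group of adjoint type with Lie algebra $\mathfrak g$, maximal torus $T$ with Lie algebra $\mathfrak t$, roots $R$, simple roots $\alpha_i$ ($i\in I$), positive roots $R^+$, coroots $\alpha^\vee$, opposite Borel subgroups $B=TU$ and $B^-=TU^-$, and write $\mathfrak t^\vee:=\mathfrak t^*$. Fix $e_i\in\mathfrak g_{\alpha_i}$, $f_i\in\mathfrak g_{-\alpha_i}$ with $[e_i,f_i]=\alpha_i^\vee$, and put $x_i(a)=\exp(ae_i)$, $y_i(a)=\exp(af_i)$, $\overline{s_i}=x_i(-1)y_i(1)x_i(-1)$. Let $\chi:U\to\mathbb C$ be the homomorphism with $\chi(x_i(a))=a$ for all $i$, and let $\iota$ be the anti-automorphism of $G$ fixing all $x_i(a),y_i(a)$ and inverting $T$. Let $I_P\subsetneq I$, let $P\supseteq B$ be the corresponding parabolic subgroup, $R_P^+\subseteq R^+$ the positive roots generated by the $\alpha_i$, $i\in I_P$, and $Z(L_P)=\{t\in T:\alpha_i(t)=1\ \forall i\in I_P\}$. Let $w_0$ and $w_0^P$ be the longest elements of the Weyl group $W$ and of $W_P=\langle s_i: i\in I_P\rangle$,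 put $w_P=w_0^Pw_0$, fix a reduced decomposition $(i_1,\dots,i_\ell)$ of $w_P$, and put $\overline{w_P}=\overline{s_{i_1}}\cdots\overline{s_{i_\ell}}$, $\overline{w_P^{-1}}=\overline{s_{i_\ell}}\cdots\overline{s_{i_1}}$. Let $$X=B^-\cap U\,Z(L_P)\,\overline{w_P}\,U,\qquad f(x)=\chi(u_1)+\chi(u_2),\quad \pi(x)=t,\quad \gamma(x)=t_0$$ for $x=u_0t_0=u_1t\,\overline{w_P}\,u_2\in X$ with $u_0\in U^-$, $t_0\in T$, $t\in Z(L_P)$, $u_1,u_2\in U$. Consider the torus chart $$\theta:Z(L_P)\times(\mathbb C^\times)^\ell\to X,\qquad \theta(t,\mathbf a)=t\cdot\iota(b),$$ where $x_{i_1}(a_1)\cdots x_{i_\ell}(a_\ell)\,\overline{w_P^{-1}}=bu$ with $b\in B^-$, $u\in U$. The fiberwise volume form $\mathrm{vol}$ on $X$ (relative to $\pi$) is the pull-back, under $x\mapsto x^{-1}P$, of the volume form on the open projected Richardson variety $\mathcal U\subset G/P$, the image of $(B^-w_0^PB/B)\cap(Bw_0B/B)$, which has simple poles along all irreducible components of $(G/P)\setminus\mathcal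 U$; it is unique up to a scalar and normalized by $\theta^*\mathrm{vol}=\frac{da_1\wedge\cdots\wedge da_\ell}{a_1\cdots a_\ell}$. Let $T_{>0}$ be the submonoid of $T$ generated by the $\alpha_i^\vee(a)$, and $G_{\ge0}$ the submonoid of $G$ generated by the $\alpha_i^\vee(a),x_i(a),y_i(a)$ ($i\in I$, $a\in\mathbb R_{>0}$). Let $X_{>0}=(Z(L_P)\cap T_{>0})\cdot(B^-\cap U\overline{w_P}U\cap G_{\ge 0})$ and $X_{t,>0}=\pi^{-1}(t)\cap X_{>0}$, oriented through the chart $\theta(t,\cdot):\mathbb R_{>0}^\ell\xrightarrow{\sim}X_{t,>0}$. For $\hbar>0$, $h\in\mathfrak t^\vee$ and $t\in Z(L_P)\cap T_{>0}$ put $$I_B(\hbar,h,t,[\mathrm{vol}])=\int_{X_{t,>0}}e^{-f/\hbar}\,\gamma^{h/\hbar}\,\mathrm{vol},\qquad \gamma^{h/\hbar}=\exp\left(\tfrac1\hbar\langle h,\log\gamma\rangle\right),$$ where $\log:T_{>0}\to\mathfrak t_{\mathbb R}$ is the inverse of the exponential map. **Statement.** Write $\alpha^\vee(h)$, $\lambda(\alpha_i)$,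 $\lambda(h)$ for the natural pairings of $\mathfrak t$ with $\mathfrak t^*=\mathfrak t^\vee$. Let $\hbar\in\mathbb R_{>0}$, $h\in\mathfrak t^\vee$ and $\lambda\in\mathfrak t$ be such that $\mathrm{Re}\,\alpha^\vee(h)<0$ for all $\alpha\in R^+$, $\lambda(\alpha_i)\in\mathbb R_{>0}$ for $i\in I\setminus I_P$ and $\lambda(\alpha_i)=0$ for $i\in I_P$. For $s>0$ let $t_\lambda(s)\in Z(L_P)$ be the element with $\alpha_i(t_\lambda(s))=s^{\lambda(\alpha_i)}$ for all $i\in I\setminus I_P$. Then the integral $I_B(\hbar,h,t_\lambda(s),[\mathrm{vol}])$ converges absolutely for every $s>0$, and $$\lim_{s\to0^+}s^{-\lambda(h)/\hbar}\,I_B(\hbar,h,t_\lambda(s),[\mathrm{vol}])=\hbar^{-(2\rho^\vee-2\rho_P^\vee)(h)/\hbar}\prod_{\alpha\in-(R^+\setminus R_P^+)}\Gamma\left(\frac{\alpha^\vee(h)}{\hbar}\right),$$ where $2\rho^\vee-2\rho_P^\vee=\sum_{\alpha\in R^+\setminus R_P^+}\alpha^\vee$. -/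

import Mathlib

open Filter Topology MeasureTheory Module
open scoped Pointwise

noncomputable section

namespace RietschMirror

/-! ### Exponentials of ad-nilpotent elements -/

section Exp

variable {𝔤 : Type*} [LieRing 𝔤] [LieAlgebra ℂ 𝔤]

/-- The exponential `exp (ad x) = ∑ (ad x)ᵏ / k!` of an ad-nilpotent element `x`; the sum runs
over all `k` with `(ad x)ᵏ ≠ 0`. -/
def adExpSeries (x : 𝔤) : Module.End ℂ 𝔤 :=
  ∑ k ∈ Finset.range (nilpotencyClass (LieAlgebra.ad ℂ 𝔤 x)),
    ((k.factorial : ℂ)⁻¹) • (LieAlgebra.ad ℂ 𝔤 x) ^ k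

theorem adExpSeries_mul_neg {x : 𝔤} (hx : IsNilpotent (LieAlgebra.ad ℂ 𝔤 x)) :
    adExpSeries x * adExpSeries (-x) = 1 := by
  let _i : Algebra ℚ (Module.End ℂ 𝔤) :=
    ((algebraMap ℂ (Module.End ℂ 𝔤)).comp (algebraMap ℚ ℂ)).toAlgebra'
      fun c f => Algebra.commutes (algebraMap ℚ ℂ c) f
  have key : ∀ y : 𝔤, adExpSeries y = IsNilpotent.exp (LieAlgebra.ad ℂ 𝔤 y) := by
    intro y
    refine Finset.sum_congr rfl fun k _ => ?_
    rw [Algebra.smul_def, Algebra.smul_def]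
    change _ = algebraMap ℂ (Module.End ℂ 𝔤) (algebraMap ℚ ℂ _) * _
    simp
  have hneg : LieAlgebra.ad ℂ 𝔤 (-x) = -LieAlgebra.ad ℂ 𝔤 x := map_neg _ _
  rw [key x, key (-x), hneg]
  exact IsNilpotent.exp_mul_exp_neg_self hx

open Classical in
/-- The automorphism `exp (ad x)` of `𝔤`, for ad-nilpotent `x` (and `1` otherwise). -/
def expAd (x : 𝔤) : 𝔤 ≃ₗ[ℂ] 𝔤 :=
  if hx : IsNilpotent (LieAlgebra.ad ℂ 𝔤 x) then
    LinearEquiv.ofLinearMap (adExpSeries x) (adExpSeries (-x))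
      (adExpSeries_mul_neg hx)
      (by
        have hneg : LieAlgebra.ad ℂ 𝔤 (-x) = -LieAlgebra.ad ℂ 𝔤 x := map_neg _ _
        have := adExpSeries_mul_neg (x := -x) (by rw [hneg]; exact hx.neg)
        rwa [neg_neg] at this)
  else 1

end Exp

open LieAlgebra LieAlgebra.IsKilling

variable {𝔤 : Type*} [LieRing 𝔤] [LieAlgebra ℂ 𝔤] [FiniteDimensional ℂ 𝔤] [IsKilling ℂ 𝔤]

/-- The choices fixed once and for all for `(𝔤, 𝔱)`, `𝔱 = H`: a base `{αᵢ}` of the root system,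
and root vectors `eᵢ ∈ 𝔤_{αᵢ}`, `fᵢ ∈ 𝔤_{-αᵢ}` with `[eᵢ, fᵢ] = αᵢ^∨`. -/
structure Pinning (H : LieSubalgebra ℂ 𝔤) [H.IsCartanSubalgebra] where
  base : (rootSystem H).Base
  e : base.support → 𝔤
  f : base.support → 𝔤
  e_mem : ∀ i, e i ∈ rootSpace H (i.1.1 : H → ℂ)
  f_mem : ∀ i, f i ∈ rootSpace H (-(i.1.1 : H → ℂ))
  lie_e_f : ∀ i, ⁅e i, f i⁆ = ((coroot i.1.1 : H) : 𝔤)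

variable {H : LieSubalgebra ℂ 𝔤} [H.IsCartanSubalgebra]

namespace Pinning

variable (p : Pinning H)

/-- The index set `I` of the simple roots. -/
abbrev I : Type _ := p.base.support

/-- The simple root `αᵢ`, as a linear form on `𝔱`. -/
def simpleRoot (i : p.I) : Dual ℂ H := (rootSystem H).root i.1

open Classical in
/-- The fundamental coweights `ϖᵢ ∈ 𝔱`: the basis dual to `{αᵢ}`. -/
def coweight (i : p.I) : H :=
  (evalEquiv ℂ H).symm (p.base.toWeightBasis.dualBasis i)

/-! ### Roots, Weyl group -/

/-- `R⁺`. -/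
def posRoots : Set H.root := {α | p.base.IsPos α}

/-- `R_P⁺`: the positive roots generated by the `αᵢ` with `i ∈ I_P = J`. -/
def posRootsP (J : Set p.I) : Set H.root :=
  {α | p.base.IsPos α ∧ (rootSystem H).root α ∈ AddSubmonoid.closure (p.simpleRoot '' J)}

open Classical in
/-- `R⁺ ∖ R_P⁺`, as a finite set. -/
def posRootsOutside (J : Set p.I) : Finset H.root :=
  Finset.univ.filter fun α => α ∈ p.posRoots ∧ α ∉ p.posRootsP J

/-- The simple reflection `sᵢ`, acting on the set of roots. The Weyl group acts faithfully on
roots and is identified with a group of permutations of them. -/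
def simpleReflection (i : p.I) : Equiv.Perm H.root := (rootSystem H).reflectionPerm i.1

/-- The product `s_{i₁} ⋯ s_{iₘ}`. -/
def weylWord (l : List p.I) : Equiv.Perm H.root := (l.map p.simpleReflection).prod

/-- The standard parabolic subgroup of the Weyl group generated by `sᵢ`, `i ∈ J`. -/
def weylSubgroup (J : Set p.I) : Subgroup (Equiv.Perm H.root) :=
  Subgroup.closure (p.simpleReflection '' J)

/-- The length of an element of the Weyl group. -/
def length (w : Equiv.Perm H.root) : ℕ :=
  sInf {m | ∃ l : List p.I, p.weylWord l = w ∧ l.length = m}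

theorem exists_longest (J : Set p.I) :
    ∃ w ∈ p.weylSubgroup J, ∀ v ∈ p.weylSubgroup J, p.length v ≤ p.length w := by
  obtain ⟨w, hw⟩ := Finite.exists_max fun w : p.weylSubgroup J => p.length w.1
  exact ⟨w.1, w.2, fun v hv => hw ⟨v, hv⟩⟩

/-- The longest element of the subgroup of the Weyl group generated by `sᵢ`, `i ∈ J`. -/
def longest (J : Set p.I) : Equiv.Perm H.root := (p.exists_longest J).choose

/-- `w_P = w₀ᴾ w₀`. -/
def wP (J : Set p.I) : Equiv.Perm H.root := p.longest J * p.longest Set.univ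

/-- `(i₁, …, iₙ)` is a reduced decomposition of `w`. -/
def IsReducedDecomposition {n : ℕ} (w : Equiv.Perm H.root) (ii : Fin n → p.I) : Prop :=
  p.weylWord (List.ofFn ii) = w ∧ p.length w = n

/-! ### The adjoint group and its subgroups

The complex algebraic group of adjoint type with Lie algebra `𝔤` is realised, through its
(faithful) adjoint representation, as the group of automorphisms of `𝔤` generated by the root
subgroups. -/

/-- The subgroup generated by the root subgroups `exp (ad 𝔤_α)`, `α ∈ S`. -/
def rootGroup (H : LieSubalgebra ℂ 𝔤) [H.IsCartanSubalgebra] (S : Set H.root) :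
    Subgroup (𝔤 ≃ₗ[ℂ] 𝔤) :=
  Subgroup.closure {g | ∃ α ∈ S, ∃ x ∈ rootSpace H (α.1 : H → ℂ), g = expAd x}

/-- The adjoint group `G`. -/
def G (_p : Pinning H) : Subgroup (𝔤 ≃ₗ[ℂ] 𝔤) := rootGroup H Set.univ

/-- The maximal torus `T` of `G` with Lie algebra `𝔱`, i.e. the centralizer of `𝔱` in `G`. -/
def T : Subgroup (𝔤 ≃ₗ[ℂ] 𝔤) where
  carrier := {g | g ∈ p.G ∧ ∀ x ∈ H, g x = x}
  mul_mem' := by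
    rintro a b ⟨ha, ha'⟩ ⟨hb, hb'⟩
    refine ⟨mul_mem ha hb, fun x hx => ?_⟩
    rw [LinearEquiv.mul_apply, hb' x hx, ha' x hx]
  one_mem' := ⟨one_mem _, fun _ _ => rfl⟩
  inv_mem' := by
    rintro a ⟨ha, ha'⟩
    refine ⟨inv_mem ha, fun x hx => ?_⟩
    conv_lhs => rw [← ha' x hx]
    exact a.symm_apply_apply x

/-- `U`, the unipotent radical of `B`. -/
def U : Subgroup (𝔤 ≃ₗ[ℂ] 𝔤) := rootGroup H p.posRoots

/-- `U⁻`, the unipotent radical of `B⁻`. -/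
def Uminus : Subgroup (𝔤 ≃ₗ[ℂ] 𝔤) := rootGroup H p.posRootsᶜ

/-- The Borel subgroup `B = T U`. -/
def B : Subgroup (𝔤 ≃ₗ[ℂ] 𝔤) := p.T ⊔ p.U

/-- The Borel subgroup `B⁻ = T U⁻`. -/
def Bminus : Subgroup (𝔤 ≃ₗ[ℂ] 𝔤) := p.T ⊔ p.Uminus

/-- The set of roots `R⁺ ∪ (-R_P⁺)` of the parabolic subgroup `P`. -/
def parabolicRoots (J : Set p.I) : Set H.root :=
  {α | α ∈ p.posRoots ∨
    -(rootSystem H).root α ∈ AddSubmonoid.closure (p.simpleRoot '' J)}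

/-- The parabolic subgroup `P ⊇ B`. -/
def P (J : Set p.I) : Subgroup (𝔤 ≃ₗ[ℂ] 𝔤) := p.T ⊔ rootGroup H (p.parabolicRoots J)

/-- `Lie P`. -/
def lieP (J : Set p.I) : Submodule ℂ 𝔤 :=
  H.toSubmodule ⊔ ⨆ α ∈ p.parabolicRoots J, (rootSpace H (α.1 : H → ℂ)).toSubmodule

/-- The complement `⨁_{α ∈ -(R⁺∖R_P⁺)} 𝔤_α` of `Lie P` in `𝔤`. -/
def nilP (J : Set p.I) : Submodule ℂ 𝔤 :=
  ⨆ α ∈ (p.parabolicRoots J)ᶜ, (rootSpace H (α.1 : H → ℂ)).toSubmodule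

/-- `xᵢ(a) = exp (a eᵢ)`. -/
def x (i : p.I) (a : ℂ) : 𝔤 ≃ₗ[ℂ] 𝔤 := expAd (a • p.e i)

/-- `yᵢ(a) = exp (a fᵢ)`. -/
def y (i : p.I) (a : ℂ) : 𝔤 ≃ₗ[ℂ] 𝔤 := expAd (a • p.f i)

/-- The coefficient of `eᵢ` in `z ∈ 𝔤` relative to the root space decomposition: `fᵢ` is
orthogonal for the Killing form to `𝔱` and to all root spaces except `𝔤_{αᵢ} = ℂ eᵢ`. -/
def coeff (i : p.I) (z : 𝔤) : ℂ := killingForm ℂ 𝔤 z (p.f i) / killingForm ℂ 𝔤 (p.e i) (p.f i)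

/-- The character `αᵢ : T → ℂˣ`: `t eᵢ = αᵢ(t) eᵢ`. -/
def rootChar (i : p.I) (t : 𝔤 ≃ₗ[ℂ] 𝔤) : ℂ := p.coeff i (t (p.e i))

/-- The homomorphism `χᵢ : U → ℂ` with `χᵢ(xⱼ(a)) = δᵢⱼ a`. For `u ∈ U`, the component of
`u ϖᵢ - ϖᵢ` in `𝔤_{αᵢ}` is `-χᵢ(u) eᵢ` (as `[eᵢ, ϖᵢ] = -eᵢ`). -/
def chiAt (i : p.I) (u : 𝔤 ≃ₗ[ℂ] 𝔤) : ℂ := -p.coeff i (u (p.coweight i))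

/-- `χ = ∑ᵢ χᵢ`. -/
def chi (u : 𝔤 ≃ₗ[ℂ] 𝔤) : ℂ := ∑ i : p.I, p.chiAt i u

/-- `s̄ᵢ = xᵢ(-1) yᵢ(1) xᵢ(-1)`. -/
def sbar (i : p.I) : 𝔤 ≃ₗ[ℂ] 𝔤 := p.x i (-1) * p.y i 1 * p.x i (-1)

/-- `s̄_{i₁} ⋯ s̄_{iₘ}`. -/
def sbarWord (l : List p.I) : 𝔤 ≃ₗ[ℂ] 𝔤 := (l.map p.sbar).prod

/-- The value at `a ≠ 0` of the cocharacter `αᵢ^∨`: with `wᵢ(a) = xᵢ(a) yᵢ(-a⁻¹) xᵢ(a)`, it is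
`wᵢ(a) wᵢ(1)⁻¹` (in `SL₂`, `diag(a, a⁻¹) = [[0, a], [-a⁻¹, 0]] [[0, 1], [-1, 0]]⁻¹`). -/
def corootChar (i : p.I) (a : ℂ) : 𝔤 ≃ₗ[ℂ] 𝔤 :=
  (p.x i a * p.y i (-a⁻¹) * p.x i a) * (p.x i 1 * p.y i (-1) * p.x i 1)⁻¹

/-- The unique element of `T` with `αᵢ(t) = cᵢ` for all `i` (`cᵢ ≠ 0`); recall that `G` is of
adjoint type, so that `(αᵢ)ᵢ : T → (ℂˣ)ᴵ` is an isomorphism. -/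
def torusElt (c : p.I → ℂ) : 𝔤 ≃ₗ[ℂ] 𝔤 :=
  Classical.epsilon fun t => t ∈ p.T ∧ ∀ i, p.rootChar i t = c i

/-- The logarithm `T_{>0} → 𝔱_ℝ`, inverse to the exponential map: `log t` is the element of
`𝔱` with `αᵢ(log t) = log αᵢ(t)` for all `i`. -/
def logT (t : 𝔤 ≃ₗ[ℂ] 𝔤) : H := ∑ i : p.I, (Real.log (p.rootChar i t).re : ℂ) • p.coweight i

/-- `Z(L_P)`: the elements of `T` killed by all `αᵢ`, `i ∈ I_P = J`. -/
def ZL (J : Set p.I) : Set (𝔤 ≃ₗ[ℂ] 𝔤) := {t | t ∈ p.T ∧ ∀ i ∈ J, p.rootChar i t = 1}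

/-- The anti-automorphism `ι` of `G` fixing all `xᵢ(a)` and `yᵢ(a)` and inverting `T`: it is
`g ↦ ε g⁻¹ ε⁻¹` for the element `ε ∈ T` with `αᵢ(ε) = -1` for all `i`, because
`ε xᵢ(a) ε⁻¹ = xᵢ(-a)` and `ε yᵢ(a) ε⁻¹ = yᵢ(-a)`. -/
def iota (g : 𝔤 ≃ₗ[ℂ] 𝔤) : 𝔤 ≃ₗ[ℂ] 𝔤 :=
  p.torusElt (fun _ => -1) * g⁻¹ * (p.torusElt (fun _ => -1))⁻¹

/-! ### Totally positive parts -/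

/-- `T_{>0}`. -/
def Tpos : Submonoid (𝔤 ≃ₗ[ℂ] 𝔤) :=
  Submonoid.closure {g | ∃ i : p.I, ∃ a : ℝ, 0 < a ∧ g = p.corootChar i a}

/-- `G_{≥0}`. -/
def Gnonneg : Submonoid (𝔤 ≃ₗ[ℂ] 𝔤) :=
  Submonoid.closure {g | ∃ i : p.I, ∃ a : ℝ, 0 < a ∧
    (g = p.corootChar i a ∨ g = p.x i a ∨ g = p.y i a)}

/-- `Z(L_P)_{>0} = Z(L_P) ∩ T_{>0}`. -/
def ZLpos (J : Set p.I) : Set (𝔤 ≃ₗ[ℂ] 𝔤) := p.ZL J ∩ p.Tpos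

/-! ### The parabolic geometric crystal

`ii` is a reduced decomposition of `w_P`; the representative `w̄_P` of `w_P` is
`s̄_{i₁} ⋯ s̄_{iₙ}`, which does not depend on the reduced decomposition. -/

section Crystal

variable (J : Set p.I) {n : ℕ} (ii : Fin n → p.I)

/-- `w̄_P`. -/
def wbar : 𝔤 ≃ₗ[ℂ] 𝔤 := p.sbarWord (List.ofFn ii)

/-- The representative `s̄_{iₙ} ⋯ s̄_{i₁}` of `w_P⁻¹`. -/
def wbarInv : 𝔤 ≃ₗ[ℂ] 𝔤 := p.sbarWord (List.ofFn ii).reverse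

/-- `X = B⁻ ∩ U Z(L_P) w̄_P U`. -/
def X : Set (𝔤 ≃ₗ[ℂ] 𝔤) :=
  {g | g ∈ p.Bminus ∧ ∃ u₁ ∈ p.U, ∃ t ∈ p.ZL J, ∃ u₂ ∈ p.U, g = u₁ * t * p.wbar ii * u₂}

/-- The decoration `f(g) = χ(u₁) + χ(u₂)` for `g = u₁ t w̄_P u₂`. -/
def decoration (g : 𝔤 ≃ₗ[ℂ] 𝔤) : ℂ :=
  let q : (𝔤 ≃ₗ[ℂ] 𝔤) × (𝔤 ≃ₗ[ℂ] 𝔤) := Classical.epsilon fun q =>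
    q.1 ∈ p.U ∧ q.2 ∈ p.U ∧ ∃ t ∈ p.ZL J, g = q.1 * t * p.wbar ii * q.2
  p.chi q.1 + p.chi q.2

/-- The highest weight map `π(g) = t` for `g = u₁ t w̄_P u₂`. -/
def highestWeight (g : 𝔤 ≃ₗ[ℂ] 𝔤) : 𝔤 ≃ₗ[ℂ] 𝔤 :=
  Classical.epsilon fun t => t ∈ p.ZL J ∧ ∃ u₁ ∈ p.U, ∃ u₂ ∈ p.U, g = u₁ * t * p.wbar ii * u₂

/-- The weight map `γ(g) = t₀` for `g = u₀ t₀`, `u₀ ∈ U⁻`, `t₀ ∈ T`. -/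
def weightMap (g : 𝔤 ≃ₗ[ℂ] 𝔤) : 𝔤 ≃ₗ[ℂ] 𝔤 :=
  Classical.epsilon fun t₀ => t₀ ∈ p.T ∧ ∃ u₀ ∈ p.Uminus, g = u₀ * t₀

/-- `(B⁻_{w_P})_{>0} = B⁻ ∩ U w̄_P U ∩ G_{≥0}`. -/
def BminusPos : Set (𝔤 ≃ₗ[ℂ] 𝔤) :=
  {g | g ∈ p.Bminus ∧ (∃ u₁ ∈ p.U, ∃ u₂ ∈ p.U, g = u₁ * p.wbar ii * u₂) ∧ g ∈ p.Gnonneg}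

/-- The totally positive part `X_{>0}` of `X`. -/
def Xpos : Set (𝔤 ≃ₗ[ℂ] 𝔤) := p.ZLpos J * p.BminusPos ii

/-- The totally positive fiber `X_{t,>0} = π⁻¹(t) ∩ X_{>0}`. -/
def XposFiber (t : 𝔤 ≃ₗ[ℂ] 𝔤) : Set (𝔤 ≃ₗ[ℂ] 𝔤) :=
  {g | g ∈ p.X J ii ∧ p.highestWeight J ii g = t ∧ g ∈ p.Xpos J ii}

/-- The twist map `η : U ∩ B⁻ w_P B⁻ → B⁻ ∩ U w̄_P U`, `η(g) = ι(b)`, where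
`g s̄_{iₙ} ⋯ s̄_{i₁} = b u` with `b ∈ B⁻` and `u ∈ U`. -/
def twist (g : 𝔤 ≃ₗ[ℂ] 𝔤) : 𝔤 ≃ₗ[ℂ] 𝔤 :=
  p.iota (Classical.epsilon fun b => b ∈ p.Bminus ∧ ∃ u ∈ p.U, g * p.wbarInv ii = b * u)

/-- The torus chart `θ(t, a) = t · η(x_{i₁}(a₁) ⋯ x_{iₙ}(aₙ))` of `X`. -/
def chart (t : 𝔤 ≃ₗ[ℂ] 𝔤) (a : Fin n → ℂ) : 𝔤 ≃ₗ[ℂ] 𝔤 :=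
  t * p.twist ii (List.ofFn fun k => p.x (ii k) (a k)).prod

/-! ### The volume form -/

/-- The preimage in `G` of the open projected Richardson variety in `G/P`, i.e. of the image
in `G/P` of `(B⁻ w₀ᴾ B/B) ∩ (B w₀ B/B)`. -/
def openRichardson : Set (𝔤 ≃ₗ[ℂ] 𝔤) :=
  {g | g ∈ p.G ∧ ∃ q ∈ p.P J,
    (∃ l, p.weylWord l = p.longest J ∧ ∃ b ∈ p.Bminus, ∃ b' ∈ p.B,
      g * q = b * p.sbarWord l * b') ∧
    (∃ l, p.weylWord l = p.longest Set.univ ∧ ∃ b ∈ p.B, ∃ b' ∈ p.B,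
      g * q = b * p.sbarWord l * b')}

/-- The left logarithmic derivative `g(τ)⁻¹ g'(τ)` of a curve in `G`, an element of
`Lie G = 𝔤 ≅ ad 𝔤`. The derivative is taken weakly: for every `z ∈ 𝔤` and every linear form. -/
def leftLogDeriv (g : ℂ → (𝔤 ≃ₗ[ℂ] 𝔤)) (τ : ℂ) : 𝔤 :=
  Classical.epsilon fun v : 𝔤 => ∀ (z : 𝔤) (φ : Dual ℂ 𝔤),
    HasDerivAt (fun σ => φ (g σ z)) (φ (g τ ⁅v, z⁆)) τ

/-- The pull-back of a top degree form `ω` on the open projected Richardson variety along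
`a ↦ θ(t, a)⁻¹ P`, as the coefficient of `da₁ ∧ ⋯ ∧ daₙ`. Here `ω` is given by its pull-back
to `G`, in the trivialization of the tangent bundle of `G` by left translations. -/
def pullbackCoeff (ω : (𝔤 ≃ₗ[ℂ] 𝔤) → 𝔤 [⋀^Fin n]→ₗ[ℂ] ℂ) (t : 𝔤 ≃ₗ[ℂ] 𝔤) (a : Fin n → ℂ) : ℂ :=
  ω (p.chart ii t a)⁻¹ fun k =>
    leftLogDeriv (fun τ => (p.chart ii t (Function.update a k τ))⁻¹) (a k)

/-- `ω` is the volume form on the open projected Richardson variety `𝓡 ⊆ G/P` which has simple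
poles along all the irreducible components of the boundary divisor `(G/P) ∖ 𝓡`, rescaled so
that the induced fiberwise volume form `vol` on `X` (the pull-back of `ω` along `g ↦ g⁻¹P`)
becomes `da₁ ∧ ⋯ ∧ daₙ / (a₁ ⋯ aₙ)` in the torus chart of the reduced decomposition `ii`.

A top degree form on `𝓡` is given by its pull-back `ω` to the preimage of `𝓡` in `G`, in the
left trivialization: a function with values in the alternating `n`-forms on `𝔤`, horizontal
and equivariant for the action of `P` by right translations. -/
structure IsVolumeForm (ω : (𝔤 ≃ₗ[ℂ] 𝔤) → 𝔤 [⋀^Fin n]→ₗ[ℂ] ℂ) : Prop where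
  horizontal : ∀ g ∈ p.openRichardson J, ∀ v : Fin n → 𝔤, (∃ k, v k ∈ p.lieP J) → ω g v = 0
  equivariant : ∀ g ∈ p.openRichardson J, ∀ q ∈ p.P J, ∀ v : Fin n → 𝔤,
    ω (g * q) v = ω g fun k => q (v k)
  /-- In each of the affine charts `c ↦ g exp(∑ cₖ Eₖ) P` (`g ∈ G`), which cover `G/P`, the
  boundary has a reduced equation `φ = 0`, and `φ ω` is regular and nowhere vanishing on the
  chart. -/
  simplePoles : ∀ g ∈ p.G, ∀ E : Basis (Fin n) ℂ (p.nilP J),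
    ∃ φ ψ : MvPolynomial (Fin n) ℂ, Squarefree φ ∧ (∀ c, MvPolynomial.eval c ψ ≠ 0) ∧
      ∀ c : Fin n → ℂ,
        (g * expAd (∑ k, c k • (E k : 𝔤)) ∈ p.openRichardson J ↔ MvPolynomial.eval c φ ≠ 0) ∧
        (MvPolynomial.eval c φ ≠ 0 →
          MvPolynomial.eval c φ * ω (g * expAd (∑ k, c k • (E k : 𝔤))) (fun k => (E k : 𝔤))
            = MvPolynomial.eval c ψ)
  normalized : ∀ t ∈ p.ZL J, ∀ a : Fin n → ℂ, (∀ k, a k ≠ 0) →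
    p.pullbackCoeff ii ω t a = ∏ k, (a k)⁻¹

/-! ### The oscillatory integral -/

/-- The part of the positive orthant that the chart `θ(t, ·)`, which defines the orientation of
the totally positive fiber over `t`, sends to the totally positive fiber. -/
def chartDomain (t : 𝔤 ≃ₗ[ℂ] 𝔤) : Set (Fin n → ℝ) :=
  {a | (∀ k, 0 < a k) ∧ p.chart ii t (fun k => (a k : ℂ)) ∈ p.XposFiber J ii t}

/-- The integrand `e^{-f/ħ} γ^{h/ħ} vol` on the totally positive fiber over `t`, in the oriented
chart `θ(t, ·)`; here `γ^{h/ħ} = exp (⟨h, log γ⟩ / ħ)`. -/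
def integrand (ω : (𝔤 ≃ₗ[ℂ] 𝔤) → 𝔤 [⋀^Fin n]→ₗ[ℂ] ℂ) (ħ : ℝ) (h : Dual ℂ H)
    (t : 𝔤 ≃ₗ[ℂ] 𝔤) (a : Fin n → ℝ) : ℂ :=
  let g := p.chart ii t (fun k => (a k : ℂ))
  Complex.exp (-p.decoration J ii g / ħ) * Complex.exp (h (p.logT (p.weightMap g)) / ħ) *
    p.pullbackCoeff ii ω t (fun k => (a k : ℂ))

/-- The oscillatory integral `I_B(ħ, h, t, [vol]) = ∫_{X_{t,>0}} e^{-f/ħ} γ^{h/ħ} vol`. -/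
def IB (ω : (𝔤 ≃ₗ[ℂ] 𝔤) → 𝔤 [⋀^Fin n]→ₗ[ℂ] ℂ) (ħ : ℝ) (h : Dual ℂ H) (t : 𝔤 ≃ₗ[ℂ] 𝔤) : ℂ :=
  ∫ a in p.chartDomain J ii t, p.integrand J ii ω ħ h t a

end Crystal

open Classical in
/-- `t_λ(s)`: the element of `Z(L_P)` with `αᵢ(t_λ(s)) = s^{λ(αᵢ)}` for all `i ∉ I_P = J`. -/
def tLam (J : Set p.I) (lam : H) (s : ℝ) : 𝔤 ≃ₗ[ℂ] 𝔤 :=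
  p.torusElt fun i => if i ∈ J then 1 else (s : ℂ) ^ (p.simpleRoot i lam)

end Pinning

end RietschMirror

end

/-!
Everything takes place in the group of linear automorphisms of `𝔤`, where `G` of adjoint type is
the group generated by the `exp (ad x)` for root vectors `x`. The integral is computed in the
torus chart attached to the reduced word `(i₁, …, iₗ)` of `w_P`, and it turns out to be a damped
product of Gamma integrals.

*The chart.* For `a > 0` the relations `xᵢ(a) s̄ᵢ ∈ U⁻ T U` and `xᵢ(a) yᵢ(c) ∈ U⁻ T U` in `SL₂`
give, by induction on the word, a factorization
`x_{i₁}(a₁) ⋯ x_{iₗ}(aₗ) s̄_{iₗ} ⋯ s̄_{i₁} = n τ u`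
with `n` a product of elements `yᵢ` with positive parameters, `τ = ∏ βₖ^∨(aₖ)` for the roots
`βₖ = s_{i₁} ⋯ s_{iₖ₋₁} α_{iₖ}`, and `u ∈ U` (`xWord_mul_sbarWord`). Since `ι` reverses products,
`θ(t, a)` is both `t τ⁻¹ ι(n)` and `t ι(u⁻¹) w̄_P x_{iₗ}(aₗ) ⋯ x_{i₁}(a₁)`. The first form shows
that `θ(t, a)` is totally positive, so that the chart covers the whole positive orthant, and that
`γ = t τ⁻¹`. The second form shows that `f = ∑ aₖ + ∑ αᵢ(t) rᵢ(a)` with `rᵢ = -χᵢ(u)`. The factor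
`u` is a product of elements `exp (-dₖ v_k)`, where `dₖ > 0` and `v_k` is the root vector of `βₖ`
obtained from `e_{iₖ}` by the inverse of `s̄_{iₖ₋₁} ⋯ s̄_{i₁}`. As `v_k = eᵢ` if `βₖ = αᵢ`, the
functions `rᵢ` are non-negative, do not depend on `t`, and vanish for `i ∈ I_P` because the `βₖ`
enumerate `R⁺ ∖ R_P⁺` (`chiAt_conj_uWord`, `exists_chart_formula`).

*Uniqueness.* The maps `f`, `π` and `γ` are defined by choosing factorizations, so one has to know
that the values do not depend on the choices. The torus parts are unique by comparing degrees with
respect to `ρ^∨` (`eq_one_of_mem_filtStab_neg`, `tor_eq_one_of_mul_sbarWord_eq`). For `f` one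
shows that if `u, v ∈ U` are conjugate by `t w̄_P` with `t ∈ Z(L_P)`, then `χ(u) = χ(v)`: the
value `χᵢ(u)` vanishes for `i ∉ I_P`, and equals `χⱼ(v)` if `w_P⁻¹ αᵢ = αⱼ`
(`chi_eq_chi_of_conj`). Here the characters `χᵢ` are read off from the action of `U` on `𝔱` by
means of the Killing form.

*Signs.* Both parts use that a representative `s̄_{i₁} ⋯ s̄_{iₙ}` of `w` for a reduced word
carries `eⱼ` to `eᵢ`, without a sign, whenever `w αⱼ = αᵢ` (`sbarWord_apply_e`). This follows by
induction on the length from the rank two systems, which are treated one by one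
(`exists_rankTwoWord`), together with the independence of the representative of the reduced word
(`sbarWord_eq_of_weylWord_eq`).

*The limit.* The volume form enters only through its normalization in the chart. The integrand is
`s^{λ(h)/ħ}` times `exp (-ħ⁻¹ ∑ αᵢ(t) rᵢ(a)) ∏ aₖ^{-βₖ^∨(h)/ħ} e^{-aₖ/ħ} daₖ/aₖ`, where
`t = t_λ(s)`. It is dominated by the same product without the damping factor, which is integrable as
the exponents have positive real part. As `s → 0` the numbers `αᵢ(t)` tend to zero for `i ∉ I_P`,
so the damping factor tends to one, and what is left is a product of Gamma integrals over the `βₖ`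
(`tendsto_setIntegral_damped`, `integral_asymptotics`).
-/

set_option linter.unusedSectionVars false

noncomputable section

namespace RietschMirror

open LieAlgebra LieAlgebra.IsKilling

/-! ### Exponentials of nilpotent derivations -/

section Exponential

variable {𝔤 : Type*} [LieRing 𝔤] [LieAlgebra ℂ 𝔤]

/-- The exponential series applied to `z` may be truncated at any `N` with `(ad x)^N z = 0`. -/
theorem adExpSeries_apply {x : 𝔤} (hx : IsNilpotent (LieAlgebra.ad ℂ 𝔤 x)) {z : 𝔤} {N : ℕ}
    (hz : ((LieAlgebra.ad ℂ 𝔤 x) ^ N) z = 0) :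
    adExpSeries x z =
      ∑ k ∈ Finset.range N, ((k.factorial : ℂ)⁻¹) • ((LieAlgebra.ad ℂ 𝔤 x) ^ k) z := by
  have h1 : ∀ k, N ≤ k → ((LieAlgebra.ad ℂ 𝔤 x) ^ k) z = 0 := fun k hk => by
    rw [← Nat.sub_add_cancel hk, pow_add, Module.End.mul_apply, hz, map_zero]
  have h2 : ∀ k, nilpotencyClass (LieAlgebra.ad ℂ 𝔤 x) ≤ k →
      ((LieAlgebra.ad ℂ 𝔤 x) ^ k) z = 0 := fun k hk => by
    rw [pow_eq_zero_of_le hk (pow_nilpotencyClass hx), LinearMap.zero_apply]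
  have h3 : adExpSeries x z = ∑ k ∈ Finset.range (nilpotencyClass (LieAlgebra.ad ℂ 𝔤 x)),
      ((k.factorial : ℂ)⁻¹) • ((LieAlgebra.ad ℂ 𝔤 x) ^ k) z := by
    simp [adExpSeries, LinearMap.sum_apply]
  rw [h3]
  rcases le_total N (nilpotencyClass (LieAlgebra.ad ℂ 𝔤 x)) with h | h
  · refine (Finset.sum_subset (Finset.range_mono h) fun k _ hk => ?_).symm
    rw [h1 k (by simpa using hk), smul_zero]
  · refine Finset.sum_subset (Finset.range_mono h) fun k _ hk => ?_
    rw [h2 k (by simpa using hk), smul_zero]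

theorem coe_expAd {x : 𝔤} (hx : IsNilpotent (LieAlgebra.ad ℂ 𝔤 x)) (z : 𝔤) :
    expAd x z = adExpSeries x z := by
  simp only [expAd, dif_pos hx]; rfl

theorem expAd_apply {x : 𝔤} (hx : IsNilpotent (LieAlgebra.ad ℂ 𝔤 x)) {z : 𝔤} {N : ℕ}
    (hz : ((LieAlgebra.ad ℂ 𝔤 x) ^ N) z = 0) :
    expAd x z =
      ∑ k ∈ Finset.range N, ((k.factorial : ℂ)⁻¹) • ((LieAlgebra.ad ℂ 𝔤 x) ^ k) z := by
  rw [coe_expAd hx, adExpSeries_apply hx hz]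

theorem expAd_apply_of_lie_eq_zero {x z : 𝔤} (hx : IsNilpotent (LieAlgebra.ad ℂ 𝔤 x))
    (h : ⁅x, z⁆ = 0) : expAd x z = z := by
  rw [expAd_apply hx (N := 1) (by simpa using h)]; simp

theorem expAd_apply_of_lie_lie_eq_zero {x z : 𝔤} (hx : IsNilpotent (LieAlgebra.ad ℂ 𝔤 x))
    (h : ⁅x, ⁅x, z⁆⁆ = 0) : expAd x z = z + ⁅x, z⁆ := by
  rw [expAd_apply hx (N := 2) (by simpa [pow_succ] using h)]; simp [Finset.sum_range_succ]

theorem expAd_apply_of_lie_lie_lie_eq_zero {x z : 𝔤} (hx : IsNilpotent (LieAlgebra.ad ℂ 𝔤 x))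
    (h : ⁅x, ⁅x, ⁅x, z⁆⁆⁆ = 0) : expAd x z = z + ⁅x, z⁆ + (2⁻¹ : ℂ) • ⁅x, ⁅x, z⁆⁆ := by
  rw [expAd_apply hx (N := 3) (by simpa [pow_succ] using h)]
  simp [Finset.sum_range_succ, pow_succ, Nat.factorial]

theorem commute_ad {x y : 𝔤} (hxy : ⁅x, y⁆ = 0) :
    Commute (LieAlgebra.ad ℂ 𝔤 x) (LieAlgebra.ad ℂ 𝔤 y) := by
  refine LinearMap.ext fun z => ?_
  rw [Module.End.mul_apply, Module.End.mul_apply]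
  simp only [LieAlgebra.ad_apply]
  rw [leibniz_lie, hxy, zero_lie, zero_add]

theorem adExpSeries_add {x y : 𝔤} (hx : IsNilpotent (LieAlgebra.ad ℂ 𝔤 x))
    (hy : IsNilpotent (LieAlgebra.ad ℂ 𝔤 y)) (hxy : ⁅x, y⁆ = 0) :
    adExpSeries (x + y) = adExpSeries x * adExpSeries y := by
  let _i : Algebra ℚ (Module.End ℂ 𝔤) :=
    ((algebraMap ℂ (Module.End ℂ 𝔤)).comp (algebraMap ℚ ℂ)).toAlgebra'
      fun c f => Algebra.commutes (algebraMap ℚ ℂ c) f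
  have key : ∀ y : 𝔤, adExpSeries y = IsNilpotent.exp (LieAlgebra.ad ℂ 𝔤 y) := by
    intro y
    refine Finset.sum_congr rfl fun k _ => ?_
    rw [Algebra.smul_def, Algebra.smul_def]
    change _ = algebraMap ℂ (Module.End ℂ 𝔤) (algebraMap ℚ ℂ _) * _
    simp
  rw [key, key, key, map_add]
  exact IsNilpotent.exp_add_of_commute (commute_ad hxy) hx hy

theorem expAd_add {x y : 𝔤} (hx : IsNilpotent (LieAlgebra.ad ℂ 𝔤 x))
    (hy : IsNilpotent (LieAlgebra.ad ℂ 𝔤 y)) (hxy : ⁅x, y⁆ = 0) :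
    expAd (x + y) = expAd x * expAd y := by
  have h : IsNilpotent (LieAlgebra.ad ℂ 𝔤 (x + y)) := by
    rw [map_add]
    exact Commute.isNilpotent_add (commute_ad hxy) hx hy
  ext z
  rw [LinearEquiv.mul_apply, coe_expAd h, coe_expAd hx, coe_expAd hy, adExpSeries_add hx hy hxy]
  rfl

theorem isNilpotent_ad_smul {x : 𝔤} (hx : IsNilpotent (LieAlgebra.ad ℂ 𝔤 x)) (a : ℂ) :
    IsNilpotent (LieAlgebra.ad ℂ 𝔤 (a • x)) := by
  rw [map_smul]; exact hx.smul a

theorem expAd_add_smul {x : 𝔤} (hx : IsNilpotent (LieAlgebra.ad ℂ 𝔤 x)) (a b : ℂ) :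
    expAd ((a + b) • x) = expAd (a • x) * expAd (b • x) := by
  rw [add_smul]
  exact expAd_add (isNilpotent_ad_smul hx a) (isNilpotent_ad_smul hx b) (by simp)

theorem expAd_zero : expAd (0 : 𝔤) = 1 := by
  have : IsNilpotent (LieAlgebra.ad ℂ 𝔤 (0 : 𝔤)) := by rw [map_zero]; exact IsNilpotent.zero
  ext z
  rw [expAd_apply_of_lie_eq_zero this (by simp)]; rfl

variable (𝔤) in
/-- The group of Lie algebra automorphisms of `𝔤`, inside the linear group of `𝔤`. -/
def lieAut : Subgroup (𝔤 ≃ₗ[ℂ] 𝔤) where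
  carrier := {g | ∀ x y : 𝔤, g ⁅x, y⁆ = ⁅g x, g y⁆}
  mul_mem' {a b} ha hb x y := by
    simp only [LinearEquiv.mul_apply, hb x y]; exact ha _ _
  one_mem' _ _ := rfl
  inv_mem' {a} ha x y := by
    apply a.injective
    have h : ∀ z, a (a⁻¹ z) = z := fun z => a.apply_symm_apply z
    rw [ha, h, h, h]

theorem apply_inv_apply (g : 𝔤 ≃ₗ[ℂ] 𝔤) (z : 𝔤) : g (g⁻¹ z) = z := g.apply_symm_apply z

theorem inv_apply_apply (g : 𝔤 ≃ₗ[ℂ] 𝔤) (z : 𝔤) : g⁻¹ (g z) = z := g.symm_apply_apply z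

theorem expAd_mem_lieAut (x : 𝔤) : expAd x ∈ lieAut 𝔤 := by
  by_cases hx : IsNilpotent (LieAlgebra.ad ℂ 𝔤 x)
  · intro y z
    let _i : Module ℚ 𝔤 := Module.compHom 𝔤 (algebraMap ℚ ℂ)
    let _j : LieAlgebra ℚ 𝔤 := { lie_smul := fun t y z => lie_smul (algebraMap ℚ ℂ t) y z }
    have hD : (LieDerivation.ad ℂ 𝔤 x).toLinearMap = LieAlgebra.ad ℂ 𝔤 x := by
      ext; simp
    have h : IsNilpotent (LieDerivation.ad ℂ 𝔤 x).toLinearMap := by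
      rwa [hD]
    have key : ∀ z, expAd x z = (LieDerivation.ad ℂ 𝔤 x).exp h z := by
      intro z
      rw [LieDerivation.exp_map_apply, coe_expAd hx, hD, adExpSeries, IsNilpotent.exp,
        LinearMap.sum_apply, LinearMap.sum_apply]
      refine Finset.sum_congr rfl fun k _ => ?_
      rw [LinearMap.smul_apply, LinearMap.smul_apply]
      change _ = (algebraMap ℚ ℂ ((k.factorial : ℚ)⁻¹)) • (((LieAlgebra.ad ℂ 𝔤 x) ^ k) z)
      simp
    rw [key, key, key, LieEquiv.map_lie]
  · rw [expAd, dif_neg hx]; exact one_mem _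

theorem conj_ad_of_mem_lieAut {g : 𝔤 ≃ₗ[ℂ] 𝔤} (hg : g ∈ lieAut 𝔤) (x : 𝔤) (k : ℕ) (z : 𝔤) :
    ((LieAlgebra.ad ℂ 𝔤 (g x)) ^ k) z = g (((LieAlgebra.ad ℂ 𝔤 x) ^ k) (g⁻¹ z)) := by
  induction k with
  | zero => simp
  | succ k ih =>
    rw [pow_succ', pow_succ', Module.End.mul_apply, Module.End.mul_apply, ih, LieAlgebra.ad_apply,
      LieAlgebra.ad_apply, hg]

theorem isNilpotent_ad_map {g : 𝔤 ≃ₗ[ℂ] 𝔤} (hg : g ∈ lieAut 𝔤) {x : 𝔤}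
    (hx : IsNilpotent (LieAlgebra.ad ℂ 𝔤 x)) : IsNilpotent (LieAlgebra.ad ℂ 𝔤 (g x)) := by
  obtain ⟨k, hk⟩ := hx
  refine ⟨k, LinearMap.ext fun z => ?_⟩
  rw [conj_ad_of_mem_lieAut hg, hk]; simp

theorem conj_expAd {g : 𝔤 ≃ₗ[ℂ] 𝔤} (hg : g ∈ lieAut 𝔤) {x : 𝔤}
    (hx : IsNilpotent (LieAlgebra.ad ℂ 𝔤 x)) : g * expAd x * g⁻¹ = expAd (g x) := by
  obtain ⟨N, hN⟩ := id hx
  ext z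
  rw [expAd_apply (isNilpotent_ad_map hg hx) (N := N)
    (by rw [conj_ad_of_mem_lieAut hg, hN]; simp), LinearEquiv.mul_apply, LinearEquiv.mul_apply,
    expAd_apply hx (N := N) (by rw [hN]; simp), map_sum]
  simp_rw [conj_ad_of_mem_lieAut hg, map_smul]

end Exponential

/-! ### Weight spaces and the degree filtration -/

section WeightSpaces

variable {𝔤 : Type*} [LieRing 𝔤] [LieAlgebra ℂ 𝔤]

/-- The simultaneous eigenspace of `H` on `𝔤` for the linear form `χ`. -/
def wtSpace (H : LieSubalgebra ℂ 𝔤) (χ : Dual ℂ H) : Submodule ℂ 𝔤 where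
  carrier := {z | ∀ x : H, ⁅(x : 𝔤), z⁆ = χ x • z}
  add_mem' {a b} ha hb x := by rw [lie_add, ha x, hb x, smul_add]
  zero_mem' x := by simp
  smul_mem' c z hz x := by rw [lie_smul, hz x, smul_comm]

variable {H : LieSubalgebra ℂ 𝔤}

theorem mem_wtSpace {χ : Dual ℂ H} {z : 𝔤} :
    z ∈ wtSpace H χ ↔ ∀ x : H, ⁅(x : 𝔤), z⁆ = χ x • z := Iff.rfl

theorem lie_mem_wtSpace {χ ψ : Dual ℂ H} {y z : 𝔤} (hy : y ∈ wtSpace H χ) (hz : z ∈ wtSpace H ψ) :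
    ⁅y, z⁆ ∈ wtSpace H (χ + ψ) := by
  intro x
  rw [leibniz_lie, hy x, hz x, smul_lie, lie_smul, LinearMap.add_apply, add_smul]

/-- The part of `𝔤` of real `ρ`-degree at least `r`. -/
def filt (ρ : H) (r : ℝ) : Submodule ℂ 𝔤 :=
  ⨆ (χ : Dual ℂ H) (_ : r ≤ (χ ρ).re), wtSpace H χ

theorem mem_filt {ρ : H} {r : ℝ} {χ : Dual ℂ H} (h : r ≤ (χ ρ).re) {z : 𝔤}
    (hz : z ∈ wtSpace H χ) : z ∈ filt ρ r :=
  (le_iSup₂_of_le χ h le_rfl : wtSpace H χ ≤ filt ρ r) hz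

theorem filt_le {ρ : H} {r : ℝ} {N : Submodule ℂ 𝔤}
    (h : ∀ χ : Dual ℂ H, r ≤ (χ ρ).re → wtSpace H χ ≤ N) : filt ρ r ≤ N :=
  iSup₂_le h

theorem filt_anti (ρ : H) {r s : ℝ} (h : r ≤ s) : filt ρ s ≤ filt ρ r :=
  filt_le fun _ hχ _ hz => mem_filt (h.trans hχ) hz

variable [FiniteDimensional ℂ 𝔤]

/-- The group of those linear automorphisms of `𝔤` which differ from the identity by a map
raising the `ρ`-degree by at least one. -/
def unipotentFor (ρ : H) : Subgroup (𝔤 ≃ₗ[ℂ] 𝔤) where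
  carrier := {g | ∀ r, ∀ z ∈ filt ρ r, g z - z ∈ filt ρ (r + 1)}
  mul_mem' {a b} ha hb r z hz := by
    have h1 := hb r z hz
    have h2 := ha _ _ h1
    have h3 := ha r z hz
    rw [LinearEquiv.mul_apply]
    have : a (b z) - z = (a (b z - z) - (b z - z)) + (b z - z) + (a z - z) := by
      rw [map_sub]; abel
    rw [this]
    exact add_mem (add_mem (filt_anti ρ (by linarith) h2) h1) h3
  one_mem' r z _ := by simp
  inv_mem' {a} ha r z hz := by
    have hmaps : ∀ y ∈ filt ρ r, a.toLinearMap y ∈ filt ρ r := fun y hy => by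
      have := add_mem (filt_anti ρ (by linarith) (ha r y hy)) hy
      simpa using this
    let f : filt ρ r →ₗ[ℂ] filt ρ r := a.toLinearMap.restrict hmaps
    have hf : Function.Injective f := fun x y hxy =>
      Subtype.ext (a.injective (congrArg Subtype.val hxy))
    obtain ⟨y, hy⟩ := LinearMap.injective_iff_surjective.mp hf ⟨z, hz⟩
    have hy' : a y = z := congrArg Subtype.val hy
    rw [← hy', inv_apply_apply, ← neg_sub]
    exact neg_mem (ha r y y.2)

variable [IsKilling ℂ 𝔤] [H.IsCartanSubalgebra]

theorem mem_wtSpace_iff_mem_rootSpace {χ : Dual ℂ H} {z : 𝔤} :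
    z ∈ wtSpace H χ ↔ z ∈ rootSpace H (χ : H → ℂ) := by
  refine ⟨fun h => (LieModule.mem_genWeightSpace 𝔤 _ z).mpr fun x => ⟨1, ?_⟩,
    fun h x => lie_eq_smul_of_mem_rootSpace h x⟩
  have := h x
  simp only [pow_one, LinearMap.sub_apply, LieModule.toEnd_apply_apply,
    LieSubalgebra.coe_bracket_of_module, this]
  simp

theorem mem_wtSpace_zero {z : 𝔤} : z ∈ wtSpace H 0 ↔ z ∈ H := by
  rw [mem_wtSpace_iff_mem_rootSpace]
  change z ∈ rootSpace H (0 : H → ℂ) ↔ _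
  rw [rootSpace_zero_eq, LieSubalgebra.mem_toLieSubmodule]

theorem mem_wtSpace_root {α : H.root} {z : 𝔤} :
    z ∈ wtSpace H ((rootSystem H).root α) ↔ z ∈ rootSpace H (α.1 : H → ℂ) :=
  mem_wtSpace_iff_mem_rootSpace

theorem isNilpotent_ad_of_mem_wtSpace {χ : Dual ℂ H} (hχ : χ ≠ 0) {x : 𝔤} (hx : x ∈ wtSpace H χ) :
    IsNilpotent (LieAlgebra.ad ℂ 𝔤 x) := by
  refine LieAlgebra.isNilpotent_ad_of_mem_rootSpace H (χ := χ) (fun h => hχ ?_)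
    (mem_wtSpace_iff_mem_rootSpace.mp hx)
  exact LinearMap.ext fun x => congrFun h x

theorem exists_root_of_wtSpace_ne_bot {χ : Dual ℂ H} (hχ : χ ≠ 0) {z : 𝔤} (hz : z ∈ wtSpace H χ)
    (hz0 : z ≠ 0) : ∃ α : H.root, (rootSystem H).root α = χ := by
  have hne : LieModule.genWeightSpace 𝔤 (χ : H → ℂ) ≠ ⊥ := fun h => hz0 (by
    have := mem_wtSpace_iff_mem_rootSpace.mp hz
    rw [rootSpace, h] at this
    simpa using this)
  let α : LieModule.Weight ℂ H 𝔤 := ⟨χ, hne⟩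
  refine ⟨⟨α, ?_⟩, ?_⟩
  · simp only [LieSubalgebra.root, Finset.mem_filter, Finset.mem_univ, true_and]
    exact fun h => hχ (LinearMap.ext fun x => congrFun h x)
  · ext x; rfl

theorem iSup_wtSpace_eq_top : ⨆ χ : Dual ℂ H, wtSpace H χ = ⊤ := by
  rw [eq_top_iff, ← LieSubmodule.top_toSubmodule (R := ℂ) (L := H),
    ← LieModule.iSup_genWeightSpace_eq_top' ℂ H 𝔤, LieSubmodule.iSup_toSubmodule]
  refine iSup_le fun χ z hz => ?_
  exact (le_iSup (wtSpace H) χ.toLinear) (mem_wtSpace_iff_mem_rootSpace.mpr hz)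

/-- Linear maps out of `𝔤` which agree on all weight vectors are equal. -/
theorem linearMap_ext_wtSpace {V : Type*} [AddCommGroup V] [Module ℂ V] {f g : 𝔤 →ₗ[ℂ] V}
    (h : ∀ χ : Dual ℂ H, ∀ z ∈ wtSpace H χ, f z = g z) : f = g := by
  have : (⨆ χ : Dual ℂ H, wtSpace H χ) ≤ LinearMap.eqLocus f g := iSup_le h
  rw [iSup_wtSpace_eq_top] at this
  exact LinearMap.ext fun z => this trivial

theorem killingForm_eq_zero_of_wtSpace {χ ψ : Dual ℂ H} (h : χ + ψ ≠ 0) {y z : 𝔤}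
    (hy : y ∈ wtSpace H χ) (hz : z ∈ wtSpace H ψ) : killingForm ℂ 𝔤 y z = 0 := by
  refine killingForm_apply_eq_zero_of_mem_rootSpace_of_add_ne_zero ℂ 𝔤 H
    (mem_wtSpace_iff_mem_rootSpace.mp hy) (mem_wtSpace_iff_mem_rootSpace.mp hz) fun h' => h ?_
  exact LinearMap.ext fun x => congrFun h' x

theorem eq_zero_of_killingForm_wtSpace {z : 𝔤}
    (h : ∀ χ : Dual ℂ H, ∀ y ∈ wtSpace H χ, killingForm ℂ 𝔤 z y = 0) : z = 0 := by
  have h1 : killingForm ℂ 𝔤 z = 0 := linearMap_ext_wtSpace (H := H) h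
  have h2 : z ∈ LinearMap.ker (killingForm ℂ 𝔤) := h1
  rwa [LieAlgebra.IsKilling.ker_killingForm_eq_bot, Submodule.mem_bot] at h2

/-- The parts of degree at least `r` and at least `s` are orthogonal for the Killing form if `0 < r
+ s`, since weight spaces are orthogonal unless their weights are opposite. -/
theorem killingForm_filt_eq_zero {ρ : H} {r s : ℝ} (hrs : 0 < r + s) {y z : 𝔤}
    (hy : y ∈ filt ρ r) (hz : z ∈ filt ρ s) : killingForm ℂ 𝔤 y z = 0 := by
  have h1 : filt ρ r ≤ LinearMap.ker ((killingForm ℂ 𝔤).flip z) := by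
    refine filt_le fun χ hχ y hy => ?_
    have h2 : filt ρ s ≤ LinearMap.ker (killingForm ℂ 𝔤 y) := by
      refine filt_le fun ψ hψ z hz => killingForm_eq_zero_of_wtSpace (fun h => ?_) hy hz
      have := congrArg (fun φ : Dual ℂ H => (φ ρ).re) h
      simp at this
      linarith
    exact h2 hz
  exact h1 hy

/-- The filtrations by degree for `ρ` and `-ρ` are transversal: the Killing form is nondegenerate
and pairs opposite weights. -/
theorem eq_zero_of_mem_filt_of_mem_filt_neg {ρ : H} {r s : ℝ} (hrs : 0 < r + s) {z : 𝔤}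
    (h1 : z ∈ filt ρ r) (h2 : z ∈ filt (-ρ) s) : z = 0 := by
  refine eq_zero_of_killingForm_wtSpace (H := H) fun χ y hy => ?_
  by_cases h : 0 < r + (χ ρ).re
  · exact killingForm_filt_eq_zero h h1 (mem_filt le_rfl hy)
  · refine killingForm_filt_eq_zero (ρ := -ρ) (s := -(χ ρ).re) (by linarith) h2
      (mem_filt (by simp) hy)

theorem expAd_mem_unipotentFor {ρ : H} {χ : Dual ℂ H} (hχ : 1 ≤ (χ ρ).re) {x : 𝔤}
    (hx : x ∈ wtSpace H χ) : expAd x ∈ unipotentFor ρ := by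
  have hχ0 : χ ≠ 0 := by rintro rfl; simp at hχ; linarith
  have hn := isNilpotent_ad_of_mem_wtSpace hχ0 hx
  intro r
  change filt ρ r ≤ (filt ρ (r + 1)).comap ((expAd x).toLinearMap - LinearMap.id)
  refine filt_le fun ψ hψ z hz => ?_
  change expAd x z - z ∈ filt ρ (r + 1)
  obtain ⟨N, hN⟩ := id hn
  rw [expAd_apply hn (N := N + 1) (by rw [pow_succ, hN]; simp), Finset.sum_range_succ']
  simp only [pow_zero, Nat.factorial_zero, Nat.cast_one, inv_one, one_smul, Module.End.one_apply,
    add_sub_cancel_right]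
  refine Submodule.sum_mem _ fun k _ => Submodule.smul_mem _ _ ?_
  have key : ∀ k : ℕ, ((LieAlgebra.ad ℂ 𝔤 x) ^ k) z ∈ wtSpace H ((k : ℂ) • χ + ψ) := by
    intro k
    induction k with
    | zero => simpa using hz
    | succ k ih =>
      rw [pow_succ', Module.End.mul_apply, LieAlgebra.ad_apply]
      convert lie_mem_wtSpace hx ih using 2
      push_cast; module
  refine mem_filt ?_ (key (k + 1))
  have : (0 : ℝ) ≤ k := Nat.cast_nonneg k
  simp
  nlinarith

theorem rootGroup_le_unipotentFor {ρ : H} {S : Set H.root}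
    (hS : ∀ α ∈ S, 1 ≤ (((rootSystem H).root α) ρ).re) :
    Pinning.rootGroup H S ≤ unipotentFor ρ := by
  refine (Subgroup.closure_le _).mpr ?_
  rintro g ⟨α, hα, x, hx, rfl⟩
  exact expAd_mem_unipotentFor (hS α hα) (mem_wtSpace_root.mpr hx)

theorem rootGroup_le_lieAut (S : Set H.root) : Pinning.rootGroup H S ≤ lieAut 𝔤 := by
  refine (Subgroup.closure_le _).mpr ?_
  rintro g ⟨α, hα, x, hx, rfl⟩
  exact expAd_mem_lieAut x

theorem killingForm_lieAut {g : 𝔤 ≃ₗ[ℂ] 𝔤} (hg : g ∈ lieAut 𝔤) (y z : 𝔤) :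
    killingForm ℂ 𝔤 (g y) (g z) = killingForm ℂ 𝔤 y z := by
  let e : 𝔤 ≃ₗ⁅ℂ⁆ 𝔤 := { g with map_lie' := fun {x y} => hg x y }
  exact LieAlgebra.killingForm_of_equiv_apply e y z

theorem killingForm_inv_apply {g : 𝔤 ≃ₗ[ℂ] 𝔤} (hg : g ∈ lieAut 𝔤) (y z : 𝔤) :
    killingForm ℂ 𝔤 (g y) z = killingForm ℂ 𝔤 y (g⁻¹ z) := by
  rw [← killingForm_lieAut hg y, apply_inv_apply]

/-! ### Torus elements -/

/-- If an automorphism `g` acts on `H` by the inverse of `σ`, it carries the weight space of `χ` to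
that of `χ ∘ σ`. -/
theorem apply_mem_wtSpace {g : 𝔤 ≃ₗ[ℂ] 𝔤} (hg : g ∈ lieAut 𝔤) (σ : H → H)
    (hσ : ∀ x : H, g (σ x : 𝔤) = x) {χ ψ : Dual ℂ H} (hψ : ∀ x : H, ψ x = χ (σ x)) {z : 𝔤}
    (hz : z ∈ wtSpace H χ) : g z ∈ wtSpace H ψ := by
  intro x
  rw [hψ, ← map_smul, ← hz, hg, hσ]

open Classical in
theorem bijective_sum_genWeightSpace :
    Function.Bijective (DirectSum.coeLinearMap fun χ : LieModule.Weight ℂ H 𝔤 =>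
      (LieModule.genWeightSpace 𝔤 (χ : H → ℂ)).toSubmodule) := by
  refine DirectSum.isInternal_submodule_of_iSupIndep_of_iSup_eq_top ?_ ?_
  · exact LieSubmodule.iSupIndep_toSubmodule.mpr (LieModule.iSupIndep_genWeightSpace' ℂ H 𝔤)
  · rw [← LieSubmodule.iSup_toSubmodule, LieModule.iSup_genWeightSpace_eq_top' ℂ H 𝔤,
      LieSubmodule.top_toSubmodule]

open Classical in
/-- The linear endomorphism `exp (ad x)` of `𝔤`, for `x ∈ H`. -/
def torLin (x : H) : 𝔤 →ₗ[ℂ] 𝔤 :=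
  (DirectSum.toModule ℂ (LieModule.Weight ℂ H 𝔤) 𝔤 fun χ =>
      Complex.exp (χ x) • (LieModule.genWeightSpace 𝔤 (χ : H → ℂ)).toSubmodule.subtype) ∘ₗ
    (LinearEquiv.ofBijective (DirectSum.coeLinearMap fun χ : LieModule.Weight ℂ H 𝔤 =>
      (LieModule.genWeightSpace 𝔤 (χ : H → ℂ)).toSubmodule)
        bijective_sum_genWeightSpace).symm.toLinearMap

theorem torLin_apply (x : H) {χ : Dual ℂ H} {z : 𝔤} (hz : z ∈ wtSpace H χ) :
    torLin x z = Complex.exp (χ x) • z := by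
  classical
  by_cases hz0 : z = 0
  · simp [hz0]
  have hz' := mem_wtSpace_iff_mem_rootSpace.mp hz
  have hne : LieModule.genWeightSpace 𝔤 (χ : H → ℂ) ≠ ⊥ := fun h => hz0 (by
    rw [rootSpace, h] at hz'
    simpa using hz')
  let α : LieModule.Weight ℂ H 𝔤 := ⟨χ, hne⟩
  have h1 : (LinearEquiv.ofBijective (DirectSum.coeLinearMap fun χ : LieModule.Weight ℂ H 𝔤 =>
      (LieModule.genWeightSpace 𝔤 (χ : H → ℂ)).toSubmodule) bijective_sum_genWeightSpace).symm z =
      DirectSum.lof ℂ _ _ α ⟨z, hz'⟩ := by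
    rw [LinearEquiv.symm_apply_eq, LinearEquiv.ofBijective_apply]
    exact (DirectSum.coeLinearMap_lof (fun χ : LieModule.Weight ℂ H 𝔤 =>
      (LieModule.genWeightSpace 𝔤 (χ : H → ℂ)).toSubmodule) α ⟨z, hz'⟩).symm
  simp only [torLin, LinearMap.comp_apply, LinearEquiv.coe_coe]
  rw [h1, DirectSum.toModule_lof]
  rfl

theorem torLin_comp (x y : H) : torLin x ∘ₗ torLin y = (torLin (x + y) : 𝔤 →ₗ[ℂ] 𝔤) := by
  refine linearMap_ext_wtSpace (H := H) fun χ z hz => ?_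
  rw [LinearMap.comp_apply, torLin_apply y hz, map_smul, torLin_apply x hz, torLin_apply _ hz,
    smul_smul, map_add, Complex.exp_add, mul_comm]

theorem torLin_zero : torLin (0 : H) = (LinearMap.id : 𝔤 →ₗ[ℂ] 𝔤) := by
  refine linearMap_ext_wtSpace (H := H) fun χ z hz => ?_
  rw [torLin_apply _ hz]; simp

/-- The automorphism `exp (ad x)` of `𝔤`, for `x ∈ H`: it acts on the weight space of `χ` by the
scalar `exp (χ x)`. -/
def tor (x : H) : 𝔤 ≃ₗ[ℂ] 𝔤 :=
  LinearEquiv.ofLinearMap (torLin x) (torLin (-x))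
    (by rw [torLin_comp, add_neg_cancel, torLin_zero])
    (by rw [torLin_comp, neg_add_cancel, torLin_zero])

theorem tor_apply (x : H) {χ : Dual ℂ H} {z : 𝔤} (hz : z ∈ wtSpace H χ) :
    tor x z = Complex.exp (χ x) • z := torLin_apply x hz

theorem tor_add (x y : H) : tor (x + y) = (tor x * tor y : 𝔤 ≃ₗ[ℂ] 𝔤) := by
  ext z
  exact (LinearMap.congr_fun (torLin_comp x y) z).symm

theorem tor_zero : tor (0 : H) = (1 : 𝔤 ≃ₗ[ℂ] 𝔤) := by
  ext z
  exact LinearMap.congr_fun torLin_zero z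

theorem tor_neg (x : H) : tor (-x) = (tor x : 𝔤 ≃ₗ[ℂ] 𝔤)⁻¹ := by
  rw [eq_inv_iff_mul_eq_one, ← tor_add, neg_add_cancel, tor_zero]

theorem linearEquiv_ext_wtSpace {f g : 𝔤 ≃ₗ[ℂ] 𝔤}
    (h : ∀ χ : Dual ℂ H, ∀ z ∈ wtSpace H χ, f z = g z) : f = g :=
  LinearEquiv.toLinearMap_injective (linearMap_ext_wtSpace (H := H) h)

theorem tor_mem_lieAut (x : H) : (tor x : 𝔤 ≃ₗ[ℂ] 𝔤) ∈ lieAut 𝔤 := by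
  intro y z
  have h1 : ∀ χ : Dual ℂ H, ∀ y ∈ wtSpace H χ, ∀ z, tor x ⁅y, z⁆ = ⁅tor x y, tor x z⁆ := by
    intro χ y hy z
    have : (tor x).toLinearMap ∘ₗ LieAlgebra.ad ℂ 𝔤 y =
        LieAlgebra.ad ℂ 𝔤 (tor x y) ∘ₗ (tor x).toLinearMap := by
      refine linearMap_ext_wtSpace (H := H) fun ψ z hz => ?_
      change tor x ⁅y, z⁆ = ⁅tor x y, tor x z⁆
      rw [tor_apply x (lie_mem_wtSpace hy hz), tor_apply x hy, tor_apply x hz, smul_lie, lie_smul,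
        smul_smul, LinearMap.add_apply, Complex.exp_add]
    exact LinearMap.congr_fun this z
  have h2 : (tor x).toLinearMap ∘ₗ LieAlgebra.ad ℂ 𝔤 z =
      LieAlgebra.ad ℂ 𝔤 (tor x z) ∘ₗ (tor x).toLinearMap := by
    refine linearMap_ext_wtSpace (H := H) fun ψ y hy => ?_
    change tor x ⁅z, y⁆ = ⁅tor x z, tor x y⁆
    rw [← lie_skew, map_neg, h1 ψ y hy, lie_skew]
  have h3 : tor x ⁅z, y⁆ = ⁅tor x z, tor x y⁆ := LinearMap.congr_fun h2 y
  rw [← lie_skew, map_neg, h3, lie_skew]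

theorem tor_apply_cartan (x : H) {z : 𝔤} (hz : z ∈ H) : tor x z = z := by
  rw [tor_apply x (mem_wtSpace_zero.mpr hz)]; simp

theorem tor_conj_expAd (x : H) {χ : Dual ℂ H} (hχ : χ ≠ 0) {z : 𝔤} (hz : z ∈ wtSpace H χ) :
    tor x * expAd z * (tor x)⁻¹ = expAd (Complex.exp (χ x) • z) := by
  rw [conj_expAd (tor_mem_lieAut x) (isNilpotent_ad_of_mem_wtSpace hχ hz), tor_apply x hz]

end WeightSpaces

variable {𝔤 : Type*} [LieRing 𝔤] [LieAlgebra ℂ 𝔤] [FiniteDimensional ℂ 𝔤] [IsKilling ℂ 𝔤]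
variable {H : LieSubalgebra ℂ 𝔤} [H.IsCartanSubalgebra]

/-! ### The chosen root vectors -/

theorem commute_expAd {x y : 𝔤} (hx : IsNilpotent (LieAlgebra.ad ℂ 𝔤 x))
    (hy : IsNilpotent (LieAlgebra.ad ℂ 𝔤 y)) (hxy : ⁅x, y⁆ = 0) :
    expAd x * expAd y = expAd y * expAd x := by
  rw [← expAd_add hx hy hxy, add_comm, expAd_add hy hx (by rw [← lie_skew, hxy, neg_zero])]

theorem conj_tor {g : 𝔤 ≃ₗ[ℂ] 𝔤} (hg : g ∈ lieAut 𝔤) (σ : H ≃ₗ[ℂ] H)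
    (hσ : ∀ x : H, g x = σ x) (z : H) : g * tor z * g⁻¹ = tor (σ z) := by
  refine linearEquiv_ext_wtSpace (H := H) fun χ y hy => ?_
  have h1 : g⁻¹ y ∈ wtSpace H (χ ∘ₗ σ.toLinearMap) :=
    apply_mem_wtSpace (inv_mem hg) σ (fun x => by rw [← hσ, inv_apply_apply]) (fun x => rfl) hy
  rw [LinearEquiv.mul_apply, LinearEquiv.mul_apply, tor_apply z h1, map_smul, apply_inv_apply,
    tor_apply _ hy]
  rfl

namespace Pinning

variable (p : Pinning H)

/-- The simple coroot `αᵢ^∨`, as an element of `𝔱`. -/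
def sCoroot (i : p.I) : H := coroot i.1.1

theorem e_mem_wtSpace (i : p.I) : p.e i ∈ wtSpace H (p.simpleRoot i) :=
  mem_wtSpace_root.mpr (p.e_mem i)

theorem f_mem_wtSpace (i : p.I) : p.f i ∈ wtSpace H (-p.simpleRoot i) :=
  mem_wtSpace_iff_mem_rootSpace.mpr (p.f_mem i)

theorem simpleRoot_ne_zero (i : p.I) : p.simpleRoot i ≠ 0 := (rootSystem H).ne_zero i.1

theorem simpleRoot_sCoroot_self (i : p.I) : p.simpleRoot i (p.sCoroot i) = 2 :=
  root_apply_coroot (LieSubalgebra.isNonZero_coe_root i.1)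

theorem lie_e_f_eq (i : p.I) : ⁅p.e i, p.f i⁆ = (p.sCoroot i : 𝔤) := p.lie_e_f i

theorem lie_f_e_eq (i : p.I) : ⁅p.f i, p.e i⁆ = -(p.sCoroot i : 𝔤) := by
  rw [← lie_skew, lie_e_f_eq]

theorem lie_cartan_e (i : p.I) (z : H) : ⁅(z : 𝔤), p.e i⁆ = p.simpleRoot i z • p.e i :=
  p.e_mem_wtSpace i z

theorem lie_cartan_f (i : p.I) (z : H) : ⁅(z : 𝔤), p.f i⁆ = -p.simpleRoot i z • p.f i :=
  p.f_mem_wtSpace i z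

theorem lie_e_cartan (i : p.I) (z : H) : ⁅p.e i, (z : 𝔤)⁆ = -p.simpleRoot i z • p.e i := by
  rw [← lie_skew, lie_cartan_e, neg_smul]

theorem lie_f_cartan (i : p.I) (z : H) : ⁅p.f i, (z : 𝔤)⁆ = p.simpleRoot i z • p.f i := by
  rw [← lie_skew, lie_cartan_f, neg_smul, neg_neg]

theorem isNilpotent_ad_e (i : p.I) : IsNilpotent (LieAlgebra.ad ℂ 𝔤 (p.e i)) :=
  isNilpotent_ad_of_mem_wtSpace (p.simpleRoot_ne_zero i) (p.e_mem_wtSpace i)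

theorem isNilpotent_ad_f (i : p.I) : IsNilpotent (LieAlgebra.ad ℂ 𝔤 (p.f i)) :=
  isNilpotent_ad_of_mem_wtSpace (neg_ne_zero.mpr (p.simpleRoot_ne_zero i)) (p.f_mem_wtSpace i)

theorem isNilpotent_ad_smul_e (i : p.I) (a : ℂ) :
    IsNilpotent (LieAlgebra.ad ℂ 𝔤 (a • p.e i)) := isNilpotent_ad_smul (p.isNilpotent_ad_e i) a

theorem isNilpotent_ad_smul_f (i : p.I) (a : ℂ) :
    IsNilpotent (LieAlgebra.ad ℂ 𝔤 (a • p.f i)) := isNilpotent_ad_smul (p.isNilpotent_ad_f i) a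

theorem e_ne_zero (i : p.I) : p.e i ≠ 0 := by
  intro h
  have h1 := p.lie_e_f_eq i
  rw [h, zero_lie] at h1
  have h2 : p.sCoroot i = 0 := Subtype.ext h1.symm
  have h3 := p.simpleRoot_sCoroot_self i
  rw [h2, map_zero] at h3
  norm_num at h3

theorem f_ne_zero (i : p.I) : p.f i ≠ 0 := by
  intro h
  have h1 := p.lie_e_f_eq i
  rw [h, lie_zero] at h1
  have h2 : p.sCoroot i = 0 := Subtype.ext h1.symm
  have h3 := p.simpleRoot_sCoroot_self i
  rw [h2, map_zero] at h3
  norm_num at h3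

/-! ### One-parameter subgroups and the action on `𝔰𝔩₂` -/

theorem x_add (i : p.I) (a b : ℂ) : p.x i (a + b) = p.x i a * p.x i b :=
  expAd_add_smul (p.isNilpotent_ad_e i) a b

theorem y_add (i : p.I) (a b : ℂ) : p.y i (a + b) = p.y i a * p.y i b :=
  expAd_add_smul (p.isNilpotent_ad_f i) a b

theorem x_zero (i : p.I) : p.x i 0 = 1 := by rw [x, zero_smul, expAd_zero]

theorem y_zero (i : p.I) : p.y i 0 = 1 := by rw [y, zero_smul, expAd_zero]

theorem x_neg (i : p.I) (a : ℂ) : p.x i (-a) = (p.x i a)⁻¹ := by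
  rw [eq_inv_iff_mul_eq_one, ← x_add, neg_add_cancel, x_zero]

theorem y_neg (i : p.I) (a : ℂ) : p.y i (-a) = (p.y i a)⁻¹ := by
  rw [eq_inv_iff_mul_eq_one, ← y_add, neg_add_cancel, y_zero]

theorem x_mem_lieAut (i : p.I) (a : ℂ) : p.x i a ∈ lieAut 𝔤 := expAd_mem_lieAut _

theorem y_mem_lieAut (i : p.I) (a : ℂ) : p.y i a ∈ lieAut 𝔤 := expAd_mem_lieAut _

theorem x_apply_cartan (i : p.I) (a : ℂ) (z : H) :
    p.x i a z = z - (a * p.simpleRoot i z) • p.e i := by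
  rw [x, expAd_apply_of_lie_lie_eq_zero (p.isNilpotent_ad_smul_e i a)]
  · rw [smul_lie, lie_e_cartan]; module
  · simp only [smul_lie, lie_e_cartan, lie_smul, lie_self, smul_zero]

theorem y_apply_cartan (i : p.I) (a : ℂ) (z : H) :
    p.y i a z = z + (a * p.simpleRoot i z) • p.f i := by
  rw [y, expAd_apply_of_lie_lie_eq_zero (p.isNilpotent_ad_smul_f i a)]
  · rw [smul_lie, lie_f_cartan]; module
  · simp only [smul_lie, lie_f_cartan, lie_smul, lie_self, smul_zero]

theorem x_apply_e (i : p.I) (a : ℂ) : p.x i a (p.e i) = p.e i :=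
  expAd_apply_of_lie_eq_zero (p.isNilpotent_ad_smul_e i a) (by simp)

theorem y_apply_f (i : p.I) (a : ℂ) : p.y i a (p.f i) = p.f i :=
  expAd_apply_of_lie_eq_zero (p.isNilpotent_ad_smul_f i a) (by simp)

theorem x_apply_f (i : p.I) (a : ℂ) :
    p.x i a (p.f i) = p.f i + a • (p.sCoroot i : 𝔤) - a ^ 2 • p.e i := by
  rw [x, expAd_apply_of_lie_lie_lie_eq_zero (p.isNilpotent_ad_smul_e i a)]
  · simp only [smul_lie, lie_smul, lie_e_f_eq, lie_e_cartan, simpleRoot_sCoroot_self]; module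
  · simp only [smul_lie, lie_smul, lie_e_f_eq, lie_e_cartan, lie_self, smul_zero]

theorem y_apply_e (i : p.I) (a : ℂ) :
    p.y i a (p.e i) = p.e i - a • (p.sCoroot i : 𝔤) - a ^ 2 • p.f i := by
  rw [y, expAd_apply_of_lie_lie_lie_eq_zero (p.isNilpotent_ad_smul_f i a)]
  · simp only [smul_lie, lie_smul, lie_f_e_eq, lie_neg, lie_f_cartan, simpleRoot_sCoroot_self]
    module
  · simp only [smul_lie, lie_smul, lie_f_e_eq, lie_neg, lie_f_cartan, lie_self, smul_zero, neg_zero]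

/-- The representative `xᵢ(a) yᵢ(-a⁻¹) xᵢ(a)` of the simple reflection `sᵢ`. -/
def wElt (i : p.I) (a : ℂ) : 𝔤 ≃ₗ[ℂ] 𝔤 := p.x i a * p.y i (-a⁻¹) * p.x i a

theorem sbar_eq_wElt (i : p.I) : p.sbar i = p.wElt i (-1) := by
  simp [sbar, wElt, inv_neg]

theorem corootChar_eq_wElt (i : p.I) (a : ℂ) :
    p.corootChar i a = p.wElt i a * (p.wElt i 1)⁻¹ := by
  simp [corootChar, wElt]

theorem wElt_neg (i : p.I) (a : ℂ) : p.wElt i (-a) = (p.wElt i a)⁻¹ := by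
  rw [wElt, wElt, x_neg, inv_neg, neg_neg, mul_inv_rev, mul_inv_rev, ← p.y_neg i (-a⁻¹), neg_neg,
    mul_assoc]

theorem wElt_mem_lieAut (i : p.I) (a : ℂ) : p.wElt i a ∈ lieAut 𝔤 :=
  mul_mem (mul_mem (p.x_mem_lieAut i a) (p.y_mem_lieAut i _)) (p.x_mem_lieAut i a)

theorem sbar_mem_lieAut (i : p.I) : p.sbar i ∈ lieAut 𝔤 := by
  rw [sbar_eq_wElt]; exact p.wElt_mem_lieAut i _

/-- The simple reflection on `𝔱`. -/
abbrev cor (i : p.I) : H ≃ₗ[ℂ] H := (rootSystem H).coreflection i.1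

theorem cor_apply (i : p.I) (z : H) : p.cor i z = z - p.simpleRoot i z • p.sCoroot i :=
  (rootSystem H).coreflection_apply i.1 z

theorem wElt_apply_cartan (i : p.I) {a : ℂ} (ha : a ≠ 0) (z : H) :
    p.wElt i a z = p.cor i z := by
  rw [wElt, LinearEquiv.mul_apply, LinearEquiv.mul_apply, x_apply_cartan, map_sub, map_smul,
    y_apply_cartan, y_apply_e, cor_apply]
  have : (z : 𝔤) + (-a⁻¹ * p.simpleRoot i z) • p.f i -
      (a * p.simpleRoot i z) • (p.e i - (-a⁻¹) • (p.sCoroot i : 𝔤) - (-a⁻¹) ^ 2 • p.f i) =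
      z - p.simpleRoot i z • (p.sCoroot i : 𝔤) - (a * p.simpleRoot i z) • p.e i := by
    match_scalars <;> field_simp <;> ring
  rw [this, map_sub, map_sub, map_smul, map_smul, x_apply_cartan, x_apply_cartan, x_apply_e,
    simpleRoot_sCoroot_self]
  push_cast
  module

theorem wElt_apply_e (i : p.I) {a : ℂ} (ha : a ≠ 0) :
    p.wElt i a (p.e i) = -(a⁻¹) ^ 2 • p.f i := by
  rw [wElt, LinearEquiv.mul_apply, LinearEquiv.mul_apply, x_apply_e, y_apply_e, map_sub, map_sub,
    map_smul, map_smul, x_apply_cartan, x_apply_e, x_apply_f, simpleRoot_sCoroot_self]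
  match_scalars <;> field_simp <;> ring

theorem wElt_apply_f (i : p.I) {a : ℂ} (ha : a ≠ 0) :
    p.wElt i a (p.f i) = -a ^ 2 • p.e i := by
  rw [wElt, LinearEquiv.mul_apply, LinearEquiv.mul_apply, x_apply_f, map_sub, map_add, map_smul,
    map_smul, y_apply_cartan, y_apply_e, y_apply_f, simpleRoot_sCoroot_self]
  have : p.f i + a • ((p.sCoroot i : 𝔤) + (-a⁻¹ * 2) • p.f i) -
      a ^ 2 • (p.e i - (-a⁻¹) • (p.sCoroot i : 𝔤) - (-a⁻¹) ^ 2 • p.f i) = -a ^ 2 • p.e i := by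
    match_scalars <;> field_simp <;> ring
  rw [this, map_smul, x_apply_e]

theorem wElt_conj_x (i : p.I) {a : ℂ} (ha : a ≠ 0) (b : ℂ) :
    p.wElt i a * p.x i b * (p.wElt i a)⁻¹ = p.y i (-b * (a⁻¹) ^ 2) := by
  rw [x, conj_expAd (p.wElt_mem_lieAut i a) (p.isNilpotent_ad_smul_e i b), map_smul,
    p.wElt_apply_e i ha, y, smul_smul]
  congr 2; ring

theorem wElt_conj_y (i : p.I) {a : ℂ} (ha : a ≠ 0) (b : ℂ) :
    p.wElt i a * p.y i b * (p.wElt i a)⁻¹ = p.x i (-b * a ^ 2) := by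
  rw [y, conj_expAd (p.wElt_mem_lieAut i a) (p.isNilpotent_ad_smul_f i b), map_smul,
    p.wElt_apply_f i ha, x, smul_smul]
  congr 2; ring

/-- The braid relation in `SL₂`: conjugating `wElt i a` by itself interchanges the roles of `xᵢ`
and `yᵢ`. -/
theorem wElt_eq_yxy (i : p.I) {a : ℂ} (ha : a ≠ 0) :
    p.wElt i a = p.y i (-a⁻¹) * p.x i a * p.y i (-a⁻¹) := by
  have h : p.wElt i a = p.wElt i a * p.wElt i a * (p.wElt i a)⁻¹ := by group
  have e1 : -a * (a⁻¹) ^ 2 = -a⁻¹ := by field_simp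
  have e2 : -(-a⁻¹) * a ^ 2 = a := by field_simp
  calc p.wElt i a = p.wElt i a * (p.x i a * p.y i (-a⁻¹) * p.x i a) * (p.wElt i a)⁻¹ := h
    _ = (p.wElt i a * p.x i a * (p.wElt i a)⁻¹) * (p.wElt i a * p.y i (-a⁻¹) * (p.wElt i a)⁻¹) *
        (p.wElt i a * p.x i a * (p.wElt i a)⁻¹) := by group
    _ = _ := by rw [p.wElt_conj_x i ha, p.wElt_conj_y i ha, e1, e2]

theorem x_eq_y_wElt_y (i : p.I) {a : ℂ} (ha : a ≠ 0) :
    p.x i a = p.y i a⁻¹ * p.wElt i a * p.y i a⁻¹ := by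
  rw [p.wElt_eq_yxy i ha, y_neg]; group

theorem y_eq_x_wElt_x (i : p.I) {c : ℂ} :
    p.y i c = p.x i c⁻¹ * p.wElt i (-c⁻¹) * p.x i c⁻¹ := by
  rw [wElt, x_neg, inv_neg, inv_inv, neg_neg]; group

theorem wElt_conj_tor (i : p.I) {a : ℂ} (ha : a ≠ 0) (z : H) :
    p.wElt i a * tor z * (p.wElt i a)⁻¹ = tor (p.cor i z) :=
  conj_tor (p.wElt_mem_lieAut i a) (p.cor i) (p.wElt_apply_cartan i ha) z

theorem tor_conj_x (i : p.I) (z : H) (a : ℂ) :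
    tor z * p.x i a * (tor z)⁻¹ = p.x i (Complex.exp (p.simpleRoot i z) * a) := by
  rw [x, tor_conj_expAd z (p.simpleRoot_ne_zero i)
    (Submodule.smul_mem _ _ (p.e_mem_wtSpace i)), smul_smul, x]

theorem tor_conj_y (i : p.I) (z : H) (a : ℂ) :
    tor z * p.y i a * (tor z)⁻¹ = p.y i (Complex.exp (-p.simpleRoot i z) * a) := by
  rw [y, tor_conj_expAd z (neg_ne_zero.mpr (p.simpleRoot_ne_zero i))
    (Submodule.smul_mem _ _ (p.f_mem_wtSpace i)), smul_smul, y, LinearMap.neg_apply]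

theorem cor_smul_sCoroot (i : p.I) (c : ℂ) : p.cor i (c • p.sCoroot i) = -(c • p.sCoroot i) := by
  rw [cor_apply, map_smul, simpleRoot_sCoroot_self, smul_eq_mul]; module

/-- The torus element `αᵢ^∨(exp c)`, defined in terms of `xᵢ` and `yᵢ`, is `exp (c αᵢ^∨)`:
conjugation by `exp (c/2 αᵢ^∨)` carries `wElt i 1` to `wElt i (exp c)`. -/
theorem corootChar_exp (i : p.I) (c : ℂ) :
    p.corootChar i (Complex.exp c) = tor (c • p.sCoroot i) := by
  have h : p.wElt i (Complex.exp c) =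
      tor ((c / 2) • p.sCoroot i) * p.wElt i 1 * (tor ((c / 2) • p.sCoroot i))⁻¹ := by
    have e1 : Complex.exp (p.simpleRoot i ((c / 2) • p.sCoroot i)) * 1 = Complex.exp c := by
      rw [map_smul, simpleRoot_sCoroot_self, smul_eq_mul]; ring_nf
    have e2 : Complex.exp (-p.simpleRoot i ((c / 2) • p.sCoroot i)) * (-1⁻¹) =
        -(Complex.exp c)⁻¹ := by
      rw [map_smul, simpleRoot_sCoroot_self, smul_eq_mul, ← Complex.exp_neg]; ring_nf
    rw [wElt, wElt, ← e2, ← e1, ← tor_conj_x, ← tor_conj_y]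
    group
  rw [corootChar_eq_wElt, h]
  calc _ = tor ((c / 2) • p.sCoroot i) *
        (p.wElt i 1 * tor (-((c / 2) • p.sCoroot i)) * (p.wElt i 1)⁻¹) := by
        rw [tor_neg]; group
    _ = _ := by
      rw [p.wElt_conj_tor i one_ne_zero, map_neg, cor_smul_sCoroot, neg_neg, ← tor_add]
      congr 1; module

theorem corootChar_ofReal (i : p.I) {a : ℝ} (ha : 0 < a) :
    p.corootChar i a = tor ((Real.log a : ℂ) • p.sCoroot i) := by
  rw [← corootChar_exp, ← Complex.ofReal_exp, Real.exp_log ha]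

/-- The factorization of `xᵢ(a) s̄ᵢ` in `U⁻ T U`. -/
theorem x_mul_sbar (i : p.I) {a : ℝ} (ha : 0 < a) :
    p.x i a * p.sbar i =
      p.y i (a : ℂ)⁻¹ * tor ((Real.log a : ℂ) • p.sCoroot i) * p.x i (-(a : ℂ)⁻¹) := by
  have ha' : (a : ℂ) ≠ 0 := by exact_mod_cast ha.ne'
  have h := p.wElt_conj_y i one_ne_zero (a : ℂ)⁻¹
  rw [one_pow, mul_one] at h
  rw [← corootChar_ofReal p i ha, corootChar_eq_wElt, sbar_eq_wElt, wElt_neg, ← h,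
    p.x_eq_y_wElt_y i ha']
  group

/-- For `a, c > 0` the product `xᵢ(a) yᵢ(c)` is refactored in `U⁻ T U` with positive parameters. -/
theorem x_mul_y_self (i : p.I) {a c : ℝ} (ha : 0 < a) (hc : 0 < c) :
    p.x i a * p.y i c = p.y i (c / (1 + a * c) : ℝ) *
      tor ((Real.log (1 + a * c) : ℂ) • p.sCoroot i) * p.x i (a / (1 + a * c) : ℝ) := by
  have hd : 0 < 1 + a * c := by positivity
  have hA : 0 < a + c⁻¹ := by positivity
  have hA' : ((a + c⁻¹ : ℝ) : ℂ) ≠ 0 := by exact_mod_cast hA.ne'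
  have hc' : ((c : ℂ)⁻¹) ≠ 0 := inv_ne_zero (by exact_mod_cast hc.ne')
  have e1 : (Real.log (1 + a * c) : ℂ) • p.sCoroot i =
      (Real.log (a + c⁻¹) : ℂ) • p.sCoroot i + -((Real.log c⁻¹ : ℂ) • p.sCoroot i) := by
    have : 1 + a * c = (a + c⁻¹) * c := by field_simp; ring
    rw [this, Real.log_mul hA.ne' hc.ne', Real.log_inv]
    push_cast; module
  have e2 : tor ((Real.log c⁻¹ : ℂ) • p.sCoroot i) =
      p.wElt i (c : ℂ)⁻¹ * (p.wElt i 1)⁻¹ := by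
    rw [← corootChar_ofReal p i (inv_pos.mpr hc), corootChar_eq_wElt]; push_cast; rfl
  have e3 : p.y i ((a + c⁻¹ : ℝ) : ℂ)⁻¹ = (p.wElt i (c : ℂ)⁻¹)⁻¹ *
      p.x i (-((a + c⁻¹ : ℝ) : ℂ)⁻¹ * ((c : ℂ)⁻¹) ^ 2) * p.wElt i (c : ℂ)⁻¹ := by
    rw [← p.wElt_conj_y i hc']; group
  have e4 : p.x i (a / (1 + a * c) : ℝ) =
      p.x i (-((a + c⁻¹ : ℝ) : ℂ)⁻¹ * ((c : ℂ)⁻¹) ^ 2) * p.x i (c : ℂ)⁻¹ := by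
    rw [← x_add]
    congr 1
    have : (a / (1 + a * c) : ℝ) = -(a + c⁻¹)⁻¹ * (c⁻¹) ^ 2 + c⁻¹ := by
      have : a + c⁻¹ = (1 + a * c) / c := by field_simp; ring
      rw [this]; field_simp; ring
    rw [this]; push_cast; ring
  have e5 : ((c / (1 + a * c) : ℝ) : ℂ) = ((a + c⁻¹ : ℝ) : ℂ)⁻¹ := by
    rw [← Complex.ofReal_inv]
    congr 1
    have : a + c⁻¹ = (1 + a * c) / c := by field_simp; ring
    rw [this, inv_div]
  rw [e1, tor_add, tor_neg, e2, ← corootChar_ofReal p i hA, corootChar_eq_wElt, e4, e5]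
  calc p.x i a * p.y i c
      = p.x i a * (p.x i (c : ℂ)⁻¹ * p.wElt i (-(c : ℂ)⁻¹) * p.x i (c : ℂ)⁻¹) := by
        rw [← y_eq_x_wElt_x]
    _ = p.x i ((a + c⁻¹ : ℝ) : ℂ) * (p.wElt i (c : ℂ)⁻¹)⁻¹ * p.x i (c : ℂ)⁻¹ := by
        rw [wElt_neg]; push_cast; rw [x_add]; group
    _ = p.y i ((a + c⁻¹ : ℝ) : ℂ)⁻¹ * p.wElt i ((a + c⁻¹ : ℝ) : ℂ) *
        p.y i ((a + c⁻¹ : ℝ) : ℂ)⁻¹ * (p.wElt i (c : ℂ)⁻¹)⁻¹ * p.x i (c : ℂ)⁻¹ := by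
        rw [← p.x_eq_y_wElt_y i hA']
    _ = p.y i ((a + c⁻¹ : ℝ) : ℂ)⁻¹ * p.wElt i ((a + c⁻¹ : ℝ) : ℂ) *
        ((p.wElt i (c : ℂ)⁻¹)⁻¹ *
      p.x i (-((a + c⁻¹ : ℝ) : ℂ)⁻¹ * ((c : ℂ)⁻¹) ^ 2) * p.wElt i (c : ℂ)⁻¹) *
        (p.wElt i (c : ℂ)⁻¹)⁻¹ * p.x i (c : ℂ)⁻¹ := by rw [← e3]
    _ = _ := by group

theorem lie_e_f_of_ne {i j : p.I} (hij : i ≠ j) : ⁅p.e i, p.f j⁆ = 0 := by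
  by_contra h
  have h1 : ⁅p.e i, p.f j⁆ ∈ wtSpace H (p.simpleRoot i - p.simpleRoot j) := by
    rw [sub_eq_add_neg]; exact lie_mem_wtSpace (p.e_mem_wtSpace i) (p.f_mem_wtSpace j)
  have hne : p.simpleRoot i - p.simpleRoot j ≠ 0 := fun h0 => hij (Subtype.ext
    ((rootSystem H).root.injective (sub_eq_zero.mp h0)))
  obtain ⟨α, hα⟩ := exists_root_of_wtSpace_ne_bot hne h1 h
  exact p.base.sub_notMem_range_root i.2 j.2 ⟨α, hα⟩

theorem x_mul_y_of_ne {i j : p.I} (hij : i ≠ j) (a c : ℂ) :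
    p.x i a * p.y j c = p.y j c * p.x i a :=
  commute_expAd (p.isNilpotent_ad_smul_e i a) (p.isNilpotent_ad_smul_f j c)
    (by rw [smul_lie, lie_smul, p.lie_e_f_of_ne hij, smul_zero, smul_zero])

theorem wElt_apply_mem_wtSpace (i : p.I) {a : ℂ} (ha : a ≠ 0) {χ : Dual ℂ H} {z : 𝔤}
    (hz : z ∈ wtSpace H χ) : p.wElt i a z ∈ wtSpace H ((rootSystem H).reflection i.1 χ) := by
  refine apply_mem_wtSpace (p.wElt_mem_lieAut i a) (p.cor i) (fun x => ?_) (fun x => ?_) hz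
  · rw [p.wElt_apply_cartan i ha]
    exact congrArg Subtype.val ((rootSystem H).coreflection_same i.1 x)
  · rw [cor_apply, map_sub, map_smul, RootPairing.reflection_apply]
    simp [simpleRoot, sCoroot, mul_comm]

theorem sbar_apply_mem_wtSpace (i : p.I) {χ : Dual ℂ H} {z : 𝔤}
    (hz : z ∈ wtSpace H χ) : p.sbar i z ∈ wtSpace H ((rootSystem H).reflection i.1 χ) := by
  rw [sbar_eq_wElt]; exact p.wElt_apply_mem_wtSpace i (by norm_num) hz

theorem sbar_apply_root (i : p.I) {β : H.root} {z : 𝔤}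
    (hz : z ∈ wtSpace H ((rootSystem H).root β)) :
    p.sbar i z ∈ wtSpace H ((rootSystem H).root (p.simpleReflection i β)) := by
  rw [simpleReflection, RootPairing.root_reflectionPerm]
  exact p.sbar_apply_mem_wtSpace i hz

theorem sbar_apply_cartan (i : p.I) (z : H) : p.sbar i z = p.cor i z := by
  rw [sbar_eq_wElt, p.wElt_apply_cartan i (by norm_num)]

theorem sbar_mul_self (i : p.I) : p.sbar i * p.sbar i =
    tor (((Real.pi : ℂ) * Complex.I) • p.sCoroot i) := by
  rw [← corootChar_exp, Complex.exp_pi_mul_I, corootChar_eq_wElt, sbar_eq_wElt, ← wElt_neg]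

/-! ### Coordinates of roots -/

open Classical in
theorem simpleRoot_coweight (i j : p.I) :
    p.simpleRoot i (p.coweight j) = if i = j then 1 else 0 := by
  rw [coweight, apply_evalEquiv_symm_apply]
  have := p.base.toWeightBasis.dualBasis_apply_self j i
  rw [RootPairing.Base.toWeightBasis_apply] at this
  rw [simpleRoot, this]

/-- The simple roots separate the points of `𝔱`. -/
theorem cartan_ext {z w : H} (h : ∀ i, p.simpleRoot i z = p.simpleRoot i w) : z = w := by
  apply (evalEquiv ℂ H).injective
  refine p.base.toWeightBasis.ext fun i => ?_
  rw [RootPairing.Base.toWeightBasis_apply]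
  exact h i

theorem sum_simpleRoot_smul_coweight (z : H) : ∑ i, p.simpleRoot i z • p.coweight i = z := by
  classical
  refine p.cartan_ext fun j => ?_
  simp [map_sum, simpleRoot_coweight]

/-- The element `ρ^∨` of `𝔱` on which every simple root takes the value one. -/
def rhoCheck : H := ∑ i, p.coweight i

theorem simpleRoot_rhoCheck (i : p.I) : p.simpleRoot i p.rhoCheck = 1 := by
  classical
  simp [rhoCheck, map_sum, simpleRoot_coweight]

/-- The root `β` as a linear form on `𝔱`. -/
abbrev rt (_p : Pinning H) (β : H.root) : Dual ℂ H := (rootSystem H).root β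

theorem rt_simple (i : p.I) : p.rt i.1 = p.simpleRoot i := rfl

theorem rt_injective {β γ : H.root} (h : p.rt β = p.rt γ) : β = γ := (rootSystem H).root.injective h

theorem simple_injective {i j : p.I} (h : p.simpleRoot i = p.simpleRoot j) : i = j :=
  Subtype.ext (p.rt_injective h)

/-- The height of a root is its value on `ρ^∨`. -/
theorem rt_rhoCheck (β : H.root) : p.rt β p.rhoCheck = p.base.height β := by
  obtain ⟨f, -, -, hf⟩ := p.base.exists_root_eq_sum_int β
  rw [rt, RootPairing.Base.height_eq_sum hf, hf, LinearMap.sum_apply, ← Finset.sum_coe_sort]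
  push_cast
  rw [← Finset.sum_coe_sort p.base.support (fun j => (f j : ℂ))]
  refine Finset.sum_congr rfl fun i _ => ?_
  rw [LinearMap.smul_apply]
  have := p.simpleRoot_rhoCheck i
  rw [simpleRoot] at this
  rw [this]; simp

theorem mem_posRoots {β : H.root} : β ∈ p.posRoots ↔ 0 < p.base.height β := Iff.rfl

theorem notMem_posRoots {β : H.root} : β ∉ p.posRoots ↔ p.base.height β < 0 := by
  rw [mem_posRoots]
  have := p.base.height_ne_zero β
  omega

theorem simple_mem_posRoots (i : p.I) : i.1 ∈ p.posRoots :=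
  RootPairing.Base.isPos_of_mem_support i.2

/-- The coefficient of `αⱼ` in the root `β`. -/
def coordAt (β : H.root) (j : p.I) : ℂ := p.rt β (p.coweight j)

/-- A positive root has natural numbers as coordinates in the simple roots. -/
theorem exists_nat_coord {β : H.root} (hβ : β ∈ p.posRoots) :
    ∃ f : p.I → ℕ, p.rt β = ∑ j, f j • p.simpleRoot j ∧ ∀ j, p.coordAt β j = f j := by
  classical
  obtain ⟨f, -, hf⟩ := p.base.exists_root_eq_sum_nat_or_neg β
  have key : ∀ g : p.I → ℤ, p.rt β = ∑ j, g j • p.simpleRoot j → ∀ j, p.coordAt β j = g j := by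
    intro g hg j
    rw [coordAt, hg, LinearMap.sum_apply]
    simp [simpleRoot_coweight]
  rcases hf with hf | hf
  · refine ⟨fun j => f j, ?_, fun j => ?_⟩
    · rw [rt, hf, ← Finset.sum_coe_sort]; rfl
    · exact_mod_cast key (fun j => f j) (by
        rw [rt, hf, ← Finset.sum_coe_sort]
        exact Finset.sum_congr rfl fun j _ => (natCast_zsmul _ _).symm) j
  · exfalso
    have h1 : p.base.height β = ∑ j ∈ p.base.support, (-(f j : ℤ)) := by
      apply RootPairing.Base.height_eq_sum
      rw [hf]; simp
    rw [mem_posRoots, h1] at hβ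
    have : ∑ j ∈ p.base.support, (-(f j : ℤ)) ≤ 0 := Finset.sum_nonpos fun j _ => by simp
    omega

/-- The positive roots generated by the `αᵢ` with `i ∈ J` are those whose other coordinates vanish.
-/
theorem mem_posRootsP {J : Set p.I} {β : H.root} :
    β ∈ p.posRootsP J ↔ β ∈ p.posRoots ∧ ∀ j ∉ J, p.coordAt β j = 0 := by
  classical
  refine ⟨fun ⟨h1, h2⟩ => ⟨h1, fun j hj => ?_⟩, fun ⟨h1, h2⟩ => ⟨h1, ?_⟩⟩
  · rw [coordAt]
    change p.rt β ∈ _ at h2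
    generalize p.rt β = χ at h2
    induction h2 using AddSubmonoid.closure_induction with
    | mem x hx =>
      obtain ⟨i, hi, rfl⟩ := hx
      rw [simpleRoot_coweight, if_neg]
      rintro rfl; exact hj hi
    | zero => simp
    | add x y _ _ hx hy => simp [hx, hy]
  · obtain ⟨f, hf, hc⟩ := p.exists_nat_coord h1
    change p.rt β ∈ AddSubmonoid.closure (p.simpleRoot '' J)
    rw [hf]
    refine AddSubmonoid.sum_mem _ fun j _ => ?_
    by_cases hj : j ∈ J
    · exact AddSubmonoid.nsmul_mem _ (AddSubmonoid.subset_closure (Set.mem_image_of_mem _ hj)) _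
    · have := hc j
      rw [h2 j hj] at this
      have h0 : f j = 0 := by exact_mod_cast this.symm
      rw [h0, zero_smul]; exact zero_mem _

open Classical in
theorem mem_posRootsOutside {J : Set p.I} {β : H.root} :
    β ∈ p.posRootsOutside J ↔ β ∈ p.posRoots ∧ ∃ j ∉ J, p.coordAt β j ≠ 0 := by
  rw [posRootsOutside, Finset.mem_filter, mem_posRootsP]
  simp only [Finset.mem_univ, true_and, not_and, not_forall]
  constructor
  · rintro ⟨h1, h2⟩
    obtain ⟨j, hj, h⟩ := h2 h1
    exact ⟨h1, j, hj, h⟩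
  · rintro ⟨h1, j, hj, h⟩
    exact ⟨h1, fun _ => ⟨j, hj, h⟩⟩

/-! ### Weyl group elements as linear maps -/

theorem rt_simpleReflection (i : p.I) (β : H.root) :
    p.rt (p.simpleReflection i β) = (rootSystem H).reflection i.1 (p.rt β) :=
  (rootSystem H).root_reflectionPerm i.1 β

theorem rt_simpleReflection' (i : p.I) (β : H.root) :
    p.rt (p.simpleReflection i β) = p.rt β - p.rt β (p.sCoroot i) • p.simpleRoot i := by
  rw [rt_simpleReflection, RootPairing.reflection_apply]; rfl

theorem simpleReflection_mul_self (i : p.I) : p.simpleReflection i * p.simpleReflection i = 1 := by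
  ext β; simp [simpleReflection]

theorem simpleReflection_apply_self (i : p.I) (β : H.root) :
    p.simpleReflection i (p.simpleReflection i β) = β := by simp [simpleReflection]

theorem simpleReflection_inv (i : p.I) : (p.simpleReflection i)⁻¹ = p.simpleReflection i := by
  simp [simpleReflection]

theorem weylWord_nil : p.weylWord [] = 1 := rfl

theorem weylWord_cons (i : p.I) (l : List p.I) :
    p.weylWord (i :: l) = p.simpleReflection i * p.weylWord l := by simp [weylWord]

theorem weylWord_append (l m : List p.I) :
    p.weylWord (l ++ m) = p.weylWord l * p.weylWord m := by simp [weylWord]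

theorem weylWord_reverse (l : List p.I) : p.weylWord l.reverse = (p.weylWord l)⁻¹ := by
  induction l with
  | nil => simp [weylWord]
  | cons i l ih =>
    rw [List.reverse_cons, weylWord_append, ih, weylWord_cons, weylWord_cons, weylWord_nil,
      mul_inv_rev, simpleReflection_inv, mul_one]

/-- `w` is induced by a linear automorphism of `𝔱*`. -/
def IsLin (w : Equiv.Perm H.root) : Prop :=
  ∃ g : Dual ℂ H ≃ₗ[ℂ] Dual ℂ H, ∀ β, (rootSystem H).root (w β) = g ((rootSystem H).root β)

theorem isLin_weylWord (l : List p.I) : IsLin (p.weylWord l) := by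
  induction l with
  | nil => exact ⟨LinearEquiv.refl _ _, fun β => rfl⟩
  | cons i l ih =>
    obtain ⟨g, hg⟩ := ih
    refine ⟨g.trans ((rootSystem H).reflection i.1), fun β => ?_⟩
    rw [weylWord_cons, Equiv.Perm.mul_apply]
    exact (p.rt_simpleReflection i _).trans (congrArg _ (hg β))

theorem IsLin.inv {w : Equiv.Perm H.root} (h : IsLin w) : IsLin w⁻¹ := by
  obtain ⟨g, hg⟩ := h
  refine ⟨g.symm, fun β => ?_⟩
  rw [LinearEquiv.eq_symm_apply, ← hg]
  simp

theorem IsLin.map_neg {w : Equiv.Perm H.root} (h : IsLin w) {β γ : H.root}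
    (hβ : p.rt γ = -p.rt β) : p.rt (w γ) = -p.rt (w β) := by
  obtain ⟨g, hg⟩ := h
  change (rootSystem H).root (w γ) = -(rootSystem H).root (w β)
  rw [hg, hg, ← _root_.map_neg]; exact congrArg g hβ

theorem IsLin.map_add {w : Equiv.Perm H.root} (h : IsLin w) {β γ δ : H.root}
    (hβ : p.rt β = p.rt γ + p.rt δ) : p.rt (w β) = p.rt (w γ) + p.rt (w δ) := by
  obtain ⟨g, hg⟩ := h
  change (rootSystem H).root (w β) = (rootSystem H).root (w γ) + (rootSystem H).root (w δ)
  rw [hg, hg, hg, ← _root_.map_add]; exact congrArg g hβ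

theorem exists_neg (β : H.root) : ∃ γ, p.rt γ = -p.rt β :=
  ⟨(rootSystem H).reflectionPerm β β, by
    rw [rt, RootPairing.root_reflectionPerm, RootPairing.reflection_apply_self]⟩

theorem height_of_neg {β γ : H.root} (h : p.rt γ = -p.rt β) :
    p.base.height γ = -p.base.height β := by
  have h1 := p.rt_rhoCheck γ
  rw [h, LinearMap.neg_apply, p.rt_rhoCheck β] at h1
  exact_mod_cast h1.symm

theorem height_of_add {β γ δ : H.root} (h : p.rt β = p.rt γ + p.rt δ) :
    p.base.height β = p.base.height γ + p.base.height δ := p.base.height_add h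

theorem height_simple (i : p.I) : p.base.height i.1 = 1 :=
  RootPairing.Base.height_one_of_mem_support i.2

theorem neg_mem_posRoots_iff {β γ : H.root} (h : p.rt γ = -p.rt β) :
    γ ∈ p.posRoots ↔ β ∉ p.posRoots := by
  rw [notMem_posRoots, mem_posRoots, p.height_of_neg h]; omega

theorem rt_simpleReflection_simple (i : p.I) :
    p.rt (p.simpleReflection i i.1) = -p.simpleRoot i := by
  rw [rt_simpleReflection, RootPairing.reflection_apply_self]; rfl

theorem simpleReflection_pos {i : p.I} {β : H.root} (hβ : β ∈ p.posRoots) (h : β ≠ i.1) :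
    p.simpleReflection i β ∈ p.posRoots :=
  RootPairing.Base.IsPos.reflectionPerm hβ i.2 h

theorem simpleReflection_simple_neg (i : p.I) : p.simpleReflection i i.1 ∉ p.posRoots := by
  rw [← p.neg_mem_posRoots_iff (γ := i.1)]
  · exact p.simple_mem_posRoots i
  · rw [rt_simpleReflection_simple, neg_neg, rt_simple]

/-! ### Inversions and length -/

open Classical in
/-- The positive roots made negative by `w⁻¹`. -/
def invSet (w : Equiv.Perm H.root) : Finset H.root :=
  Finset.univ.filter fun β => β ∈ p.posRoots ∧ w⁻¹ β ∉ p.posRoots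

theorem mem_invSet {w : Equiv.Perm H.root} {β : H.root} :
    β ∈ p.invSet w ↔ β ∈ p.posRoots ∧ w⁻¹ β ∉ p.posRoots := by
  simp [invSet]

theorem inv_simple_mul_apply (i : p.I) (w : Equiv.Perm H.root) (β : H.root) :
    (p.simpleReflection i * w)⁻¹ β = w⁻¹ (p.simpleReflection i β) := by
  rw [mul_inv_rev, simpleReflection_inv]; rfl

open Classical in
/-- If `w⁻¹ αᵢ` is positive, the inversions of `sᵢ w` are `αᵢ` and the images under `sᵢ` of those
of `w`. -/
theorem invSet_simple_mul {w : Equiv.Perm H.root} (hw : IsLin w) {i : p.I}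
    (hi : w⁻¹ i.1 ∈ p.posRoots) :
    p.invSet (p.simpleReflection i * w) =
      insert i.1 ((p.invSet w).image (p.simpleReflection i)) := by
  ext β
  rw [mem_invSet, inv_simple_mul_apply, Finset.mem_insert, Finset.mem_image]
  constructor
  · rintro ⟨h1, h2⟩
    by_cases hb : β = i.1
    · exact Or.inl hb
    · exact Or.inr ⟨p.simpleReflection i β, p.mem_invSet.mpr ⟨p.simpleReflection_pos h1 hb, h2⟩,
        p.simpleReflection_apply_self i β⟩
  · rintro (rfl | ⟨γ, hγ, rfl⟩)
    · refine ⟨p.simple_mem_posRoots i, ?_⟩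
      rw [← p.neg_mem_posRoots_iff (γ := w⁻¹ i.1)]
      · exact hi
      · exact IsLin.map_neg p hw.inv (by rw [rt_simpleReflection_simple, neg_neg, rt_simple])
    · rw [mem_invSet] at hγ
      refine ⟨p.simpleReflection_pos hγ.1 ?_, by rw [simpleReflection_apply_self]; exact hγ.2⟩
      rintro rfl
      exact hγ.2 hi

theorem simple_notMem_image_invSet [DecidableEq H.root] (w : Equiv.Perm H.root) (i : p.I) :
    i.1 ∉ (p.invSet w).image (p.simpleReflection i) := by
  intro h
  obtain ⟨γ, hγ, h⟩ := Finset.mem_image.mp h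
  have : γ = p.simpleReflection i i.1 := by rw [← h, simpleReflection_apply_self]
  rw [this] at hγ
  exact p.simpleReflection_simple_neg i (p.mem_invSet.mp hγ).1

theorem card_invSet_simple_mul {w : Equiv.Perm H.root} (hw : IsLin w) {i : p.I}
    (hi : w⁻¹ i.1 ∈ p.posRoots) :
    (p.invSet (p.simpleReflection i * w)).card = (p.invSet w).card + 1 := by
  classical
  rw [p.invSet_simple_mul hw hi, Finset.card_insert_of_notMem (p.simple_notMem_image_invSet w i),
    Finset.card_image_of_injective _ (p.simpleReflection i).injective]

theorem isLin_simple_mul {w : Equiv.Perm H.root} (hw : IsLin w) (i : p.I) :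
    IsLin (p.simpleReflection i * w) := by
  obtain ⟨g, hg⟩ := hw
  refine ⟨g.trans ((rootSystem H).reflection i.1), fun β => ?_⟩
  rw [Equiv.Perm.mul_apply]
  exact (p.rt_simpleReflection i _).trans (congrArg _ (hg β))

theorem card_invSet_simple_mul_of_neg {w : Equiv.Perm H.root} (hw : IsLin w) {i : p.I}
    (hi : w⁻¹ i.1 ∉ p.posRoots) :
    (p.invSet (p.simpleReflection i * w)).card + 1 = (p.invSet w).card := by
  have h1 : (p.simpleReflection i * w)⁻¹ i.1 ∈ p.posRoots := by
    rw [inv_simple_mul_apply, p.neg_mem_posRoots_iff (β := w⁻¹ i.1)]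
    · exact hi
    · exact IsLin.map_neg p hw.inv (p.rt_simpleReflection_simple i)
  rw [← p.card_invSet_simple_mul (p.isLin_simple_mul hw i) h1, ← mul_assoc,
    simpleReflection_mul_self, one_mul]

theorem card_invSet_weylWord_le (l : List p.I) : (p.invSet (p.weylWord l)).card ≤ l.length := by
  induction l with
  | nil => simp [invSet, weylWord]
  | cons i l ih =>
    rw [weylWord_cons, List.length_cons]
    by_cases hi : (p.weylWord l)⁻¹ i.1 ∈ p.posRoots
    · rw [p.card_invSet_simple_mul (p.isLin_weylWord l) hi]; omega
    · have := p.card_invSet_simple_mul_of_neg (p.isLin_weylWord l) hi; omega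

/-- The exchange property: a positive root `β` made negative by `w⁻¹`, for `w` given by a word,
is removed by the reflection in `β` by deleting one letter of the word. -/
theorem exchange (r : List p.I) : ∀ β ∈ p.posRoots, (p.weylWord r)⁻¹ β ∉ p.posRoots →
    ∃ r', (rootSystem H).reflectionPerm β * p.weylWord r = p.weylWord r' ∧
      r'.length + 1 = r.length := by
  induction r with
  | nil => intro β h1 h2; exact absurd h1 (by simpa [weylWord] using h2)
  | cons j q ih =>
    intro β h1 h2
    by_cases hb : β = j.1
    · refine ⟨q, ?_, rfl⟩
      rw [hb, weylWord_cons, ← mul_assoc]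
      change p.simpleReflection j * p.simpleReflection j * _ = _
      rw [simpleReflection_mul_self, one_mul]
    · rw [weylWord_cons, inv_simple_mul_apply] at h2
      obtain ⟨q', hq, hlen⟩ := ih _ (p.simpleReflection_pos h1 hb) h2
      refine ⟨j :: q', ?_, by simp [hlen]⟩
      rw [weylWord_cons, weylWord_cons, ← hq]
      have h3 : (rootSystem H).reflectionPerm (p.simpleReflection j β) =
          p.simpleReflection j * (rootSystem H).reflectionPerm β * p.simpleReflection j := by
        ext1 γ
        apply (rootSystem H).root.injective
        simp only [simpleReflection, Equiv.Perm.mul_apply, RootPairing.root_reflectionPerm,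
          RootPairing.reflection_reflectionPerm]
        rfl
      rw [h3]
      simp only [mul_assoc]
      rw [← mul_assoc (p.simpleReflection j) (p.simpleReflection j), simpleReflection_mul_self,
        one_mul]

/-- A word longer than the number of inversions of its product can be shortened, by the exchange
property. -/
theorem exists_shorter (l : List p.I) (h : (p.invSet (p.weylWord l)).card < l.length) :
    ∃ l', p.weylWord l' = p.weylWord l ∧ l'.length < l.length := by
  induction l with
  | nil => simp at h
  | cons i r ih =>
    by_cases hr : (p.invSet (p.weylWord r)).card < r.length
    · obtain ⟨l', h1, h2⟩ := ih hr
      exact ⟨i :: l', by rw [weylWord_cons, weylWord_cons, h1], by simpa using h2⟩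
    · have hi : (p.weylWord r)⁻¹ i.1 ∉ p.posRoots := fun hi => by
        rw [weylWord_cons, p.card_invSet_simple_mul (p.isLin_weylWord r) hi] at h
        simp at h; omega
      obtain ⟨r', h1, h2⟩ := p.exchange r i.1 (p.simple_mem_posRoots i) hi
      exact ⟨r', by rw [← h1, weylWord_cons]; rfl, by simp; omega⟩

/-- The length of a Weyl group element is its number of inversions. -/
theorem length_weylWord (l : List p.I) :
    p.length (p.weylWord l) = (p.invSet (p.weylWord l)).card := by
  have hne : {m | ∃ l' : List p.I, p.weylWord l' = p.weylWord l ∧ l'.length = m}.Nonempty :=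
    ⟨_, l, rfl, rfl⟩
  obtain ⟨l', h1, h2⟩ := Nat.sInf_mem hne
  change l'.length = p.length (p.weylWord l) at h2
  refine le_antisymm ?_ ?_
  · by_contra hlt
    rw [not_le, ← h2] at hlt
    obtain ⟨l'', h3, h4⟩ := p.exists_shorter l' (by rw [h1]; exact hlt)
    have : p.length (p.weylWord l) ≤ l''.length := Nat.sInf_le ⟨l'', by rw [h3, h1], rfl⟩
    omega
  · rw [← h2, ← h1]; exact p.card_invSet_weylWord_le l'

/-- A word is reduced if its length is the number of inversions of its product. -/
def IsReduced (l : List p.I) : Prop := (p.invSet (p.weylWord l)).card = l.length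

theorem IsReduced.of_cons {i : p.I} {l : List p.I} (h : p.IsReduced (i :: l)) :
    p.IsReduced l ∧ (p.weylWord l)⁻¹ i.1 ∈ p.posRoots := by
  rw [IsReduced, weylWord_cons, List.length_cons] at h
  have h1 := p.card_invSet_weylWord_le l
  by_cases hi : (p.weylWord l)⁻¹ i.1 ∈ p.posRoots
  · rw [p.card_invSet_simple_mul (p.isLin_weylWord l) hi] at h
    exact ⟨by rw [IsReduced]; omega, hi⟩
  · have := p.card_invSet_simple_mul_of_neg (p.isLin_weylWord l) hi; omega

theorem IsReduced.cons {i : p.I} {l : List p.I} (h : p.IsReduced l)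
    (hi : (p.weylWord l)⁻¹ i.1 ∈ p.posRoots) : p.IsReduced (i :: l) := by
  rw [IsReduced, weylWord_cons, p.card_invSet_simple_mul (p.isLin_weylWord l) hi, h]; simp

theorem exists_reduced (l : List p.I) : ∃ l', p.weylWord l' = p.weylWord l ∧ p.IsReduced l' := by
  have hne : {m | ∃ l' : List p.I, p.weylWord l' = p.weylWord l ∧ l'.length = m}.Nonempty :=
    ⟨_, l, rfl, rfl⟩
  obtain ⟨l', h1, h2⟩ := Nat.sInf_mem hne
  change l'.length = p.length (p.weylWord l) at h2
  exact ⟨l', h1, by rw [IsReduced, h2, h1, length_weylWord]⟩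

end Pinning

theorem perm_inv_apply {ι : Type*} (w : Equiv.Perm ι) (b : ι) : w⁻¹ (w b) = b :=
  w.symm_apply_apply b

theorem perm_apply_inv {ι : Type*} (w : Equiv.Perm ι) (b : ι) : w (w⁻¹ b) = b :=
  w.apply_symm_apply b

namespace Pinning

variable (p : Pinning H)

/-! ### Longest elements and `w_P` -/

theorem exists_word_of_mem_weylSubgroup {J : Set p.I} {w : Equiv.Perm H.root}
    (hw : w ∈ p.weylSubgroup J) : ∃ l : List p.I, p.weylWord l = w ∧ ∀ i ∈ l, i ∈ J := by
  induction hw using Subgroup.closure_induction with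
  | mem x hx =>
    obtain ⟨i, hi, rfl⟩ := hx
    exact ⟨[i], by simp [weylWord], by simpa using hi⟩
  | one => exact ⟨[], rfl, by simp⟩
  | mul x y _ _ hx hy =>
    obtain ⟨l, rfl, hl⟩ := hx
    obtain ⟨m, rfl, hm⟩ := hy
    refine ⟨l ++ m, p.weylWord_append l m, fun i hi => ?_⟩
    rcases List.mem_append.mp hi with h | h
    exacts [hl i h, hm i h]
  | inv x _ hx =>
    obtain ⟨l, rfl, hl⟩ := hx
    exact ⟨l.reverse, p.weylWord_reverse l, fun i hi => hl i (by simpa using hi)⟩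

theorem longest_mem (J : Set p.I) : p.longest J ∈ p.weylSubgroup J :=
  (p.exists_longest J).choose_spec.1

theorem length_le_longest {J : Set p.I} {v : Equiv.Perm H.root} (hv : v ∈ p.weylSubgroup J) :
    p.length v ≤ p.length (p.longest J) :=
  (p.exists_longest J).choose_spec.2 v hv

theorem isLin_longest (J : Set p.I) : IsLin (p.longest J) := by
  obtain ⟨l, hl, -⟩ := p.exists_word_of_mem_weylSubgroup (p.longest_mem J)
  rw [← hl]; exact p.isLin_weylWord l

/-- The longest element of `W_J` makes the simple roots in `J` negative: otherwise multiplying it by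
the simple reflection would give a longer element. -/
theorem longest_inv_simple {J : Set p.I} {i : p.I} (hi : i ∈ J) :
    (p.longest J)⁻¹ i.1 ∉ p.posRoots := by
  intro h
  obtain ⟨l, hl, -⟩ := p.exists_word_of_mem_weylSubgroup (p.longest_mem J)
  have h1 := p.card_invSet_simple_mul (p.isLin_longest J) h
  have h2 : p.simpleReflection i * p.longest J ∈ p.weylSubgroup J :=
    mul_mem (Subgroup.subset_closure (Set.mem_image_of_mem _ hi)) (p.longest_mem J)
  have h3 := p.length_le_longest h2
  rw [← hl, ← weylWord_cons, length_weylWord, length_weylWord, weylWord_cons, hl] at h3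
  omega

theorem height_map_eq_sum {w : Equiv.Perm H.root} (hw : IsLin w) {β : H.root} {f : p.I → ℕ}
    (hf : p.rt β = ∑ j, f j • p.simpleRoot j) :
    p.base.height (w β) = ∑ j, f j * p.base.height (w j.1) := by
  obtain ⟨g, hg⟩ := hw
  have h1 : p.rt (w β) = ∑ j, f j • p.rt (w j.1) := by
    rw [rt, hg]
    change g (p.rt β) = _
    rw [hf, map_sum]
    refine Finset.sum_congr rfl fun j _ => ?_
    rw [map_nsmul, rt, hg]; rfl
  have h2 := congrArg (fun φ : Dual ℂ H => φ p.rhoCheck) h1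
  simp only [LinearMap.sum_apply, LinearMap.smul_apply] at h2
  rw [rt_rhoCheck] at h2
  simp only [rt_rhoCheck, nsmul_eq_mul] at h2
  exact_mod_cast h2

/-- The longest element of `W_J` makes all positive roots of `J` negative. -/
theorem longest_inv_neg {J : Set p.I} {β : H.root} (hβ : β ∈ p.posRootsP J) :
    (p.longest J)⁻¹ β ∉ p.posRoots := by
  rw [mem_posRootsP] at hβ
  obtain ⟨f, hf, hc⟩ := p.exists_nat_coord hβ.1
  rw [notMem_posRoots, p.height_map_eq_sum (p.isLin_longest J).inv hf]
  have h0 : ∀ j, f j * p.base.height ((p.longest J)⁻¹ j.1) ≤ 0 := by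
    intro j
    by_cases hj : j ∈ J
    · have := (p.notMem_posRoots).mp (p.longest_inv_simple hj)
      nlinarith [Int.natCast_nonneg (f j)]
    · have := hc j
      rw [hβ.2 j hj] at this
      have h0 : f j = 0 := by exact_mod_cast this.symm
      simp [h0]
  have h1 : ∃ j, f j ≠ 0 := by
    by_contra hcon
    push Not at hcon
    have : p.rt β = 0 := by rw [hf]; simp [hcon]
    exact (rootSystem H).ne_zero β this
  obtain ⟨j, hj⟩ := h1
  refine Finset.sum_neg' (fun j _ => h0 j) ⟨j, Finset.mem_univ j, ?_⟩
  have hjJ : j ∈ J := by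
    by_contra hjJ
    have := hc j
    rw [hβ.2 j hjJ] at this
    exact hj (by exact_mod_cast this.symm)
  have := (p.notMem_posRoots).mp (p.longest_inv_simple hjJ)
  have h3 : (0 : ℤ) < f j := by positivity
  nlinarith

/-- A root with a nonzero coordinate outside `J` keeps it under `sᵢ`, `i ∈ J`, hence stays
positive. -/
theorem simpleReflection_mem_outside {J : Set p.I} {i : p.I} (hi : i ∈ J) {β : H.root}
    (hβ : β ∈ p.posRootsOutside J) : p.simpleReflection i β ∈ p.posRootsOutside J := by
  classical
  rw [mem_posRootsOutside] at hβ ⊢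
  obtain ⟨h1, j, hj, h2⟩ := hβ
  have hij : i ≠ j := fun h => hj (h ▸ hi)
  refine ⟨p.simpleReflection_pos h1 ?_, j, hj, ?_⟩
  · rintro rfl
    apply h2
    rw [coordAt, rt_simple, simpleRoot_coweight, if_neg hij]
  · rw [coordAt, rt_simpleReflection', LinearMap.sub_apply, LinearMap.smul_apply,
      simpleRoot_coweight, if_neg hij]
    simpa [coordAt] using h2

theorem word_mem_outside {J : Set p.I} {l : List p.I} (hl : ∀ i ∈ l, i ∈ J) {β : H.root}
    (hβ : β ∈ p.posRootsOutside J) : p.weylWord l β ∈ p.posRootsOutside J := by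
  induction l with
  | nil => simpa [weylWord] using hβ
  | cons i l ih =>
    rw [weylWord_cons, Equiv.Perm.mul_apply]
    exact p.simpleReflection_mem_outside (hl i (by simp)) (ih fun j hj => hl j (by simp [hj]))

theorem longest_inv_mem_outside {J : Set p.I} {β : H.root} (hβ : β ∈ p.posRootsOutside J) :
    (p.longest J)⁻¹ β ∈ p.posRootsOutside J := by
  obtain ⟨l, hl, hJ⟩ := p.exists_word_of_mem_weylSubgroup (inv_mem (p.longest_mem J))
  rw [← hl]; exact p.word_mem_outside hJ hβ

theorem longest_univ_inv_pos {β : H.root} (hβ : β ∈ p.posRoots) :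
    (p.longest Set.univ)⁻¹ β ∉ p.posRoots :=
  p.longest_inv_neg (p.mem_posRootsP.mpr ⟨hβ, fun _ hj => absurd trivial hj⟩)

theorem longest_univ_inv_neg {β : H.root} (hβ : β ∉ p.posRoots) :
    (p.longest Set.univ)⁻¹ β ∈ p.posRoots := by
  obtain ⟨γ, hγ⟩ := p.exists_neg β
  have h1 := p.longest_univ_inv_pos ((p.neg_mem_posRoots_iff hγ).mpr hβ)
  rwa [p.neg_mem_posRoots_iff ((p.isLin_longest _).inv.map_neg p hγ), not_not] at h1

theorem wP_inv_apply (J : Set p.I) (β : H.root) :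
    (p.wP J)⁻¹ β = (p.longest Set.univ)⁻¹ ((p.longest J)⁻¹ β) := by
  rw [wP, mul_inv_rev]; rfl

theorem isLin_wP (J : Set p.I) : IsLin (p.wP J) := by
  obtain ⟨l, hl, -⟩ := p.exists_word_of_mem_weylSubgroup (p.longest_mem J)
  obtain ⟨m, hm, -⟩ := p.exists_word_of_mem_weylSubgroup (p.longest_mem Set.univ)
  rw [wP, ← hl, ← hm, ← weylWord_append]; exact p.isLin_weylWord _

theorem wP_inv_outside {J : Set p.I} {β : H.root} (hβ : β ∈ p.posRootsOutside J) :
    (p.wP J)⁻¹ β ∉ p.posRoots := by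
  rw [wP_inv_apply]
  exact p.longest_univ_inv_pos (p.mem_posRootsOutside.mp (p.longest_inv_mem_outside hβ)).1

theorem wP_inv_posRootsP {J : Set p.I} {β : H.root} (hβ : β ∈ p.posRootsP J) :
    (p.wP J)⁻¹ β ∈ p.posRoots := by
  rw [wP_inv_apply]; exact p.longest_univ_inv_neg (p.longest_inv_neg hβ)

theorem mem_outside_iff {J : Set p.I} {β : H.root} :
    β ∈ p.posRootsOutside J ↔ β ∈ p.posRoots ∧ β ∉ p.posRootsP J := by
  classical
  simp [posRootsOutside]

/-- The inversions of `w_P = w₀ᴾ w₀` are the positive roots that are not roots of `L_P`. -/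
theorem invSet_wP (J : Set p.I) : p.invSet (p.wP J) = p.posRootsOutside J := by
  ext β
  rw [mem_invSet]
  refine ⟨fun ⟨h1, h2⟩ => p.mem_outside_iff.mpr ⟨h1, fun h => h2 (p.wP_inv_posRootsP h)⟩,
    fun h => ⟨(p.mem_outside_iff.mp h).1, p.wP_inv_outside h⟩⟩

theorem simple_mem_outside {J : Set p.I} {i : p.I} (hi : i ∉ J) : i.1 ∈ p.posRootsOutside J := by
  classical
  refine p.mem_posRootsOutside.mpr ⟨p.simple_mem_posRoots i, i, hi, ?_⟩
  rw [coordAt, rt_simple, simpleRoot_coweight]; simp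

theorem simple_mem_posRootsP {J : Set p.I} {i : p.I} (hi : i ∈ J) : i.1 ∈ p.posRootsP J := by
  classical
  refine p.mem_posRootsP.mpr ⟨p.simple_mem_posRoots i, fun j hj => ?_⟩
  rw [coordAt, rt_simple, simpleRoot_coweight, if_neg]
  rintro rfl; exact hj hi

/-- A positive root is simple or the sum of a positive root and a simple root. -/
theorem simple_or_add {γ : H.root} (hγ : γ ∈ p.posRoots) :
    (∃ j : p.I, γ = j.1) ∨ ∃ j : p.I, ∃ δ ∈ p.posRoots, p.rt γ = p.rt δ + p.simpleRoot j := by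
  obtain ⟨j, hj, hpos⟩ := RootPairing.Base.IsPos.exists_mem_support_pos_pairingIn hγ
  by_cases h : γ = j
  · exact Or.inl ⟨⟨j, hj⟩, h⟩
  · right
    have h1 : 0 < (rootSystem H).pairingIn ℤ γ j :=
      ((rootSystem H).zero_lt_pairingIn_iff' (S := ℤ)).mp hpos
    obtain ⟨δ, hδ⟩ := (rootSystem H).root_sub_root_mem_of_pairingIn_pos h1 h
    exact ⟨⟨j, hj⟩, δ, RootPairing.Base.IsPos.sub hγ hj hδ, eq_add_of_sub_eq hδ.symm⟩

/-- The inverse of `w_P` carries the simple roots of `L_P` to simple roots. -/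
theorem wP_inv_simple {J : Set p.I} {i : p.I} (hi : i ∈ J) : ∃ j : p.I, (p.wP J)⁻¹ i.1 = j.1 := by
  classical
  have hpos := p.wP_inv_posRootsP (p.simple_mem_posRootsP hi)
  rcases p.simple_or_add hpos with h | ⟨j, δ, hδ, hadd⟩
  · exact h
  exfalso
  -- If `w_P⁻¹ αᵢ` were a sum of positive roots `a` and `b`, then `αᵢ = w_P a + w_P b`. If just
  -- one of the summands is negative, say `w_P b`, then `-w_P b` is an inversion of `w_P`, hence
  -- has a nonzero coordinate outside `J`. This coordinate reappears in `w_P a`, which is thus an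
  -- inversion as well.
  have key : ∀ a b : H.root, a ∈ p.posRoots → b ∈ p.posRoots →
      p.rt i.1 = p.rt (p.wP J a) + p.rt (p.wP J b) →
      p.wP J a ∈ p.posRoots → p.wP J b ∉ p.posRoots → False := by
    intro a b ha hb hab h1 h2
    obtain ⟨c, hc⟩ := p.exists_neg (p.wP J b)
    have hcpos : c ∈ p.posRoots := (p.neg_mem_posRoots_iff hc).mpr h2
    have hcinv : (p.wP J)⁻¹ c ∉ p.posRoots := by
      rw [p.neg_mem_posRoots_iff ((p.isLin_wP J).inv.map_neg p hc)]
      simpa using hb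
    have hcout : c ∈ p.posRootsOutside J := by
      rw [← invSet_wP, mem_invSet]; exact ⟨hcpos, hcinv⟩
    obtain ⟨-, k, hk, hck⟩ := p.mem_posRootsOutside.mp hcout
    have hka : p.wP J a ∈ p.posRootsOutside J := by
      refine p.mem_posRootsOutside.mpr ⟨h1, k, hk, ?_⟩
      have h3 := congrArg (fun φ : Dual ℂ H => φ (p.coweight k)) hab
      simp only [LinearMap.add_apply] at h3
      rw [rt_simple, simpleRoot_coweight, if_neg (by rintro rfl; exact hk hi)] at h3
      have h4 := congrArg (fun φ : Dual ℂ H => φ (p.coweight k)) hc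
      simp only [LinearMap.neg_apply] at h4
      rw [coordAt] at hck ⊢
      rw [h4] at hck
      intro h5
      rw [h5, zero_add] at h3
      exact hck (by rw [← h3, neg_zero])
    have := p.wP_inv_outside hka
    rw [perm_inv_apply] at this
    exact this ha
  have hsum : p.rt i.1 = p.rt (p.wP J δ) + p.rt (p.wP J j.1) := by
    have := (p.isLin_wP J).map_add p (β := (p.wP J)⁻¹ i.1) (γ := δ) (δ := j.1) hadd
    simpa using this
  have hh := p.height_of_add hsum
  rw [height_simple] at hh
  by_cases h1 : p.wP J δ ∈ p.posRoots <;> by_cases h2 : p.wP J j.1 ∈ p.posRoots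
  · rw [mem_posRoots] at h1 h2; omega
  · exact key δ j.1 hδ (p.simple_mem_posRoots j) hsum h1 h2
  · exact key j.1 δ (p.simple_mem_posRoots j) hδ (by rw [hsum, add_comm]) h2 h1
  · rw [notMem_posRoots] at h1 h2; omega

/-- A simple root that `w_P` keeps positive is carried to a simple root of `L_P`. -/
theorem wP_simple_of_pos {J : Set p.I} {j : p.I} (hj : p.wP J j.1 ∈ p.posRoots) :
    ∃ i ∈ J, p.wP J j.1 = i.1 := by
  have hP : p.wP J j.1 ∈ p.posRootsP J := by
    by_contra h
    have := p.wP_inv_outside (p.mem_outside_iff.mpr ⟨hj, h⟩)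
    rw [perm_inv_apply] at this
    exact this (p.simple_mem_posRoots j)
  rcases p.simple_or_add hj with ⟨i, hi⟩ | ⟨k, δ, hδ, hadd⟩
  · refine ⟨i, ?_, hi⟩
    by_contra hiJ
    rw [hi] at hP
    exact (p.mem_outside_iff.mp (p.simple_mem_outside hiJ)).2 hP
  exfalso
  have hP' := (p.mem_posRootsP.mp hP).2
  have hsub : ∀ m ∉ J, p.coordAt δ m = 0 ∧ p.coordAt k.1 m = 0 := by
    intro m hm
    have h1 := hP' m hm
    obtain ⟨f, -, hf⟩ := p.exists_nat_coord hδ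
    obtain ⟨g, -, hg⟩ := p.exists_nat_coord (p.simple_mem_posRoots k)
    rw [coordAt, hadd, LinearMap.add_apply] at h1
    change p.coordAt δ m + p.coordAt k.1 m = 0 at h1
    rw [hf, hg] at h1 ⊢
    have : f m + g m = 0 := by exact_mod_cast h1
    constructor
    · have : f m = 0 := by omega
      simp [this]
    · have : g m = 0 := by omega
      simp [this]
  have h1 := p.wP_inv_posRootsP (p.mem_posRootsP.mpr ⟨hδ, fun m hm => (hsub m hm).1⟩)
  have h2 := p.wP_inv_posRootsP
    (p.mem_posRootsP.mpr ⟨p.simple_mem_posRoots k, fun m hm => (hsub m hm).2⟩)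
  have h3 := p.height_of_add ((p.isLin_wP J).inv.map_add p (δ := k.1) hadd)
  rw [perm_inv_apply, height_simple] at h3
  rw [mem_posRoots] at h1 h2
  omega

/-! ### The inversions attached to a word -/

/-- The roots `s_{i₁} ⋯ s_{i_{k-1}} α_{iₖ}` attached to a word. -/
def betas : List p.I → List H.root
  | [] => []
  | i :: l => i.1 :: (betas l).map (p.simpleReflection i)

/-- The roots attached to a reduced word are the inversions of its product. -/
theorem mem_betas {l : List p.I} (h : p.IsReduced l) (β : H.root) :
    β ∈ p.betas l ↔ β ∈ p.invSet (p.weylWord l) := by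
  classical
  induction l generalizing β with
  | nil => simp [betas, invSet, weylWord]
  | cons i l ih =>
    obtain ⟨h1, h2⟩ := IsReduced.of_cons p h
    rw [weylWord_cons, p.invSet_simple_mul (p.isLin_weylWord l) h2, betas, List.mem_cons,
      List.mem_map, Finset.mem_insert, Finset.mem_image]
    simp only [ih h1]

theorem nodup_betas {l : List p.I} (h : p.IsReduced l) : (p.betas l).Nodup := by
  classical
  induction l with
  | nil => simp [betas]
  | cons i l ih =>
    obtain ⟨h1, h2⟩ := IsReduced.of_cons p h
    rw [betas, List.nodup_cons]
    refine ⟨fun hm => ?_, (ih h1).map (p.simpleReflection i).injective⟩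
    obtain ⟨γ, hγ, hi⟩ := List.mem_map.mp hm
    exact p.simple_notMem_image_invSet (p.weylWord l) i
      (Finset.mem_image.mpr ⟨γ, (p.mem_betas h1 γ).mp hγ, hi⟩)

theorem prod_betas {l : List p.I} (h : p.IsReduced l) (F : H.root → ℂ) :
    ((p.betas l).map F).prod = ∏ β ∈ p.invSet (p.weylWord l), F β := by
  classical
  rw [← List.prod_toFinset F (p.nodup_betas h)]
  refine Finset.prod_congr (Finset.ext fun β => ?_) fun _ _ => rfl
  rw [List.mem_toFinset, p.mem_betas h]

end Pinning

/-! ### Weyl group representatives acting on root vectors -/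

theorem eq_zero_of_mem_wtSpace {χ : Dual ℂ H} (hχ : χ ≠ 0)
    (h : χ ∉ Set.range (rootSystem H).root) {z : 𝔤} (hz : z ∈ wtSpace H χ) : z = 0 := by
  by_contra h0
  obtain ⟨α, hα⟩ := exists_root_of_wtSpace_ne_bot hχ hz h0
  exact h ⟨α, hα⟩

/-- Twice a root is not a weight. -/
theorem eq_zero_of_mem_wtSpace_two_smul {β : H.root} {χ : Dual ℂ H}
    (hχ : χ = (2 : ℂ) • (rootSystem H).root β) {z : 𝔤} (hz : z ∈ wtSpace H χ) : z = 0 := by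
  have h := rootSpace_two_smul β.1 (LieSubalgebra.isNonZero_coe_root β)
  rw [mem_wtSpace_iff_mem_rootSpace] at hz
  have e : (χ : H → ℂ) = 2 • (β.1 : H → ℂ) := by
    ext x; rw [hχ]; simp
  rw [e, h] at hz
  simpa using hz

theorem exists_smul_of_mem_wtSpace {β : H.root} {y z : 𝔤}
    (hy : y ∈ wtSpace H ((rootSystem H).root β)) (hy0 : y ≠ 0)
    (hz : z ∈ wtSpace H ((rootSystem H).root β)) : ∃ c : ℂ, z = c • y := by
  have h1 := finrank_rootSpace_eq_one β.1 (LieSubalgebra.isNonZero_coe_root β)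
  rw [mem_wtSpace_root] at hy hz
  obtain ⟨c, hc⟩ := (finrank_eq_one_iff_of_nonzero' (⟨y, hy⟩ : rootSpace H (β.1 : H → ℂ))
    (fun h => hy0 (congrArg Subtype.val h))).mp h1 ⟨z, hz⟩
  exact ⟨c, (congrArg Subtype.val hc).symm⟩

namespace Pinning

variable (p : Pinning H)

theorem sbarWord_nil : p.sbarWord [] = 1 := rfl

theorem sbarWord_cons (i : p.I) (l : List p.I) :
    p.sbarWord (i :: l) = p.sbar i * p.sbarWord l := by simp [sbarWord]

theorem sbarWord_append (l m : List p.I) :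
    p.sbarWord (l ++ m) = p.sbarWord l * p.sbarWord m := by simp [sbarWord]

theorem sbarWord_mem_lieAut (l : List p.I) : p.sbarWord l ∈ lieAut 𝔤 := by
  induction l with
  | nil => exact one_mem _
  | cons i l ih => rw [sbarWord_cons]; exact mul_mem (p.sbar_mem_lieAut i) ih

theorem sbarWord_apply_root (l : List p.I) {β : H.root} {z : 𝔤} (hz : z ∈ wtSpace H (p.rt β)) :
    p.sbarWord l z ∈ wtSpace H (p.rt (p.weylWord l β)) := by
  induction l with
  | nil => exact hz
  | cons i l ih =>
    rw [sbarWord_cons, weylWord_cons, Equiv.Perm.mul_apply, LinearEquiv.mul_apply]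
    exact p.sbar_apply_root i ih

/-! ### Rank two -/

/-- The Cartan integer `⟨αᵢ, αₖ^∨⟩`. -/
def cart (i k : p.I) : ℤ := (rootSystem H).pairingIn ℤ i.1 k.1

theorem simpleRoot_sCoroot (i k : p.I) : p.simpleRoot i (p.sCoroot k) = p.cart i k := by
  have := (rootSystem H).algebraMap_pairingIn ℤ i.1 k.1
  rw [cart, ← eq_intCast (algebraMap ℤ ℂ), this]; rfl

theorem cart_cases {i k : p.I} (hik : i ≠ k) :
    (p.cart i k = 0 ∧ p.cart k i = 0) ∨ (p.cart i k = -1 ∧ p.cart k i = -1) ∨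
    (p.cart i k = -1 ∧ p.cart k i = -2) ∨ (p.cart i k = -2 ∧ p.cart k i = -1) ∨
    (p.cart i k = -1 ∧ p.cart k i = -3) ∨ (p.cart i k = -3 ∧ p.cart k i = -1) := by
  have hne : (i : H.root) ≠ k := fun h => hik (Subtype.ext h)
  have h1 := (rootSystem H).pairingIn_pairingIn_mem_set_of_isCrystal_of_isRed' (i := i.1)
    (j := k.1) (fun h => hne ((rootSystem H).root.injective h))
    (p.base.root_ne_neg_of_ne i.2 k.2 hne)
  have h2 : p.cart i k ≤ 0 := p.base.pairingIn_le_zero_of_ne hne i.2 k.2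
  have h3 : p.cart k i ≤ 0 := p.base.pairingIn_le_zero_of_ne hne.symm k.2 i.2
  change (p.cart i k, p.cart k i) ∈ _ at h1
  simp only [Set.mem_insert_iff, Set.mem_singleton_iff, Prod.mk.injEq] at h1
  omega

/-- If `⟨β, αₖ^∨⟩ < 0` and `β ≠ -αₖ`, then `β + αₖ` is a root. -/
theorem add_mem_roots {β : H.root} {k : p.I} {n : ℤ} (hn : n < 0)
    (h : p.rt β (p.sCoroot k) = n) (hne : p.rt β ≠ -p.simpleRoot k) :
    ∃ γ, p.rt γ = p.rt β + p.simpleRoot k := by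
  have h1 : (rootSystem H).pairingIn ℤ β k.1 < 0 := by
    have h2 := (rootSystem H).algebraMap_pairingIn ℤ β k.1
    have h3 : (rootSystem H).pairing β k.1 = n := h
    rw [h3, eq_intCast] at h2
    have : (rootSystem H).pairingIn ℤ β k.1 = n := by exact_mod_cast h2
    omega
  obtain ⟨γ, hγ⟩ := (rootSystem H).root_add_root_mem_of_pairingIn_neg h1 hne
  exact ⟨γ, hγ⟩

theorem simpleRoot_ne_neg (i k : p.I) : p.simpleRoot i ≠ -p.simpleRoot k := by
  intro h
  have h1 := p.simpleRoot_rhoCheck i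
  rw [h, LinearMap.neg_apply, simpleRoot_rhoCheck] at h1
  norm_num at h1

theorem eq_zero_of_mem_wtSpace_sub {i k : p.I} (hik : i ≠ k) {z : 𝔤}
    (hz : z ∈ wtSpace H (p.simpleRoot i - p.simpleRoot k)) : z = 0 := by
  refine eq_zero_of_mem_wtSpace (fun h => hik ?_) (p.base.sub_notMem_range_root i.2 k.2) hz
  exact p.simple_injective (sub_eq_zero.mp h)

/-- `αᵢ + (n + 1) αₖ` is not a root if `n = -⟨αᵢ, αₖ^∨⟩`. -/
theorem eq_zero_of_mem_wtSpace_top {i k : p.I} (hik : i ≠ k) {z : 𝔤}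
    (hz : z ∈ wtSpace H (p.simpleRoot i + (1 - p.cart i k : ℂ) • p.simpleRoot k)) : z = 0 := by
  -- The reflection in `αₖ` carries this weight to `αᵢ - αₖ`, which is not a root.
  have h := p.sbar_apply_mem_wtSpace k hz
  have e : (rootSystem H).reflection k.1
      (p.simpleRoot i + (1 - p.cart i k : ℂ) • p.simpleRoot k) =
      p.simpleRoot i - p.simpleRoot k := by
    rw [RootPairing.reflection_apply]
    change _ - (p.simpleRoot i + (1 - p.cart i k : ℂ) • p.simpleRoot k) (p.sCoroot k) •
      p.simpleRoot k = _
    rw [LinearMap.add_apply, LinearMap.smul_apply, simpleRoot_sCoroot, simpleRoot_sCoroot_self,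
      smul_eq_mul]
    module
  rw [e] at h
  have := p.eq_zero_of_mem_wtSpace_sub hik h
  exact (p.sbar k).injective (this.trans (map_zero _).symm)

theorem sbar_apply_of_lie_eq_zero (k : p.I) {z : 𝔤} (he : ⁅p.e k, z⁆ = 0) (hf : ⁅p.f k, z⁆ = 0) :
    p.sbar k z = z := by
  have h1 : ∀ a, p.x k a z = z := fun a =>
    expAd_apply_of_lie_eq_zero (p.isNilpotent_ad_smul_e k a) (by rw [smul_lie, he, smul_zero])
  have h2 : ∀ a, p.y k a z = z := fun a =>
    expAd_apply_of_lie_eq_zero (p.isNilpotent_ad_smul_f k a) (by rw [smul_lie, hf, smul_zero])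
  rw [sbar, LinearEquiv.mul_apply, LinearEquiv.mul_apply, h1, h2, h1]

/-- The element `s̄ₖ²` acts by signs on the weight spaces. -/
theorem sbar_sbar_apply (k : p.I) {χ : Dual ℂ H} {n : ℤ} (hn : χ (p.sCoroot k) = n) {z : 𝔤}
    (hz : z ∈ wtSpace H χ) : p.sbar k (p.sbar k z) = ((-1 : ℂ) ^ n) • z := by
  rw [← LinearEquiv.mul_apply, sbar_mul_self, tor_apply _ hz, map_smul, hn, smul_eq_mul, mul_comm,
    Complex.exp_int_mul, Complex.exp_pi_mul_I]

theorem lie_f_e_of_ne {i k : p.I} (hik : i ≠ k) : ⁅p.f k, p.e i⁆ = 0 := by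
  rw [← lie_skew, p.lie_e_f_of_ne hik, neg_zero]

theorem sbar_apply_e_of_cart_zero {i k : p.I} (hik : i ≠ k) (h : p.cart i k = 0) :
    p.sbar k (p.e i) = p.e i := by
  refine p.sbar_apply_of_lie_eq_zero k ?_ (p.lie_f_e_of_ne hik)
  refine p.eq_zero_of_mem_wtSpace_top hik ?_
  have := lie_mem_wtSpace (p.e_mem_wtSpace k) (p.e_mem_wtSpace i)
  rw [h]
  convert this using 2
  push_cast; module

theorem lie_f_lie_e_e {i k : p.I} (hik : i ≠ k) :
    ⁅p.f k, ⁅p.e k, p.e i⁆⁆ = -(p.cart i k : ℂ) • p.e i := by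
  rw [leibniz_lie, p.lie_f_e_of_ne hik, lie_zero, add_zero, lie_f_e_eq, neg_lie, lie_cartan_e,
    simpleRoot_sCoroot, neg_smul]

/-- The action of `s̄ₖ` on a root vector of a simple root joined to `αₖ` by a simple string. -/
theorem sbar_apply_e_of_cart_neg_one {i k : p.I} (hik : i ≠ k) (h : p.cart i k = -1) :
    p.sbar k (p.e i) = -⁅p.e k, p.e i⁆ := by
  have hee : ⁅p.e k, ⁅p.e k, p.e i⁆⁆ = 0 := by
    refine p.eq_zero_of_mem_wtSpace_top hik ?_
    have := lie_mem_wtSpace (p.e_mem_wtSpace k)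
      (lie_mem_wtSpace (p.e_mem_wtSpace k) (p.e_mem_wtSpace i))
    rw [h]
    convert this using 2
    push_cast; module
  have hfe : ⁅p.f k, p.e i⁆ = 0 := p.lie_f_e_of_ne hik
  have hfee : ⁅p.f k, ⁅p.e k, p.e i⁆⁆ = p.e i := by
    rw [p.lie_f_lie_e_e hik, h]; simp
  have x1 : ∀ a, p.x k a (p.e i) = p.e i + a • ⁅p.e k, p.e i⁆ := fun a => by
    rw [x, expAd_apply_of_lie_lie_eq_zero (p.isNilpotent_ad_smul_e k a)] <;>
      simp [hee]
  have x2 : ∀ a, p.x k a ⁅p.e k, p.e i⁆ = ⁅p.e k, p.e i⁆ := fun a => by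
    rw [x, expAd_apply_of_lie_eq_zero (p.isNilpotent_ad_smul_e k a)]; simp [hee]
  have y1 : ∀ a, p.y k a (p.e i) = p.e i := fun a => by
    rw [y, expAd_apply_of_lie_eq_zero (p.isNilpotent_ad_smul_f k a)]; simp [hfe]
  have y2 : ∀ a, p.y k a ⁅p.e k, p.e i⁆ = ⁅p.e k, p.e i⁆ + a • p.e i := fun a => by
    rw [y, expAd_apply_of_lie_lie_eq_zero (p.isNilpotent_ad_smul_f k a)] <;>
      simp [hfee, hfe]
  rw [sbar, LinearEquiv.mul_apply, LinearEquiv.mul_apply, x1, map_add, map_smul, y1, y2, map_add,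
    map_smul, map_add, map_smul, x1, x2]
  module

/-- The middle vector of a three-term string is negated. -/
theorem sbar_apply_lie_e_of_cart_neg_two {i k : p.I} (hik : i ≠ k) (h : p.cart i k = -2) :
    p.sbar k ⁅p.e k, p.e i⁆ = -⁅p.e k, p.e i⁆ := by
  set v1 := ⁅p.e k, p.e i⁆ with hv1
  set v2 := ⁅p.e k, v1⁆ with hv2
  have hee : ⁅p.e k, v2⁆ = 0 := by
    refine p.eq_zero_of_mem_wtSpace_top hik ?_
    have := lie_mem_wtSpace (p.e_mem_wtSpace k) (lie_mem_wtSpace (p.e_mem_wtSpace k)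
      (lie_mem_wtSpace (p.e_mem_wtSpace k) (p.e_mem_wtSpace i)))
    rw [h]
    convert this using 2
    push_cast; module
  have hfe : ⁅p.f k, p.e i⁆ = 0 := p.lie_f_e_of_ne hik
  have hf1 : ⁅p.f k, v1⁆ = (2 : ℂ) • p.e i := by
    rw [hv1, p.lie_f_lie_e_e hik, h]; norm_num
  have hf2 : ⁅p.f k, v2⁆ = (2 : ℂ) • v1 := by
    rw [hv2, leibniz_lie, hf1, lie_smul, ← hv1, lie_f_e_eq, neg_lie]
    have : ⁅(p.sCoroot k : 𝔤), v1⁆ = 0 := by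
      have := lie_mem_wtSpace (p.e_mem_wtSpace k) (p.e_mem_wtSpace i) (p.sCoroot k)
      rw [this, LinearMap.add_apply, simpleRoot_sCoroot_self, simpleRoot_sCoroot, h]; norm_num
    rw [this, neg_zero, zero_add]
  have x1 : ∀ a, p.x k a v1 = v1 + a • v2 := fun a => by
    rw [x, expAd_apply_of_lie_lie_eq_zero (p.isNilpotent_ad_smul_e k a)] <;>
      simp [← hv2, hee]
  have x0 : ∀ a, p.x k a (p.e i) = p.e i + a • v1 + (2⁻¹ * a ^ 2 : ℂ) • v2 := fun a => by
    rw [x, expAd_apply_of_lie_lie_lie_eq_zero (p.isNilpotent_ad_smul_e k a)]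
    · simp only [smul_lie, lie_smul, ← hv1, ← hv2]; module
    · simp [← hv1, ← hv2, hee]
  have x2 : ∀ a, p.x k a v2 = v2 := fun a => by
    rw [x, expAd_apply_of_lie_eq_zero (p.isNilpotent_ad_smul_e k a)]; simp [hee]
  have y1 : ∀ a, p.y k a v1 = v1 + (2 * a) • p.e i := fun a => by
    rw [y, expAd_apply_of_lie_lie_eq_zero (p.isNilpotent_ad_smul_f k a)]
    · simp only [smul_lie, hf1]; module
    · simp [hf1, hfe]
  have y2 : ∀ a, p.y k a v2 = v2 + (2 * a) • v1 + (2 * a ^ 2) • p.e i := fun a => by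
    rw [y, expAd_apply_of_lie_lie_lie_eq_zero (p.isNilpotent_ad_smul_f k a)]
    · simp only [smul_lie, lie_smul, hf1, hf2]; module
    · simp [hf1, hf2, hfe]
  rw [sbar, LinearEquiv.mul_apply, LinearEquiv.mul_apply, x1, map_add, map_smul, y1, y2]
  simp only [map_add, map_smul, x0, x1, x2]
  module

theorem betas_append (l m : List p.I) :
    p.betas (l ++ m) = p.betas l ++ (p.betas m).map (p.weylWord l) := by
  induction l with
  | nil => simp [betas, weylWord_nil]
  | cons i l ih =>
    simp [betas, ih, weylWord_cons]

theorem rt_reflection_simple (i k : p.I) : p.rt (p.simpleReflection k i.1) =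
    p.simpleRoot i - (p.cart i k : ℂ) • p.simpleRoot k := by
  rw [rt_simpleReflection', rt_simple, simpleRoot_sCoroot]

theorem rt_reflection_reflection_simple_left (i k : p.I) :
    p.rt (p.simpleReflection k (p.simpleReflection i k.1)) =
      -(p.cart k i : ℂ) • p.simpleRoot i +
        ((p.cart k i * p.cart i k - 1 : ℤ) : ℂ) • p.simpleRoot k := by
  rw [rt_simpleReflection', rt_reflection_simple, LinearMap.sub_apply, LinearMap.smul_apply,
    simpleRoot_sCoroot_self, simpleRoot_sCoroot, smul_eq_mul]
  push_cast; module

theorem cart_nonpos {i k : p.I} (hik : i ≠ k) : p.cart i k ≤ 0 := by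
  have := p.cart_cases hik
  omega

theorem natCast_toNat_neg_cart {i k : p.I} (hik : i ≠ k) :
    (((-p.cart i k).toNat : ℕ) : ℂ) = -(p.cart i k : ℂ) := by
  have h := p.cart_nonpos hik
  have : ((-p.cart i k).toNat : ℤ) = -p.cart i k := Int.toNat_of_nonneg (by omega)
  exact_mod_cast congrArg (Int.cast (R := ℂ)) this

/-- What is used of a word `k :: A` such that `k :: A ++ [j]` is a reduced word of the longest
element of `⟨sᵢ, sₖ⟩`: the roots attached to it involve `αₖ`, and its product, as well as the
corresponding representative, carry `αⱼ` to `αᵢ` and `eⱼ` to `eᵢ`. -/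
structure IsRankTwoWord (i k : p.I) (A : List p.I) (j : p.I) : Prop where
  betas_eq : ∀ β ∈ p.betas (k :: A),
    ∃ a b : ℕ, 0 < a ∧ p.rt β = a • p.simpleRoot k + b • p.simpleRoot i
  sbarWord_e : p.sbarWord (k :: A) (p.e j) = p.e i
  weylWord_simple : p.weylWord (k :: A) j.1 = i.1

theorem rt_eq_nsmul_of_eq {i k : p.I} {β : H.root} (h : β = k.1) : ∃ a b : ℕ, 0 < a ∧
    p.rt β = a • p.simpleRoot k + b • p.simpleRoot i :=
  ⟨1, 0, one_pos, by rw [h, rt_simple]; simp⟩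

theorem isRankTwoWord_of_cart_zero {i k : p.I} (hik : i ≠ k) (h0 : p.cart i k = 0) :
    p.IsRankTwoWord i k [] i := by
  refine ⟨fun β hβ => p.rt_eq_nsmul_of_eq (by simpa [betas] using hβ), ?_, ?_⟩
  · simp [sbarWord, p.sbar_apply_e_of_cart_zero hik h0]
  · apply p.rt_injective
    rw [weylWord_cons, weylWord_nil, mul_one, rt_reflection_simple, h0, rt_simple]; simp

theorem isRankTwoWord_of_cart_neg_one {i k : p.I} (hik : i ≠ k) (h1 : p.cart i k = -1)
    (h2 : p.cart k i = -1) : p.IsRankTwoWord i k [i] k := by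
  refine ⟨?_, ?_, ?_⟩
  · intro β hβ
    simp only [betas, List.map_cons, List.map_nil, List.mem_cons, List.not_mem_nil,
      or_false] at hβ
    rcases hβ with h | h
    · exact p.rt_eq_nsmul_of_eq h
    · exact ⟨1, 1, one_pos, by rw [h, rt_reflection_simple, h1]; push_cast; module⟩
  · have h3 : p.sbar i (p.e k) = -p.sbar k (p.e i) := by
      rw [p.sbar_apply_e_of_cart_neg_one hik h1, p.sbar_apply_e_of_cart_neg_one hik.symm h2,
        lie_skew, neg_neg]
    rw [sbarWord_cons, sbarWord_cons, sbarWord_nil, mul_one, LinearEquiv.mul_apply, h3, map_neg,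
      p.sbar_sbar_apply k (n := -1) (by rw [simpleRoot_sCoroot, h1]) (p.e_mem_wtSpace i)]
    simp
  · apply p.rt_injective
    rw [weylWord_cons, weylWord_cons, weylWord_nil, mul_one, Equiv.Perm.mul_apply,
      rt_reflection_reflection_simple_left, h1, h2, rt_simple]
    simp

/-- Type `B₂`. The root vector `s̄ₖ eᵢ` belongs to a root orthogonal to `αᵢ`, so that `s̄ᵢ` acts on
it by a sign, which is `-1` exactly if `αᵢ` is the short root. -/
theorem isRankTwoWord_of_cart_mul_eq_two {i k : p.I} (hik : i ≠ k)
    (hcase : (p.cart i k = -1 ∧ p.cart k i = -2) ∨ (p.cart i k = -2 ∧ p.cart k i = -1)) :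
    p.IsRankTwoWord i k [i, k] i := by
  have htwo : p.cart i k * p.cart k i = 2 := by
    rcases hcase with ⟨h1, h2⟩ | ⟨h1, h2⟩ <;> rw [h1, h2] <;> norm_num
  have hneg : p.cart i k < 0 := by omega
  have hc1 := p.natCast_toNat_neg_cart hik
  have hc2 := p.natCast_toNat_neg_cart hik.symm
  have e1 := p.rt_reflection_simple i k
  have e2 := p.rt_reflection_reflection_simple_left i k
  have e3 := p.rt_reflection_reflection_simple_left k i
  have rik := p.simpleRoot_sCoroot i k
  have hE : p.sbar k (p.e i) ∈ wtSpace H (p.rt (p.simpleReflection k i.1)) :=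
    p.sbar_apply_root k (β := i.1) (p.e_mem_wtSpace i)
  have hfix : p.simpleReflection i (p.simpleReflection k i.1) = p.simpleReflection k i.1 := by
    apply p.rt_injective
    rw [e3, e1, htwo]; push_cast; module
  refine ⟨?_, ?_, ?_⟩
  · intro β hβ
    simp only [betas, List.map_cons, List.map_nil, List.mem_cons, List.not_mem_nil,
      or_false] at hβ
    rcases hβ with h | h | h
    · exact p.rt_eq_nsmul_of_eq h
    · refine ⟨(-p.cart i k).toNat, 1, by omega, ?_⟩
      rw [h, e1, ← Nat.cast_smul_eq_nsmul ℂ, hc1]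
      module
    · refine ⟨1, (-p.cart k i).toNat, one_pos, ?_⟩
      rw [h, e2, mul_comm (p.cart k i), htwo, ← Nat.cast_smul_eq_nsmul ℂ (-p.cart k i).toNat, hc2]
      push_cast; module
  · simp only [sbarWord_cons, sbarWord_nil, mul_one, LinearEquiv.mul_apply]
    rcases hcase with ⟨h1, h2⟩ | ⟨h1, h2⟩
    · have h3 : p.sbar i (p.sbar k (p.e i)) = -p.sbar k (p.e i) := by
        rw [p.sbar_apply_e_of_cart_neg_one hik h1, lie_skew,
          p.sbar_apply_lie_e_of_cart_neg_two hik.symm h2]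
      rw [h3, map_neg, p.sbar_sbar_apply k (n := -1) (by rw [rik, h1]) (p.e_mem_wtSpace i)]
      simp
    · -- Neither adding nor subtracting `αᵢ` leads from `sₖ αᵢ` to a root, only to twice a root.
      have h3 : p.sbar i (p.sbar k (p.e i)) = p.sbar k (p.e i) := by
        obtain ⟨γ, hγ⟩ := p.add_mem_roots (β := i.1) (k := k) (n := -2) (by norm_num)
          (by rw [rt_simple, rik, h1]) (p.simpleRoot_ne_neg i k)
        rw [rt_simple] at hγ
        refine p.sbar_apply_of_lie_eq_zero i ?_ ?_
        · refine eq_zero_of_mem_wtSpace_two_smul (β := γ) ?_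
            (lie_mem_wtSpace (p.e_mem_wtSpace i) hE)
          change _ + p.rt _ = (2 : ℂ) • p.rt γ
          rw [e1, hγ, h1]; push_cast; module
        · refine eq_zero_of_mem_wtSpace_two_smul (β := k.1) ?_
            (lie_mem_wtSpace (p.f_mem_wtSpace i) hE)
          change _ + p.rt _ = (2 : ℂ) • p.rt k.1
          rw [e1, rt_simple, h1]; push_cast; module
      rw [h3, p.sbar_sbar_apply k (n := -2) (by rw [rik, h1]) (p.e_mem_wtSpace i)]
      norm_num
  · simp only [weylWord_cons, weylWord_nil, mul_one, Equiv.Perm.mul_apply]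
    rw [hfix, simpleReflection_apply_self]

/-- Type `G₂`. The root vector `s̄ᵢ s̄ₖ eᵢ` belongs to a root `γ` orthogonal to `αₖ`, and it is
fixed by `s̄ₖ` because neither `γ + αₖ` nor `γ - αₖ` is a root: each of them is twice a root. What
remains are the signs of `s̄ᵢ²` and `s̄ₖ²`. -/
theorem isRankTwoWord_of_cart_mul_eq_three {i k : p.I} (hik : i ≠ k)
    (h6 : (p.cart i k = -1 ∧ p.cart k i = -3) ∨ (p.cart i k = -3 ∧ p.cart k i = -1)) :
    p.IsRankTwoWord i k [i, k, i, k] i := by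
  have hneg : p.cart i k < 0 := by omega
  have hc1 := p.natCast_toNat_neg_cart hik
  have hc2 := p.natCast_toNat_neg_cart hik.symm
  have e1 := p.rt_reflection_simple i k
  have e2 := p.rt_reflection_reflection_simple_left i k
  have e3 := p.rt_reflection_reflection_simple_left k i
  have rik := p.simpleRoot_sCoroot i k
  have rki := p.simpleRoot_sCoroot k i
  have rii := p.simpleRoot_sCoroot_self i
  have rkk := p.simpleRoot_sCoroot_self k
  have hE : p.sbar k (p.e i) ∈ wtSpace H (p.rt (p.simpleReflection k i.1)) :=
    p.sbar_apply_root k (β := i.1) (p.e_mem_wtSpace i)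
  have hprod : p.cart i k * p.cart k i = 3 := by
    rcases h6 with ⟨h1, h2⟩ | ⟨h1, h2⟩ <;> rw [h1, h2] <;> norm_num
  set γ2 := p.simpleReflection i (p.simpleReflection k i.1) with hγ2
  have hγ2rt : p.rt γ2 = (2 : ℂ) • p.simpleRoot i - (p.cart i k : ℂ) • p.simpleRoot k := by
    rw [hγ2, e3, hprod]; push_cast; module
  have hfix : p.simpleReflection k γ2 = γ2 := by
    apply p.rt_injective
    rw [rt_simpleReflection', hγ2rt, LinearMap.sub_apply, LinearMap.smul_apply,
      LinearMap.smul_apply, rik, rkk, smul_eq_mul, smul_eq_mul]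
    module
  have hE2 : p.sbar i (p.sbar k (p.e i)) ∈ wtSpace H (p.rt γ2) := p.sbar_apply_root i hE
  have hkE2 : p.sbar k (p.sbar i (p.sbar k (p.e i))) = p.sbar i (p.sbar k (p.e i)) := by
    rcases h6 with ⟨h1, h2⟩ | ⟨h1, h2⟩
    · obtain ⟨γ, hγ⟩ := p.add_mem_roots (β := i.1) (k := k) (n := -1) (by norm_num)
        (by rw [rt_simple, rik, h1]) (p.simpleRoot_ne_neg i k)
      rw [rt_simple] at hγ
      refine p.sbar_apply_of_lie_eq_zero k ?_ ?_
      · refine eq_zero_of_mem_wtSpace_two_smul (β := γ) ?_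
          (lie_mem_wtSpace (p.e_mem_wtSpace k) hE2)
        change _ = (2 : ℂ) • p.rt γ
        rw [hγ2rt, hγ, h1]; push_cast; module
      · refine eq_zero_of_mem_wtSpace_two_smul (β := i.1) ?_
          (lie_mem_wtSpace (p.f_mem_wtSpace k) hE2)
        change _ = (2 : ℂ) • p.rt i.1
        rw [hγ2rt, rt_simple, h1]; push_cast; module
    · obtain ⟨γ, hγ⟩ := p.add_mem_roots (β := i.1) (k := k) (n := -3) (by norm_num)
        (by rw [rt_simple, rik, h1]) (p.simpleRoot_ne_neg i k)
      rw [rt_simple] at hγ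
      obtain ⟨δ, hδ⟩ := p.add_mem_roots (β := γ) (k := k) (n := -1) (by norm_num)
        (by rw [hγ, LinearMap.add_apply, rik, rkk, h1]; norm_num) (fun h => by
          have h3 := congrArg (fun φ : Dual ℂ H => φ p.rhoCheck) h
          simp only [hγ, LinearMap.add_apply, LinearMap.neg_apply, simpleRoot_rhoCheck] at h3
          norm_num at h3)
      refine p.sbar_apply_of_lie_eq_zero k ?_ ?_
      · refine eq_zero_of_mem_wtSpace_two_smul (β := δ) ?_
          (lie_mem_wtSpace (p.e_mem_wtSpace k) hE2)
        change _ = (2 : ℂ) • p.rt δ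
        rw [hγ2rt, hδ, hγ, h1]; push_cast; module
      · refine eq_zero_of_mem_wtSpace_two_smul (β := γ) ?_
          (lie_mem_wtSpace (p.f_mem_wtSpace k) hE2)
        change _ = (2 : ℂ) • p.rt γ
        rw [hγ2rt, hγ, h1]; push_cast; module
  have hlast : p.simpleReflection k (p.simpleReflection i γ2) = i.1 := by
    rw [hγ2, simpleReflection_apply_self, simpleReflection_apply_self]
  refine ⟨?_, ?_, ?_⟩
  · have e5 : p.rt (p.simpleReflection k (p.simpleReflection i (p.simpleReflection k
        (p.simpleReflection i k.1)))) = p.simpleRoot k - (p.cart k i : ℂ) • p.simpleRoot i := by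
      rw [p.rt_simpleReflection' k, p.rt_simpleReflection' i, e2]
      simp only [LinearMap.sub_apply, LinearMap.smul_apply, LinearMap.add_apply, rik, rki, rii,
        rkk, smul_eq_mul]
      rw [mul_comm (p.cart k i), hprod]
      have : (p.cart i k : ℂ) * p.cart k i = 3 := by exact_mod_cast hprod
      push_cast
      match_scalars
      · ring
      · linear_combination this
    intro β hβ
    simp only [betas, List.map_cons, List.map_nil, List.mem_cons, List.not_mem_nil,
      or_false] at hβ
    rcases hβ with h | h | h | h | h
    · exact p.rt_eq_nsmul_of_eq h
    · refine ⟨(-p.cart i k).toNat, 1, by omega, ?_⟩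
      rw [h, e1, ← Nat.cast_smul_eq_nsmul ℂ, hc1]; module
    · refine ⟨2, (-p.cart k i).toNat, two_pos, ?_⟩
      rw [h, e2, mul_comm (p.cart k i), hprod, ← Nat.cast_smul_eq_nsmul ℂ (-p.cart k i).toNat,
        hc2]
      push_cast; module
    · refine ⟨(-p.cart i k).toNat, 2, by omega, ?_⟩
      rw [h, ← hγ2, hfix, hγ2rt, ← Nat.cast_smul_eq_nsmul ℂ (-p.cart i k).toNat, hc1]
      module
    · refine ⟨1, (-p.cart k i).toNat, one_pos, ?_⟩
      rw [h, e5, ← Nat.cast_smul_eq_nsmul ℂ (-p.cart k i).toNat, hc2]; module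
  · simp only [sbarWord_cons, sbarWord_nil, mul_one, LinearEquiv.mul_apply]
    rw [hkE2, p.sbar_sbar_apply i (n := -1) _ hE, map_smul]
    · have hodd : ((-1 : ℂ) ^ (p.cart i k)) = -1 := by
        rcases h6 with ⟨h1, -⟩ | ⟨h1, -⟩ <;> rw [h1] <;> norm_num
      rw [p.sbar_sbar_apply k (n := p.cart i k) rik (p.e_mem_wtSpace i), hodd]
      simp
    · have : (p.cart i k : ℂ) * p.cart k i = 3 := by exact_mod_cast hprod
      change p.rt _ _ = _
      rw [e1, LinearMap.sub_apply, LinearMap.smul_apply, rki, rii, smul_eq_mul, this]; norm_num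
  · simp only [weylWord_cons, weylWord_nil, mul_one, Equiv.Perm.mul_apply]
    rw [← hγ2, hfix, hlast]

theorem exists_rankTwoWord {i k : p.I} (hik : i ≠ k) : ∃ A j, p.IsRankTwoWord i k A j := by
  rcases p.cart_cases hik with ⟨h, -⟩ | ⟨h1, h2⟩ | h | h | h | h
  · exact ⟨_, _, p.isRankTwoWord_of_cart_zero hik h⟩
  · exact ⟨_, _, p.isRankTwoWord_of_cart_neg_one hik h1 h2⟩
  · exact ⟨_, _, p.isRankTwoWord_of_cart_mul_eq_two hik (Or.inl h)⟩
  · exact ⟨_, _, p.isRankTwoWord_of_cart_mul_eq_two hik (Or.inr h)⟩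
  · exact ⟨_, _, p.isRankTwoWord_of_cart_mul_eq_three hik (Or.inl h)⟩
  · exact ⟨_, _, p.isRankTwoWord_of_cart_mul_eq_three hik (Or.inr h)⟩

end Pinning

/-! ### Independence of the reduced word -/

theorem eq_of_mem_wtSpace {χ ψ : Dual ℂ H} {z : 𝔤} (hχ : z ∈ wtSpace H χ) (hψ : z ∈ wtSpace H ψ)
    (hz : z ≠ 0) : χ = ψ := by
  ext x
  have h : (χ x - ψ x) • z = 0 := by
    rw [sub_smul, ← mem_wtSpace.mp hχ x, ← mem_wtSpace.mp hψ x, sub_self]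
  exact sub_eq_zero.mp ((smul_eq_zero.mp h).resolve_right hz)

theorem exists_mem_wtSpace_root (β : H.root) :
    ∃ z : 𝔤, z ∈ wtSpace H ((rootSystem H).root β) ∧ z ≠ 0 := by
  obtain ⟨z, hz, h0⟩ := β.1.exists_ne_zero
  exact ⟨z, mem_wtSpace_root.mpr hz, h0⟩

namespace Pinning

variable (p : Pinning H)

/-- If all the roots attached to a word are inversions of `w`, the word can be stripped from `w`,
each letter removing one inversion. -/
theorem card_invSet_strip (C : List p.I) : ∀ {w : Equiv.Perm H.root}, IsLin w →
    (∀ β ∈ p.betas C, w⁻¹ β ∉ p.posRoots) →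
    (p.invSet ((p.weylWord C)⁻¹ * w)).card + C.length = (p.invSet w).card := by
  induction C with
  | nil => intro w _ _; simp [weylWord_nil]
  | cons i C ih =>
    intro w hw h
    have h1 := p.card_invSet_simple_mul_of_neg hw (i := i) (h _ (by simp [betas]))
    have h2 := ih (w := p.simpleReflection i * w) (isLin_simple_mul p hw i) (fun β hβ => by
      rw [inv_simple_mul_apply]
      exact h _ (by simp only [betas, List.mem_cons, List.mem_map]; exact Or.inr ⟨β, hβ, rfl⟩))
    rw [weylWord_cons, mul_inv_rev, simpleReflection_inv, mul_assoc, List.length_cons]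
    omega

/-- If all the roots attached to the word `C` are inversions of the product of a reduced word `l`,
then this product has a reduced word which begins with `C`. -/
theorem exists_reduced_strip (C l : List p.I) (h : ∀ β ∈ p.betas C,
    (p.weylWord l)⁻¹ β ∉ p.posRoots) (hl : p.IsReduced l) :
    ∃ q, p.IsReduced q ∧ p.weylWord (C ++ q) = p.weylWord l ∧ C.length + q.length = l.length := by
  obtain ⟨q, hq, hq'⟩ := p.exists_reduced (C.reverse ++ l)
  have e : p.weylWord q = (p.weylWord C)⁻¹ * p.weylWord l := by
    rw [hq, weylWord_append, weylWord_reverse]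
  refine ⟨q, hq', by rw [weylWord_append, e, mul_inv_cancel_left], ?_⟩
  have h1 := p.card_invSet_strip C (p.isLin_weylWord l) h
  rw [← e] at h1
  rw [← hq', ← hl]
  omega

theorem rt_map_nsmul_add_nsmul {w : Equiv.Perm H.root} (hw : IsLin w) {β γ δ : H.root} {a b : ℕ}
    (h : p.rt β = a • p.rt γ + b • p.rt δ) :
    p.rt (w β) = a • p.rt (w γ) + b • p.rt (w δ) := by
  obtain ⟨L, hL⟩ := hw
  change ∀ β, p.rt (w β) = L (p.rt β) at hL
  rw [hL, h, map_add, map_nsmul, map_nsmul, ← hL, ← hL]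

/-- An automorphism carrying `eⱼ` to `eᵢ` and `fⱼ` to a multiple of `fᵢ` carries `fⱼ` to `fᵢ`,
because it preserves `[[e, f], e] = 2 e`. -/
theorem apply_f_eq {g : 𝔤 ≃ₗ[ℂ] 𝔤} (hg : g ∈ lieAut 𝔤) {i j : p.I} (he : g (p.e j) = p.e i)
    (hf : g (p.f j) ∈ wtSpace H (-p.simpleRoot i)) : g (p.f j) = p.f i := by
  obtain ⟨γ, hγ⟩ := p.exists_neg i.1
  rw [rt_simple] at hγ
  have h2 : p.f i ∈ wtSpace H (p.rt γ) := by rw [hγ]; exact p.f_mem_wtSpace i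
  obtain ⟨c, hc⟩ := exists_smul_of_mem_wtSpace h2 (p.f_ne_zero i) (hγ ▸ hf)
  have h3 : g ⁅(p.sCoroot j : 𝔤), p.e j⁆ = (2 * c) • p.e i := by
    rw [← lie_e_f_eq, hg, hg, he, hc, lie_smul, smul_lie, lie_e_f_eq, lie_cartan_e,
      simpleRoot_sCoroot_self, smul_smul, mul_comm]
  rw [lie_cartan_e, simpleRoot_sCoroot_self, map_smul, he] at h3
  have h4 : (2 * (1 - c)) • p.e i = 0 := by
    rw [mul_sub, sub_smul, ← h3, mul_one, sub_self]
  have h5 : c = 1 := by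
    rcases smul_eq_zero.mp h4 with h | h
    · exact (sub_eq_zero.mp ((mul_eq_zero.mp h).resolve_left two_ne_zero)).symm
    · exact absurd h (p.e_ne_zero i)
  rw [hc, h5, one_smul]

theorem sbarWord_apply_f {C : List p.I} {i j : p.I} (hw : p.weylWord C j.1 = i.1)
    (he : p.sbarWord C (p.e j) = p.e i) : p.sbarWord C (p.f j) = p.f i := by
  refine p.apply_f_eq (p.sbarWord_mem_lieAut C) he ?_
  obtain ⟨γ, hγ⟩ := p.exists_neg j.1
  have h1 : p.sbarWord C (p.f j) ∈ wtSpace H (p.rt (p.weylWord C γ)) :=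
    p.sbarWord_apply_root C (by rw [hγ]; exact p.f_mem_wtSpace j)
  rwa [(p.isLin_weylWord C).map_neg p hγ, hw] at h1

theorem conj_sbar {g : 𝔤 ≃ₗ[ℂ] 𝔤} (hg : g ∈ lieAut 𝔤) {i j : p.I} (he : g (p.e j) = p.e i)
    (hf : g (p.f j) = p.f i) : g * p.sbar j = p.sbar i * g := by
  have hx : ∀ a, g * p.x j a * g⁻¹ = p.x i a := fun a => by
    rw [x, conj_expAd hg (p.isNilpotent_ad_smul_e j a), map_smul, he]; rfl
  have hy : ∀ a, g * p.y j a * g⁻¹ = p.y i a := fun a => by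
    rw [y, conj_expAd hg (p.isNilpotent_ad_smul_f j a), map_smul, hf]; rfl
  rw [sbar, sbar, ← hx, ← hy]
  group

theorem weylWord_eq_of_sbarWord_eq {l m : List p.I} (h : p.sbarWord l = p.sbarWord m) :
    p.weylWord l = p.weylWord m := by
  ext1 β
  obtain ⟨z, hz, h0⟩ := exists_mem_wtSpace_root β
  have h1 := p.sbarWord_apply_root l hz
  have h2 := p.sbarWord_apply_root m hz
  rw [← h] at h2
  exact p.rt_injective (eq_of_mem_wtSpace h1 h2 fun h3 =>
    h0 ((p.sbarWord l).injective (h3.trans (map_zero _).symm)))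

theorem IsReduced.inv_simple_notMem {i : p.I} {l : List p.I} (h : p.IsReduced (i :: l)) :
    (p.weylWord (i :: l))⁻¹ i.1 ∉ p.posRoots :=
  (p.mem_invSet.mp ((p.mem_betas h i.1).mp (by simp [betas]))).2

variable {p} in
/-- The braid relation of `s̄ᵢ` and `s̄ₖ`: the representative of the word `k :: A` conjugates
`s̄ⱼ` to `s̄ᵢ`. -/
theorem IsRankTwoWord.sbarWord_append {i k : p.I} {A : List p.I} {j : p.I}
    (h : p.IsRankTwoWord i k A j) : p.sbarWord (k :: A ++ [j]) = p.sbarWord (i :: k :: A) := by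
  rw [Pinning.sbarWord_append, sbarWord_cons p i, sbarWord_cons p j, sbarWord_nil, mul_one]
  exact p.conj_sbar (p.sbarWord_mem_lieAut _) h.sbarWord_e
    (p.sbarWord_apply_f h.weylWord_simple h.sbarWord_e)

/-- The representative `s̄_{i₁} ⋯ s̄_{iₙ}` of a Weyl group element does not depend on the reduced
word. -/
theorem sbarWord_eq_of_weylWord_eq (n : ℕ) : ∀ {l m : List p.I}, l.length = n → p.IsReduced l →
    p.IsReduced m → p.weylWord l = p.weylWord m → p.sbarWord l = p.sbarWord m := by
  induction n with
  | zero =>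
    intro l m hn hl hm h
    have : m.length = 0 := by rw [← hm, ← h, hl, hn]
    rw [List.length_eq_zero_iff.mp hn, List.length_eq_zero_iff.mp this]
  | succ n ih =>
    intro l m hn hl hm h
    have hlen : m.length = n + 1 := by rw [← hm, ← h, hl, hn]
    obtain ⟨i, r, rfl⟩ := List.exists_cons_of_length_eq_add_one hn
    obtain ⟨k, r', rfl⟩ := List.exists_cons_of_length_eq_add_one hlen
    -- Words with the same first letter are covered by the induction hypothesis.
    have key : ∀ (i : p.I) (r r' : List p.I), r.length = n → p.IsReduced (i :: r) →
        p.IsReduced (i :: r') → p.weylWord (i :: r) = p.weylWord (i :: r') →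
        p.sbarWord (i :: r) = p.sbarWord (i :: r') := by
      intro i r r' hn h1 h2 h
      rw [sbarWord_cons, sbarWord_cons, ih hn h1.of_cons.1 h2.of_cons.1]
      rw [weylWord_cons, weylWord_cons] at h
      exact mul_left_cancel h
    have hrn : r.length = n := by simpa using hn
    have hrn' : r'.length = n := by simpa using hlen
    by_cases hik : i = k
    · subst hik
      exact key i r r' hrn hl hm h
    obtain ⟨A, j, hA⟩ := p.exists_rankTwoWord hik
    have hi := hl.inv_simple_notMem
    have hk := hm.inv_simple_notMem
    rw [← h] at hk
    -- All positive roots of the rank two system of `αᵢ` and `αₖ` are inversions, so that there are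
    -- reduced words beginning with `k :: A ++ [j]` and with `i :: k :: A`. These are related by a
    -- braid relation, and each shares its first letter with one of the given words.
    have hC : ∀ β ∈ p.betas (k :: A ++ [j]), (p.weylWord (i :: r))⁻¹ β ∉ p.posRoots := by
      intro β hβ
      rw [betas_append, List.mem_append] at hβ
      rcases hβ with hβ | hβ
      · obtain ⟨a, b, ha, hab⟩ := hA.betas_eq β hβ
        have h1 := p.rt_map_nsmul_add_nsmul (p.isLin_weylWord (i :: r)).inv (β := β) (γ := k.1)
          (δ := i.1) (a := a) (b := b) (by rw [hab, rt_simple, rt_simple])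
        have h2 := congrArg (fun φ : Dual ℂ H => φ p.rhoCheck) h1
        simp only [LinearMap.add_apply, LinearMap.smul_apply, rt_rhoCheck, nsmul_eq_mul] at h2
        have h3 : p.base.height ((p.weylWord (i :: r))⁻¹ β) =
            a * p.base.height ((p.weylWord (i :: r))⁻¹ k.1) +
            b * p.base.height ((p.weylWord (i :: r))⁻¹ i.1) := by exact_mod_cast h2
        rw [notMem_posRoots] at hi hk ⊢
        rw [h3]
        have : (0 : ℤ) < a := by exact_mod_cast ha
        have h4 : (0 : ℤ) ≤ b := by positivity
        nlinarith
      · simp only [betas, List.map_cons, List.map_nil, List.mem_singleton] at hβ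
        rw [hβ, hA.weylWord_simple]
        exact hi
    obtain ⟨q, hq, hqw, hqn⟩ := p.exists_reduced_strip _ _ hC hl
    have hsb := hA.sbarWord_append
    have hw := p.weylWord_eq_of_sbarWord_eq hsb
    have hqw' : p.weylWord (i :: (k :: A ++ q)) = p.weylWord (i :: r) := by
      rw [← hqw, ← List.cons_append, weylWord_append, ← hw, ← weylWord_append]
    have hr1 : p.IsReduced (k :: A ++ [j] ++ q) := by
      rw [IsReduced, hqw, hl, List.length_append, hqn]
    have hr2 : p.IsReduced (i :: (k :: A ++ q)) := by
      rw [IsReduced, hqw', hl, ← hqn]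
      simp; ring
    rw [key i r _ hrn hl hr2 hqw'.symm, ← List.cons_append, Pinning.sbarWord_append, ← hsb,
      ← Pinning.sbarWord_append]
    refine (key k r' (A ++ [j] ++ q) hrn' hm ?_ ?_).symm
    · simpa using hr1
    · rw [← h, ← hqw]; simp

/-- If a reduced word represents an element carrying one simple root to another, then the
corresponding representative carries the chosen simple root vectors to each other, without a
sign. -/
theorem sbarWord_apply_e (n : ℕ) : ∀ {l : List p.I} {i j : p.I}, l.length = n → p.IsReduced l →
    p.weylWord l j.1 = i.1 → p.sbarWord l (p.e j) = p.e i := by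
  induction n using Nat.strong_induction_on with
  | _ n ih =>
  intro l i j hn hl h
  rcases l with - | ⟨k, r⟩
  · have : j = i := Subtype.ext h
    rw [this]; rfl
  have hinv : (p.weylWord (k :: r))⁻¹ i.1 = j.1 := by rw [← h, perm_inv_apply]
  have hk := hl.inv_simple_notMem
  have hik : i ≠ k := by
    rintro rfl
    exact hk (hinv ▸ p.simple_mem_posRoots j)
  obtain ⟨A, j', hA⟩ := p.exists_rankTwoWord hik
  -- The roots `β = a αₖ + b αᵢ` attached to `k :: A` are inversions. Otherwise `δ = w⁻¹ β` is
  -- positive and so is `γ = -w⁻¹ αₖ`, while `w⁻¹ αᵢ = αⱼ`.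
  have hC : ∀ β ∈ p.betas (k :: A), (p.weylWord (k :: r))⁻¹ β ∉ p.posRoots := by
    intro β hβ hpos
    obtain ⟨a, b, ha, hab⟩ := hA.betas_eq β hβ
    have h1 := p.rt_map_nsmul_add_nsmul (p.isLin_weylWord (k :: r)).inv (β := β) (γ := k.1)
      (δ := i.1) (a := a) (b := b) (by rw [hab, rt_simple, rt_simple])
    rw [hinv, rt_simple] at h1
    set δ := (p.weylWord (k :: r))⁻¹ β with hδ
    obtain ⟨γ, hγ⟩ := p.exists_neg ((p.weylWord (k :: r))⁻¹ k.1)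
    have hγpos : γ ∈ p.posRoots := (p.neg_mem_posRoots_iff hγ).mpr hk
    have hγj : γ ≠ j.1 := by
      intro hγj
      have h2 := (p.isLin_weylWord (k :: r)).map_neg p hγ
      rw [hγj, h, perm_apply_inv, rt_simple, rt_simple] at h2
      exact p.simpleRoot_ne_neg i k h2
    have hδj : δ ≠ j.1 := by
      intro hδj
      have h2 : β = i.1 := by rw [← h, ← hδj, hδ, perm_apply_inv]
      rw [h2, rt_simple] at hab
      have h3 := congrArg (fun φ : Dual ℂ H => φ (p.coweight k)) hab
      simp only [LinearMap.add_apply, LinearMap.smul_apply, simpleRoot_coweight, hik, if_true,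
        if_false, smul_zero, add_zero, nsmul_eq_mul, mul_one] at h3
      exact ha.ne (by exact_mod_cast h3)
    -- The simple reflection `sⱼ` permutes the positive roots other than `αⱼ`, but it turns
    -- `δ + a γ = b αⱼ` into `sⱼ δ + a sⱼ γ = -b αⱼ`.
    have hs1 := p.mem_posRoots.mp (p.simpleReflection_pos hpos hδj)
    have hs2 := p.mem_posRoots.mp (p.simpleReflection_pos hγpos hγj)
    have e0 : p.rt δ = -(a • p.rt γ) + b • p.simpleRoot j := by
      rw [h1, hγ, smul_neg, neg_neg]
    have e1 : p.rt (p.simpleReflection j δ) + a • p.rt (p.simpleReflection j γ) =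
        -(b • p.simpleRoot j) := by
      rw [rt_simpleReflection', rt_simpleReflection', e0]
      simp only [LinearMap.add_apply, LinearMap.neg_apply, LinearMap.smul_apply,
        simpleRoot_sCoroot_self, ← Nat.cast_smul_eq_nsmul ℂ]
      module
    have e2 := congrArg (fun φ : Dual ℂ H => φ p.rhoCheck) e1
    simp only [LinearMap.add_apply, LinearMap.smul_apply, LinearMap.neg_apply, rt_rhoCheck,
      simpleRoot_rhoCheck, nsmul_eq_mul, mul_one] at e2
    have e3 : p.base.height (p.simpleReflection j δ) + a * p.base.height (p.simpleReflection j γ)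
        = -(b : ℤ) := by exact_mod_cast e2
    have : (0 : ℤ) ≤ a * p.base.height (p.simpleReflection j γ) := by positivity
    omega
  obtain ⟨q, hq, hqw, hqn⟩ := p.exists_reduced_strip _ _ hC hl
  have hred : p.IsReduced (k :: A ++ q) := by rw [IsReduced, hqw, hl, List.length_append, hqn]
  rw [p.sbarWord_eq_of_weylWord_eq _ rfl hl hred hqw.symm, sbarWord_append, LinearEquiv.mul_apply,
    ih q.length (by simp at hqn hn; omega) (i := j') rfl hq, hA.sbarWord_e]
  have h5 : p.weylWord (k :: A) (p.weylWord q j.1) = p.weylWord (k :: A) j'.1 := by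
    rw [← Equiv.Perm.mul_apply, ← weylWord_append, hqw, h, hA.weylWord_simple]
  exact (p.weylWord (k :: A)).injective h5

end Pinning

/-! ### Unipotent elements and the opposite filtration -/

/-- The subgroup of the linear automorphisms preserving the filtration by `ρ`-degree. -/
def filtStab (ρ : H) : Subgroup (𝔤 ≃ₗ[ℂ] 𝔤) where
  carrier := {g | ∀ r, ∀ z ∈ filt ρ r, g z ∈ filt ρ r ∧ g⁻¹ z ∈ filt ρ r}
  mul_mem' {a b} ha hb r z hz := by
    refine ⟨(ha r _ (hb r z hz).1).1, ?_⟩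
    rw [mul_inv_rev]
    exact (hb r _ (ha r z hz).2).2
  one_mem' r z hz := ⟨hz, by rwa [inv_one]⟩
  inv_mem' {a} ha r z hz := ⟨(ha r z hz).2, by rw [inv_inv]; exact (ha r z hz).1⟩

theorem apply_mem_filt {ρ : H} {g : 𝔤 ≃ₗ[ℂ] 𝔤} (hg : g ∈ unipotentFor ρ) {r : ℝ} {z : 𝔤}
    (hz : z ∈ filt ρ r) : g z ∈ filt ρ r := by
  have := add_mem (filt_anti ρ (by linarith) (hg r z hz)) hz
  simpa using this

theorem unipotentFor_le_filtStab (ρ : H) : (unipotentFor ρ : Subgroup (𝔤 ≃ₗ[ℂ] 𝔤)) ≤ filtStab ρ :=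
  fun _ hg _ _ hz => ⟨apply_mem_filt hg hz, apply_mem_filt (inv_mem hg) hz⟩

theorem tor_mem_filtStab (ρ z : H) : (tor z : 𝔤 ≃ₗ[ℂ] 𝔤) ∈ filtStab ρ := by
  have key : ∀ (z : H) (r : ℝ), ∀ y ∈ filt ρ r, (tor z : 𝔤 ≃ₗ[ℂ] 𝔤) y ∈ filt ρ r := by
    intro z r
    refine filt_le (N := (filt ρ r).comap (tor z : 𝔤 ≃ₗ[ℂ] 𝔤).toLinearMap) fun χ hχ y hy => ?_
    rw [Submodule.mem_comap, LinearEquiv.coe_coe, tor_apply z hy]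
    exact Submodule.smul_mem _ _ (mem_filt hχ hy)
  intro r y hy
  exact ⟨key z r y hy, by rw [← tor_neg]; exact key (-z) r y hy⟩

theorem eq_one_of_mem_filtStab_neg {ρ : H} {g : 𝔤 ≃ₗ[ℂ] 𝔤} (h1 : g ∈ unipotentFor ρ)
    (h2 : g ∈ filtStab (-ρ)) : g = 1 := by
  refine linearEquiv_ext_wtSpace (H := H) fun χ z hz => ?_
  have e1 := h1 (χ ρ).re z (mem_filt le_rfl hz)
  have e3 : z ∈ filt (-ρ) (-(χ ρ).re) := mem_filt (by simp) hz
  have e2 := sub_mem (h2 _ z e3).1 e3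
  exact sub_eq_zero.mp (eq_zero_of_mem_filt_of_mem_filt_neg (by linarith) e1 e2)

theorem tor_conj_rootGroup (z : H) {S : Set H.root} {u : 𝔤 ≃ₗ[ℂ] 𝔤}
    (hu : u ∈ Pinning.rootGroup H S) : tor z * u * (tor z)⁻¹ ∈ Pinning.rootGroup H S := by
  induction hu using Subgroup.closure_induction with
  | mem g hg =>
    obtain ⟨α, hα, y, hy, rfl⟩ := hg
    have hy' := mem_wtSpace_root.mpr hy
    rw [tor_conj_expAd z ((rootSystem H).ne_zero α) hy']
    exact Subgroup.subset_closure ⟨α, hα, _, Submodule.smul_mem _ _ hy, rfl⟩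
  | one => simp
  | mul a b _ _ ha hb =>
    have : tor z * (a * b) * (tor z)⁻¹ = (tor z * a * (tor z)⁻¹) * (tor z * b * (tor z)⁻¹) := by
      group
    rw [this]; exact mul_mem ha hb
  | inv a _ ha =>
    have : tor z * a⁻¹ * (tor z)⁻¹ = (tor z * a * (tor z)⁻¹)⁻¹ := by group
    rw [this]; exact inv_mem ha

namespace Pinning

variable (p : Pinning H)

/-! ### The torus -/

/-- Every root is conjugate to a simple root. -/
theorem exists_weylWord_simple (β : H.root) : ∃ (l : List p.I) (j : p.I), β = p.weylWord l j.1 := by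
  have key : ∀ {β : H.root}, β ∈ p.posRoots → ∃ (l : List p.I) (j : p.I), β = p.weylWord l j.1 := by
    intro β hβ
    refine RootPairing.Base.IsPos.induction_on_reflect hβ
      (p := fun β => ∃ (l : List p.I) (j : p.I), β = p.weylWord l j.1)
      (fun i hi => ⟨[], ⟨i, hi⟩, rfl⟩) ?_
    rintro _ j ⟨l, k, rfl⟩ hj
    exact ⟨⟨j, hj⟩ :: l, k, by rw [weylWord_cons]; rfl⟩
  by_cases hβ : β ∈ p.posRoots
  · exact key hβ
  · obtain ⟨γ, hγ⟩ := p.exists_neg β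
    obtain ⟨l, j, hl⟩ := key ((p.neg_mem_posRoots_iff hγ).mpr hβ)
    refine ⟨l ++ [j], j, p.rt_injective ?_⟩
    obtain ⟨δ, hδ⟩ := p.exists_neg j.1
    rw [weylWord_append, Equiv.Perm.mul_apply]
    have : p.weylWord [j] j.1 = δ := p.rt_injective (by
      rw [weylWord_cons, weylWord_nil, mul_one, rt_simpleReflection_simple, hδ, rt_simple])
    rw [this, (p.isLin_weylWord l).map_neg p hδ, ← hl, hγ, neg_neg]

/-- An automorphism that fixes `𝔱` and all the `eᵢ` commutes with all the `s̄ᵢ`, and therefore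
fixes the root vectors obtained from the `eᵢ` by applying words in the `s̄ᵢ`. -/
theorem eq_one_of_fixes {g : 𝔤 ≃ₗ[ℂ] 𝔤} (hg : g ∈ lieAut 𝔤) (hH : ∀ z : H, g z = z)
    (he : ∀ i, g (p.e i) = p.e i) : g = 1 := by
  have hwt : ∀ (χ : Dual ℂ H) (z : 𝔤), z ∈ wtSpace H χ → g z ∈ wtSpace H χ := fun χ z hz =>
    apply_mem_wtSpace hg id (fun x => hH x) (fun _ => rfl) hz
  have hf : ∀ i, g (p.f i) = p.f i := fun i => p.apply_f_eq hg (he i) (hwt _ _ (p.f_mem_wtSpace i))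
  have hs : ∀ l, g * p.sbarWord l = p.sbarWord l * g := by
    intro l
    induction l with
    | nil => rw [sbarWord_nil, mul_one, one_mul]
    | cons i l ih =>
      rw [sbarWord_cons, ← mul_assoc, p.conj_sbar hg (he i) (hf i), mul_assoc, ih, mul_assoc]
  refine linearEquiv_ext_wtSpace (H := H) fun χ z hz => ?_
  change g z = z
  by_cases h0 : z = 0
  · rw [h0, map_zero]
  by_cases hχ : χ = 0
  · subst hχ
    exact hH ⟨z, mem_wtSpace_zero.mp hz⟩
  obtain ⟨β, rfl⟩ := exists_root_of_wtSpace_ne_bot hχ hz h0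
  obtain ⟨l, j, hl⟩ := p.exists_weylWord_simple β
  have h1 : p.sbarWord l (p.e j) ∈ wtSpace H (p.rt β) := by
    rw [hl]; exact p.sbarWord_apply_root l (p.e_mem_wtSpace j)
  obtain ⟨c, rfl⟩ := exists_smul_of_mem_wtSpace h1
    (fun h => p.e_ne_zero j ((p.sbarWord l).injective (h.trans (map_zero _).symm))) hz
  rw [map_smul, ← LinearEquiv.mul_apply, hs, LinearEquiv.mul_apply, he]

theorem killingForm_e_f_ne_zero (i : p.I) : killingForm ℂ 𝔤 (p.e i) (p.f i) ≠ 0 := by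
  intro h
  obtain ⟨γ, hγ⟩ := p.exists_neg i.1
  rw [rt_simple] at hγ
  refine p.e_ne_zero i (eq_zero_of_killingForm_wtSpace (H := H) fun χ y hy => ?_)
  by_cases hχ : p.simpleRoot i + χ = 0
  · have hχ' : χ = p.rt γ := by rw [hγ]; exact (neg_eq_of_add_eq_zero_right hχ).symm
    rw [hχ'] at hy
    have h2 : p.f i ∈ wtSpace H (p.rt γ) := by rw [hγ]; exact p.f_mem_wtSpace i
    obtain ⟨c, rfl⟩ := exists_smul_of_mem_wtSpace h2 (p.f_ne_zero i) hy
    rw [map_smul, h, smul_zero]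
  · exact killingForm_eq_zero_of_wtSpace hχ (p.e_mem_wtSpace i) hy

theorem coeff_smul_e (i : p.I) (c : ℂ) : p.coeff i (c • p.e i) = c := by
  rw [coeff, map_smul, LinearMap.smul_apply, smul_eq_mul,
    mul_div_cancel_right₀ _ (p.killingForm_e_f_ne_zero i)]

theorem coeff_add (i : p.I) (y z : 𝔤) : p.coeff i (y + z) = p.coeff i y + p.coeff i z := by
  rw [coeff, map_add, LinearMap.add_apply, add_div]; rfl

theorem coeff_sub (i : p.I) (y z : 𝔤) : p.coeff i (y - z) = p.coeff i y - p.coeff i z := by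
  rw [coeff, map_sub, LinearMap.sub_apply, sub_div]; rfl

theorem rootChar_tor (i : p.I) (z : H) : p.rootChar i (tor z) = Complex.exp (p.simpleRoot i z) := by
  rw [rootChar, tor_apply z (p.e_mem_wtSpace i), coeff_smul_e]

theorem tor_eq_one {z : H} (h : ∀ i, Complex.exp (p.simpleRoot i z) = 1) :
    (tor z : 𝔤 ≃ₗ[ℂ] 𝔤) = 1 :=
  p.eq_one_of_fixes (tor_mem_lieAut z) (fun y => tor_apply_cartan z y.2) fun i => by
    rw [tor_apply z (p.e_mem_wtSpace i), h, one_smul]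

theorem tor_eq_tor {z w : H} (h : ∀ i, Complex.exp (p.simpleRoot i z) =
    Complex.exp (p.simpleRoot i w)) : (tor z : 𝔤 ≃ₗ[ℂ] 𝔤) = tor w := by
  have : (tor (z - w) : 𝔤 ≃ₗ[ℂ] 𝔤) = 1 := p.tor_eq_one fun i => by
    rw [map_sub, Complex.exp_sub, h, div_self (Complex.exp_ne_zero _)]
  rw [← sub_add_cancel z w, tor_add, this, one_mul]

theorem mem_rootGroup {S : Set H.root} {β : H.root} (hβ : β ∈ S) {z : 𝔤}
    (hz : z ∈ wtSpace H (p.rt β)) : expAd z ∈ rootGroup H S :=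
  Subgroup.subset_closure ⟨β, hβ, z, mem_wtSpace_root.mp hz, rfl⟩

theorem x_mem_U (i : p.I) (a : ℂ) : p.x i a ∈ p.U :=
  p.mem_rootGroup (p.simple_mem_posRoots i) (Submodule.smul_mem _ a (p.e_mem_wtSpace i))

theorem y_mem_Uminus (i : p.I) (a : ℂ) : p.y i a ∈ p.Uminus := by
  obtain ⟨γ, hγ⟩ := p.exists_neg i.1
  refine p.mem_rootGroup (β := γ) ?_ ?_
  · intro h
    exact (p.neg_mem_posRoots_iff hγ).mp h (p.simple_mem_posRoots i)
  · rw [hγ]; exact Submodule.smul_mem _ a (p.f_mem_wtSpace i)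

theorem rootGroup_mono {S S' : Set H.root} (h : S ⊆ S') : rootGroup H S ≤ rootGroup H S' :=
  Subgroup.closure_mono fun _ ⟨α, hα, z, hz⟩ => ⟨α, h hα, z, hz⟩

theorem U_le_G : p.U ≤ p.G := rootGroup_mono (Set.subset_univ _)

theorem Uminus_le_G : p.Uminus ≤ p.G := rootGroup_mono (Set.subset_univ _)

theorem corootChar_mem_G (i : p.I) (a : ℂ) : p.corootChar i a ∈ p.G := by
  have hx : ∀ a, p.x i a ∈ p.G := fun a => p.U_le_G (p.x_mem_U i a)
  have hy : ∀ a, p.y i a ∈ p.G := fun a => p.Uminus_le_G (p.y_mem_Uminus i a)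
  exact mul_mem (mul_mem (mul_mem (hx _) (hy _)) (hx _))
    (inv_mem (mul_mem (mul_mem (hx _) (hy _)) (hx _)))

theorem tor_sum {ι : Type*} (s : Finset ι) (F : ι → H) {S : Submonoid (𝔤 ≃ₗ[ℂ] 𝔤)}
    (h : ∀ i, (tor (F i) : 𝔤 ≃ₗ[ℂ] 𝔤) ∈ S) : (tor (∑ i ∈ s, F i) : 𝔤 ≃ₗ[ℂ] 𝔤) ∈ S := by
  classical
  induction s using Finset.induction_on with
  | empty => rw [Finset.sum_empty, tor_zero]; exact one_mem _
  | insert a s ha ih => rw [Finset.sum_insert ha, tor_add]; exact mul_mem (h a) ih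

theorem exists_sum_sCoroot (z : H) : ∃ c : p.I → ℂ, z = ∑ i, c i • p.sCoroot i :=
  ⟨fun i => p.base.toCoweightBasis.repr z i, by
    conv_lhs => rw [← p.base.toCoweightBasis.sum_repr z]
    refine Finset.sum_congr rfl fun i _ => ?_
    rw [RootPairing.Base.toCoweightBasis_apply]; rfl⟩

theorem sum_sCoroot_eq_zero {c : p.I → ℂ} (h : ∑ i, c i • p.sCoroot i = 0) (i : p.I) : c i = 0 := by
  refine Fintype.linearIndependent_iff.mp p.base.toCoweightBasis.linearIndependent c ?_ i
  rw [← h]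
  refine Finset.sum_congr rfl fun i _ => ?_
  rw [RootPairing.Base.toCoweightBasis_apply]; rfl

theorem tor_mem_T (z : H) : tor z ∈ p.T := by
  refine ⟨?_, fun x hx => tor_apply_cartan z hx⟩
  obtain ⟨c, rfl⟩ := p.exists_sum_sCoroot z
  refine tor_sum _ _ (S := p.G.toSubmonoid) fun i => ?_
  rw [← corootChar_exp]
  exact p.corootChar_mem_G i _

/-- The exponential map of the maximal torus is surjective. -/
theorem exists_tor {t : 𝔤 ≃ₗ[ℂ] 𝔤} (ht : t ∈ p.T) : ∃ z : H, t = tor z := by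
  have hlie : t ∈ lieAut 𝔤 := rootGroup_le_lieAut _ ht.1
  have hc : ∀ i, ∃ c : ℂ, t (p.e i) = Complex.exp c • p.e i := by
    intro i
    have h1 : t (p.e i) ∈ wtSpace H (p.rt i.1) :=
      apply_mem_wtSpace hlie id (fun x => ht.2 x x.2) (fun _ => rfl) (p.e_mem_wtSpace i)
    obtain ⟨c, hc⟩ := exists_smul_of_mem_wtSpace (p.e_mem_wtSpace i) (p.e_ne_zero i) h1
    have h0 : c ≠ 0 := by
      rintro rfl
      rw [zero_smul] at hc
      exact p.e_ne_zero i (t.injective (hc.trans (map_zero _).symm))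
    exact ⟨Complex.log c, by rw [Complex.exp_log h0, hc]⟩
  choose c hc using hc
  refine ⟨∑ i, c i • p.coweight i, ?_⟩
  have hz : ∀ i, p.simpleRoot i (∑ j, c j • p.coweight j) = c i := fun i => by
    classical
    simp [map_sum, simpleRoot_coweight]
  rw [← mul_inv_eq_one, ← tor_neg]
  refine p.eq_one_of_fixes (mul_mem hlie (tor_mem_lieAut _)) (fun z => ?_) fun i => ?_
  · rw [LinearEquiv.mul_apply, tor_apply_cartan _ z.2, ht.2 z z.2]
  · rw [LinearEquiv.mul_apply, tor_apply _ (p.e_mem_wtSpace i), map_smul, hc, smul_smul,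
      ← Complex.exp_add, map_neg, hz, neg_add_cancel, Complex.exp_zero, one_smul]

theorem torusElt_exp (z : H) : p.torusElt (fun i => Complex.exp (p.simpleRoot i z)) = tor z := by
  have h := Classical.epsilon_spec (p := fun t : 𝔤 ≃ₗ[ℂ] 𝔤 => t ∈ p.T ∧
    ∀ i, p.rootChar i t = Complex.exp (p.simpleRoot i z)) ⟨tor z, p.tor_mem_T z, fun i =>
      p.rootChar_tor i z⟩
  change p.torusElt _ ∈ p.T ∧ _ at h
  obtain ⟨w, hw⟩ := p.exists_tor h.1
  rw [hw]
  refine p.tor_eq_tor fun i => ?_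
  rw [← p.rootChar_tor i w, ← hw, ← h.2 i]
  rfl

theorem logT_tor {z : H} (hz : ∀ i, (p.simpleRoot i z).im = 0) : p.logT (tor z) = z := by
  refine (Finset.sum_congr rfl fun i _ => ?_).trans (p.sum_simpleRoot_smul_coweight z)
  have : p.simpleRoot i z = ((p.simpleRoot i z).re : ℂ) := by
    apply Complex.ext <;> simp [hz]
  rw [rootChar_tor, this, ← Complex.ofReal_exp, Complex.ofReal_re, Real.log_exp]

/-- An element of `𝔱` with real values on the roots is a real combination of the simple coroots,
hence its exponential is in `T_{>0}`. -/
theorem tor_mem_Tpos {z : H} (hz : ∀ i, (p.simpleRoot i z).im = 0) : tor z ∈ p.Tpos := by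
  obtain ⟨c, rfl⟩ := p.exists_sum_sCoroot z
  have him : ∑ j, (((c j).im : ℝ) : ℂ) • p.sCoroot j = 0 := by
    refine p.cartan_ext fun i => ?_
    have h := hz i
    rw [map_sum, Complex.im_sum] at h
    rw [map_zero, map_sum]
    have h2 : ∑ j, p.simpleRoot i (((c j).im : ℂ) • p.sCoroot j) =
        ((∑ j, (p.simpleRoot i (c j • p.sCoroot j)).im : ℝ) : ℂ) := by
      rw [Complex.ofReal_sum]
      refine Finset.sum_congr rfl fun j _ => ?_
      rw [map_smul, map_smul, simpleRoot_sCoroot, smul_eq_mul, smul_eq_mul, Complex.mul_im]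
      simp
    rw [h2, h, Complex.ofReal_zero]
  have hre : ∀ j, c j = ((c j).re : ℂ) := fun j => by
    have := p.sum_sCoroot_eq_zero him j
    apply Complex.ext <;> simp
    exact_mod_cast this
  refine tor_sum _ _ (S := p.Tpos) fun i => Submonoid.subset_closure ⟨i, Real.exp (c i).re,
    Real.exp_pos _, ?_⟩
  rw [corootChar_ofReal p i (Real.exp_pos _), Real.log_exp, ← hre]

theorem U_le_unipotentFor : p.U ≤ unipotentFor p.rhoCheck := by
  refine rootGroup_le_unipotentFor fun α hα => ?_
  have h := p.rt_rhoCheck α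
  rw [rt] at h
  rw [h, Complex.intCast_re]
  exact_mod_cast (p.mem_posRoots.mp hα : (0 : ℤ) < _)

theorem Uminus_le_unipotentFor : p.Uminus ≤ unipotentFor (-p.rhoCheck) := by
  refine rootGroup_le_unipotentFor fun α hα => ?_
  have h := p.rt_rhoCheck α
  rw [rt] at h
  rw [map_neg, h, Complex.neg_re, Complex.intCast_re]
  have h2 := p.notMem_posRoots.mp hα
  have : (1 : ℤ) ≤ -p.base.height α := by omega
  exact_mod_cast this

theorem Bminus_le_filtStab : p.Bminus ≤ filtStab (-p.rhoCheck) := by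
  refine sup_le (fun t ht => ?_) (p.Uminus_le_unipotentFor.trans (unipotentFor_le_filtStab _))
  obtain ⟨z, rfl⟩ := p.exists_tor ht
  exact tor_mem_filtStab _ _

theorem eq_one_of_mem_Bminus_of_mem_U {g : 𝔤 ≃ₗ[ℂ] 𝔤} (h1 : g ∈ p.Bminus) (h2 : g ∈ p.U) : g = 1 :=
  eq_one_of_mem_filtStab_neg (p.U_le_unipotentFor h2) (p.Bminus_le_filtStab h1)

theorem tor_eq_one_of_mem_Uminus {z : H} (h : (tor z : 𝔤 ≃ₗ[ℂ] 𝔤) ∈ p.Uminus) :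
    (tor z : 𝔤 ≃ₗ[ℂ] 𝔤) = 1 := by
  refine eq_one_of_mem_filtStab_neg (p.Uminus_le_unipotentFor h) ?_
  rw [neg_neg]
  exact tor_mem_filtStab _ _

/-! ### The additive characters of the unipotent radical -/

theorem f_mem_filt (i : p.I) : p.f i ∈ filt p.rhoCheck (-1) :=
  mem_filt (by rw [LinearMap.neg_apply, simpleRoot_rhoCheck]; simp) (p.f_mem_wtSpace i)

theorem cartan_mem_filt (z : H) : (z : 𝔤) ∈ filt p.rhoCheck 0 :=
  mem_filt (χ := 0) (by simp) (mem_wtSpace_zero.mpr z.2)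

theorem coeff_eq_zero_of_mem_filt (i : p.I) {z : 𝔤} (hz : z ∈ filt p.rhoCheck 2) :
    p.coeff i z = 0 := by
  rw [coeff, killingForm_filt_eq_zero (by norm_num) hz (p.f_mem_filt i), zero_div]

theorem coeff_eq_zero_of_mem_wtSpace (i : p.I) {χ : Dual ℂ H} (hχ : χ ≠ p.simpleRoot i) {z : 𝔤}
    (hz : z ∈ wtSpace H χ) : p.coeff i z = 0 := by
  rw [coeff, killingForm_eq_zero_of_wtSpace (fun h => hχ ?_) hz (p.f_mem_wtSpace i), zero_div]
  exact add_neg_eq_zero.mp h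

theorem coeff_cartan (i : p.I) (z : H) : p.coeff i z = 0 :=
  p.coeff_eq_zero_of_mem_wtSpace i (p.simpleRoot_ne_zero i).symm (mem_wtSpace_zero.mpr z.2)

/-- The map `u ↦ (eᵢ-coefficient of u z)` is additive for `z ∈ 𝔱`: modulo terms of degree at least
two, `u v z - z = (u z - z) + (v z - z)`. -/
theorem coeff_mul_apply (i : p.I) {u v : 𝔤 ≃ₗ[ℂ] 𝔤} (hu : u ∈ unipotentFor p.rhoCheck)
    (hv : v ∈ unipotentFor p.rhoCheck) (z : H) :
    p.coeff i ((u * v) z) = p.coeff i (u z) + p.coeff i (v z) := by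
  have h1 := hv 0 z (p.cartan_mem_filt z)
  have h2 := hu _ _ h1
  have e : (u * v) (z : 𝔤) = u z + (v z - z) + (u (v z - z) - (v z - z)) := by
    rw [LinearEquiv.mul_apply, map_sub]; abel
  rw [e, coeff_add, coeff_add, p.coeff_eq_zero_of_mem_filt i (filt_anti _ (by norm_num) h2),
    coeff_sub, coeff_cartan]
  ring

theorem chiAt_mul (i : p.I) {u v : 𝔤 ≃ₗ[ℂ] 𝔤} (hu : u ∈ p.U) (hv : v ∈ p.U) :
    p.chiAt i (u * v) = p.chiAt i u + p.chiAt i v := by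
  rw [chiAt, p.coeff_mul_apply i (p.U_le_unipotentFor hu) (p.U_le_unipotentFor hv), neg_add]
  rfl

theorem chiAt_one (i : p.I) : p.chiAt i 1 = 0 := by
  have : p.chiAt i 1 = -p.coeff i (p.coweight i) := rfl
  rw [this, coeff_cartan, neg_zero]

theorem chi_mul {u v : 𝔤 ≃ₗ[ℂ] 𝔤} (hu : u ∈ p.U) (hv : v ∈ p.U) :
    p.chi (u * v) = p.chi u + p.chi v := by
  rw [chi, chi, chi, ← Finset.sum_add_distrib]
  exact Finset.sum_congr rfl fun i _ => p.chiAt_mul i hu hv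

theorem expAd_apply_cartan {β : H.root} {y : 𝔤} (hy : y ∈ wtSpace H (p.rt β)) (z : H) :
    expAd y (z : 𝔤) = z - p.rt β z • y := by
  have h1 : ⁅y, (z : 𝔤)⁆ = -(p.rt β z • y) := by rw [← lie_skew, hy z]
  rw [expAd_apply_of_lie_lie_eq_zero (isNilpotent_ad_of_mem_wtSpace ((rootSystem H).ne_zero β) hy),
    h1, sub_eq_add_neg]
  rw [h1, lie_neg, lie_smul, lie_self, smul_zero, neg_zero]

theorem coeff_expAd_cartan (i : p.I) {β : H.root} {y : 𝔤} (hy : y ∈ wtSpace H (p.rt β)) (z : H) :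
    p.coeff i (expAd y (z : 𝔤)) = -(p.simpleRoot i z * p.coeff i y) := by
  have e : p.coeff i (-p.rt β z • y) = -p.rt β z * p.coeff i y := by
    rw [coeff, map_smul, LinearMap.smul_apply, smul_eq_mul, mul_div_assoc]; rfl
  rw [p.expAd_apply_cartan hy, sub_eq_add_neg, ← neg_smul, coeff_add, coeff_cartan, e, zero_add]
  by_cases h : p.rt β = p.simpleRoot i
  · rw [h]; ring
  · rw [p.coeff_eq_zero_of_mem_wtSpace i h hy]; ring

theorem chiAt_expAd (i : p.I) {β : H.root} {y : 𝔤} (hy : y ∈ wtSpace H (p.rt β)) :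
    p.chiAt i (expAd y) = p.coeff i y := by
  rw [chiAt, p.coeff_expAd_cartan i hy, simpleRoot_coweight]; simp

/-- The characters `χᵢ` describe the degree one part of the action of `U` on all of `𝔱`. -/
theorem coeff_apply_cartan (i : p.I) {u : 𝔤 ≃ₗ[ℂ] 𝔤} (hu : u ∈ p.U) (z : H) :
    p.coeff i (u z) = -(p.simpleRoot i z * p.chiAt i u) := by
  have hone : ∀ z : H, p.coeff i ((1 : 𝔤 ≃ₗ[ℂ] 𝔤) z) = 0 := fun z => p.coeff_cartan i z
  induction hu using Subgroup.closure_induction with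
  | mem g hg =>
    obtain ⟨α, -, y, hy, rfl⟩ := hg
    have hy' := mem_wtSpace_root.mpr hy
    rw [p.coeff_expAd_cartan i hy', p.chiAt_expAd i hy']
  | one => rw [hone, chiAt_one, mul_zero, neg_zero]
  | mul a b ha hb iha ihb =>
    rw [p.coeff_mul_apply i (p.U_le_unipotentFor ha) (p.U_le_unipotentFor hb), iha, ihb,
      p.chiAt_mul i ha hb]
    ring
  | inv a ha iha =>
    have h1 := p.coeff_mul_apply i (p.U_le_unipotentFor ha) (p.U_le_unipotentFor (inv_mem ha)) z
    have h2 := p.chiAt_mul i ha (inv_mem ha)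
    rw [mul_inv_cancel, hone] at h1
    rw [mul_inv_cancel, chiAt_one] at h2
    linear_combination -h1 - iha - p.simpleRoot i z * h2

open Classical in
theorem chiAt_x (i j : p.I) (a : ℂ) : p.chiAt i (p.x j a) = if i = j then a else 0 := by
  rw [x, p.chiAt_expAd i (β := j.1) (Submodule.smul_mem _ a (p.e_mem_wtSpace j))]
  split_ifs with h
  · rw [h, coeff_smul_e]
  · exact p.coeff_eq_zero_of_mem_wtSpace i (fun h' => h (p.simple_injective h').symm)
      (Submodule.smul_mem _ a (p.e_mem_wtSpace j))

theorem chi_x (j : p.I) (a : ℂ) : p.chi (p.x j a) = a := by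
  simp [chi, chiAt_x]

/-! ### The action of the Weyl group representatives -/

/-- The action of `s_{i₁} ⋯ s_{iₙ}` on `𝔱`. -/
def corWord : List p.I → (H ≃ₗ[ℂ] H)
  | [] => LinearEquiv.refl ℂ H
  | i :: l => (corWord l).trans (p.cor i)

theorem sbarWord_apply_cartan (l : List p.I) (z : H) : p.sbarWord l z = p.corWord l z := by
  induction l with
  | nil => rfl
  | cons i l ih =>
    rw [sbarWord_cons, LinearEquiv.mul_apply, ih, sbar_apply_cartan]; rfl

theorem rt_weylWord_corWord (l : List p.I) (β : H.root) (z : H) :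
    p.rt (p.weylWord l β) (p.corWord l z) = p.rt β z := by
  obtain ⟨y, hy, h0⟩ := exists_mem_wtSpace_root (H := H) (𝔤 := 𝔤) β
  have h1 := p.sbarWord_apply_root l hy (p.corWord l z)
  rw [← sbarWord_apply_cartan, ← p.sbarWord_mem_lieAut l, hy z, map_smul, ← sub_eq_zero,
    ← sub_smul] at h1
  exact (sub_eq_zero.mp ((smul_eq_zero.mp h1).resolve_right fun h =>
    h0 ((p.sbarWord l).injective (h.trans (map_zero _).symm)))).symm

theorem sbarWord_inv_apply_root (l : List p.I) {β : H.root} {z : 𝔤}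
    (hz : z ∈ wtSpace H (p.rt β)) :
    (p.sbarWord l)⁻¹ z ∈ wtSpace H (p.rt ((p.weylWord l)⁻¹ β)) := by
  obtain ⟨y, hy, h0⟩ := exists_mem_wtSpace_root (H := H) (𝔤 := 𝔤) ((p.weylWord l)⁻¹ β)
  have h1 := p.sbarWord_apply_root l hy
  rw [perm_apply_inv] at h1
  obtain ⟨c, rfl⟩ := exists_smul_of_mem_wtSpace h1
    (fun h => h0 ((p.sbarWord l).injective (h.trans (map_zero _).symm))) hz
  rw [map_smul, inv_apply_apply]
  exact Submodule.smul_mem _ _ hy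

theorem mem_filt_of_root {β : H.root} {z : 𝔤} (hz : z ∈ wtSpace H (p.rt β)) :
    z ∈ filt p.rhoCheck (p.base.height β : ℝ) :=
  mem_filt (by rw [rt_rhoCheck, Complex.intCast_re]) hz

/-- The torus component of an element of `U T w̄ U` is unique. -/
theorem tor_eq_one_of_mul_sbarWord_eq {u v : 𝔤 ≃ₗ[ℂ] 𝔤} (hu : u ∈ p.U) (hv : v ∈ p.U) {z : H}
    {l : List p.I} (h : u * tor z * p.sbarWord l = p.sbarWord l * v) :
    (tor z : 𝔤 ≃ₗ[ℂ] 𝔤) = 1 := by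
  refine p.tor_eq_one fun i => ?_
  set γ := (p.weylWord l)⁻¹ i.1 with hγ
  set m := (p.sbarWord l)⁻¹ (p.e i) with hm
  have hmγ : m ∈ wtSpace H (p.rt γ) := p.sbarWord_inv_apply_root l (p.e_mem_wtSpace i)
  have hwm : p.sbarWord l m = p.e i := apply_inv_apply _ _
  have h1 := LinearEquiv.congr_fun h m
  rw [LinearEquiv.mul_apply, LinearEquiv.mul_apply, LinearEquiv.mul_apply, hwm,
    tor_apply z (p.e_mem_wtSpace i), map_smul] at h1
  have hue : p.coeff i (u (p.e i)) = 1 := by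
    have h2 : p.e i ∈ filt p.rhoCheck 1 :=
      mem_filt (by rw [simpleRoot_rhoCheck]; simp) (p.e_mem_wtSpace i)
    have h3 := p.coeff_eq_zero_of_mem_filt i
      (filt_anti _ (by norm_num) (p.U_le_unipotentFor hu _ _ h2))
    rw [coeff_sub] at h3
    rw [sub_eq_zero.mp h3]
    simpa using p.coeff_smul_e i 1
  -- The element `v` changes `m = w̄⁻¹ eᵢ` only by terms of larger degree, and these do not affect
  -- the coefficient of `eᵢ` after applying `w̄`.
  have hn : v m - m ∈ filt p.rhoCheck ((p.base.height γ : ℝ) + 1) :=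
    p.U_le_unipotentFor hv _ _ (p.mem_filt_of_root hmγ)
  have hwn : p.coeff i (p.sbarWord l (v m - m)) = 0 := by
    obtain ⟨δ, hδ⟩ := p.exists_neg i.1
    have hf : p.f i ∈ wtSpace H (p.rt δ) := by rw [hδ]; exact p.f_mem_wtSpace i
    have h2 := p.sbarWord_inv_apply_root l hf
    have h3 : p.base.height ((p.weylWord l)⁻¹ δ) = -p.base.height γ :=
      p.height_of_neg ((p.isLin_weylWord l).inv.map_neg p hδ)
    have h4 := p.mem_filt_of_root h2
    rw [h3] at h4
    rw [coeff, killingForm_inv_apply (p.sbarWord_mem_lieAut l),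
      killingForm_filt_eq_zero (by push_cast; linarith) hn h4, zero_div]
  rw [map_sub, coeff_sub, hwm, sub_eq_zero] at hwn
  have h5 := congrArg (p.coeff i) h1
  rw [hwn] at h5
  have h6 : ∀ (c : ℂ) (y : 𝔤), p.coeff i (c • y) = c * p.coeff i y := fun c y => by
    rw [coeff, map_smul, LinearMap.smul_apply, smul_eq_mul, mul_div_assoc]; rfl
  rw [h6, hue, mul_one] at h5
  rw [h5]
  simpa using p.coeff_smul_e i 1

theorem killingForm_apply_cartan (i : p.I) {u : 𝔤 ≃ₗ[ℂ] 𝔤} (hu : u ∈ p.U) (z : H) :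
    killingForm ℂ 𝔤 (u z) (p.f i) =
      -(p.simpleRoot i z * p.chiAt i u) * killingForm ℂ 𝔤 (p.e i) (p.f i) := by
  rw [← p.coeff_apply_cartan i hu z, coeff, div_mul_cancel₀ _ (p.killingForm_e_f_ne_zero i)]

theorem killingForm_apply_cartan_of_pos {u : 𝔤 ≃ₗ[ℂ] 𝔤} (hu : u ∈ p.U) (z : H) {β : H.root}
    (hβ : β ∈ p.posRoots) {y : 𝔤} (hy : y ∈ wtSpace H (p.rt β)) :
    killingForm ℂ 𝔤 (u z) y = 0 := by
  have h1 := apply_mem_filt (p.U_le_unipotentFor hu) (p.cartan_mem_filt z)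
  refine killingForm_filt_eq_zero ?_ h1 (p.mem_filt_of_root hy)
  have := p.mem_posRoots.mp hβ
  rw [zero_add]
  exact_mod_cast this

/-- If `u` and `v` in `U` are conjugate by `t w̄`, the values `χᵢ(u)` vanish except for the
simple roots `αᵢ` that `w⁻¹` keeps positive. -/
theorem chiAt_eq_zero_left {u v : 𝔤 ≃ₗ[ℂ] 𝔤} (hu : u ∈ p.U) (hv : v ∈ p.U) {z : H} {l : List p.I}
    (h : u * (tor z * p.sbarWord l) = tor z * p.sbarWord l * v) {i : p.I}
    (hi : (p.weylWord l)⁻¹ i.1 ∉ p.posRoots) : p.chiAt i u = 0 := by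
  set y := (p.corWord l).symm (p.coweight i) with hy
  have hwy : (tor z * p.sbarWord l) (y : 𝔤) = (p.coweight i : 𝔤) := by
    rw [LinearEquiv.mul_apply, sbarWord_apply_cartan, hy, LinearEquiv.apply_symm_apply,
      tor_apply_cartan _ (p.coweight i).2]
  -- The identity is applied to `y ∈ 𝔱` with `w y = ωᵢ^∨` and paired with `fᵢ`. On the right the
  -- form can be moved to `v y` and a multiple of `w̄⁻¹ fᵢ`, a root vector of a positive root.
  have h1 := congrArg (fun m => killingForm ℂ 𝔤 m (p.f i)) (LinearEquiv.congr_fun h (y : 𝔤))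
  obtain ⟨δ, hδ⟩ := p.exists_neg i.1
  have hf : p.f i ∈ wtSpace H (p.rt δ) := by rw [hδ]; exact p.f_mem_wtSpace i
  have h2 := p.sbarWord_inv_apply_root l hf
  have h3 : (p.weylWord l)⁻¹ δ ∈ p.posRoots :=
    (p.neg_mem_posRoots_iff ((p.isLin_weylWord l).inv.map_neg p hδ)).mpr hi
  have h4 : killingForm ℂ 𝔤 ((tor z * p.sbarWord l * v) (y : 𝔤)) (p.f i) = 0 := by
    rw [LinearEquiv.mul_apply,
      killingForm_inv_apply (mul_mem (tor_mem_lieAut z) (p.sbarWord_mem_lieAut l)), mul_inv_rev,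
      LinearEquiv.mul_apply, ← tor_neg, tor_apply (-z) hf, map_smul, map_smul,
      p.killingForm_apply_cartan_of_pos hv y h3 h2, smul_zero]
  rw [h4, LinearEquiv.mul_apply, hwy, p.killingForm_apply_cartan i hu, simpleRoot_coweight,
    if_pos rfl, one_mul] at h1
  exact neg_eq_zero.mp ((mul_eq_zero.mp h1).resolve_right (p.killingForm_e_f_ne_zero i))

/-- The counterpart of `chiAt_eq_zero_left` for the right factor: `χⱼ(v)` vanishes unless `w` keeps
`αⱼ` positive. -/
theorem chiAt_eq_zero_right {u v : 𝔤 ≃ₗ[ℂ] 𝔤} (hu : u ∈ p.U) (hv : v ∈ p.U) {z : H} {l : List p.I}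
    (h : u * (tor z * p.sbarWord l) = tor z * p.sbarWord l * v) {j : p.I}
    (hj : p.weylWord l j.1 ∉ p.posRoots) : p.chiAt j v = 0 := by
  set g := tor z * p.sbarWord l with hg
  have hlie : g ∈ lieAut 𝔤 := mul_mem (tor_mem_lieAut z) (p.sbarWord_mem_lieAut l)
  have hgy : g (p.coweight j : 𝔤) = (p.corWord l (p.coweight j) : H) := by
    rw [hg, LinearEquiv.mul_apply, sbarWord_apply_cartan, tor_apply_cartan]
    exact Subtype.prop _
  obtain ⟨δ, hδ⟩ := p.exists_neg j.1
  have hf : p.f j ∈ wtSpace H (p.rt δ) := by rw [hδ]; exact p.f_mem_wtSpace j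
  have h2 := p.sbarWord_apply_root l hf
  have h3 : p.weylWord l δ ∈ p.posRoots :=
    (p.neg_mem_posRoots_iff ((p.isLin_weylWord l).map_neg p hδ)).mpr hj
  have h4 : killingForm ℂ 𝔤 (v (p.coweight j : 𝔤)) (p.f j) = 0 := by
    rw [← killingForm_lieAut hlie, ← LinearEquiv.mul_apply g v, ← h, LinearEquiv.mul_apply u, hgy,
      hg, LinearEquiv.mul_apply, tor_apply z h2, map_smul,
      p.killingForm_apply_cartan_of_pos hu _ h3 h2, smul_zero]
  rw [p.killingForm_apply_cartan j hv, simpleRoot_coweight, if_pos rfl, one_mul] at h4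
  exact neg_eq_zero.mp ((mul_eq_zero.mp h4).resolve_right (p.killingForm_e_f_ne_zero j))

/-- If `u` and `v` in `U` are conjugate by `t w̄`, and `w` carries `αⱼ` to a simple root `αᵢ` with
`αᵢ(t) = 1`, then `χᵢ(u) = χⱼ(v)`, because `t w̄` carries `eⱼ` to `eᵢ` and `fⱼ` to `fᵢ`. -/
theorem chiAt_eq_chiAt {u v : 𝔤 ≃ₗ[ℂ] 𝔤} (hu : u ∈ p.U) (hv : v ∈ p.U) {z : H} {l : List p.I}
    (hl : p.IsReduced l) (h : u * (tor z * p.sbarWord l) = tor z * p.sbarWord l * v) {i j : p.I}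
    (hij : p.weylWord l j.1 = i.1) (hz : Complex.exp (p.simpleRoot i z) = 1) :
    p.chiAt i u = p.chiAt j v := by
  set g := tor z * p.sbarWord l with hg
  have hlie : g ∈ lieAut 𝔤 := mul_mem (tor_mem_lieAut z) (p.sbarWord_mem_lieAut l)
  have he := p.sbarWord_apply_e _ rfl hl hij
  have hf := p.sbarWord_apply_f hij he
  have hge : g (p.e j) = p.e i := by
    rw [hg, LinearEquiv.mul_apply, he, tor_apply z (p.e_mem_wtSpace i), hz, one_smul]
  have hgf : g (p.f j) = p.f i := by
    rw [hg, LinearEquiv.mul_apply, hf, tor_apply z (p.f_mem_wtSpace i), LinearMap.neg_apply,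
      Complex.exp_neg, hz, inv_one, one_smul]
  have hgy : g (p.coweight j : 𝔤) = (p.corWord l (p.coweight j) : H) := by
    rw [hg, LinearEquiv.mul_apply, sbarWord_apply_cartan, tor_apply_cartan]
    exact Subtype.prop _
  have h1 : killingForm ℂ 𝔤 (v (p.coweight j : 𝔤)) (p.f j) =
      killingForm ℂ 𝔤 (u ((p.corWord l (p.coweight j) : H) : 𝔤)) (p.f i) := by
    rw [← killingForm_lieAut hlie, hgf, ← hgy, ← LinearEquiv.mul_apply g v, ← h]
    rfl
  have h2 : p.simpleRoot i (p.corWord l (p.coweight j)) = 1 := by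
    have := p.rt_weylWord_corWord l j.1 (p.coweight j)
    rw [hij, rt_simple, rt_simple, simpleRoot_coweight, if_pos rfl] at this
    exact this
  rw [p.killingForm_apply_cartan j hv, p.killingForm_apply_cartan i hu, h2, simpleRoot_coweight,
    if_pos rfl, one_mul, one_mul, ← killingForm_lieAut hlie (p.e j), hge, hgf] at h1
  exact (neg_injective (mul_right_cancel₀ (p.killingForm_e_f_ne_zero i) h1)).symm

/-- The sum `χ(u₁) + χ(u₂)` is determined by `u₁ t w̄_P u₂` for `t ∈ Z(L_P)`. -/
theorem chi_eq_chi_of_conj {J : Set p.I} {l : List p.I} (hl : p.IsReduced l)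
    (hw : p.weylWord l = p.wP J) {u v : 𝔤 ≃ₗ[ℂ] 𝔤} (hu : u ∈ p.U) (hv : v ∈ p.U) {z : H}
    (hz : ∀ i ∈ J, Complex.exp (p.simpleRoot i z) = 1)
    (h : u * (tor z * p.sbarWord l) = tor z * p.sbarWord l * v) : p.chi u = p.chi v := by
  have hex : ∀ i : p.I, p.chiAt i u ≠ 0 → i ∈ J := by
    intro i hi
    by_contra hJ
    refine hi (p.chiAt_eq_zero_left hu hv h ?_)
    rw [hw]
    exact p.wP_inv_outside (p.simple_mem_outside hJ)
  have hj : ∀ i ∈ J, ∃ j : p.I, p.weylWord l j.1 = i.1 := by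
    intro i hi
    obtain ⟨j, hj⟩ := p.wP_inv_simple hi
    exact ⟨j, by rw [hw, ← hj, perm_apply_inv]⟩
  choose! σ hσ using hj
  -- The map `αᵢ ↦ w_P⁻¹ αᵢ` matches the nonzero terms of the two sums.
  refine Finset.sum_bij_ne_zero (fun i _ _ => σ i) (fun _ _ _ => Finset.mem_univ _) ?_ ?_ ?_
  · intro i _ hi i' _ hi' hii
    have h1 := hσ i (hex i hi)
    rw [hii, hσ i' (hex i' hi')] at h1
    exact (Subtype.ext h1).symm
  · intro j _ hj
    have hpos : p.weylWord l j.1 ∈ p.posRoots := by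
      by_contra hn
      exact hj (p.chiAt_eq_zero_right hu hv h hn)
    rw [hw] at hpos
    obtain ⟨i, hi, hij⟩ := p.wP_simple_of_pos hpos
    rw [← hw] at hij
    have e : σ i = j := Subtype.ext ((p.weylWord l).injective (by rw [hσ i hi, hij]))
    refine ⟨i, Finset.mem_univ _, ?_, e⟩
    rwa [p.chiAt_eq_chiAt hu hv hl h hij (hz i hi)]
  · intro i _ hi
    exact p.chiAt_eq_chiAt hu hv hl h (hσ i (hex i hi)) (hz i (hex i hi))

/-! ### Values of the maps on explicitly factored elements -/

theorem tor_conj_mem_U (z : H) {u : 𝔤 ≃ₗ[ℂ] 𝔤} (hu : u ∈ p.U) : tor z * u * (tor z)⁻¹ ∈ p.U :=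
  tor_conj_rootGroup z hu

theorem tor_conj_mem_Uminus (z : H) {u : 𝔤 ≃ₗ[ℂ] 𝔤} (hu : u ∈ p.Uminus) :
    tor z * u * (tor z)⁻¹ ∈ p.Uminus :=
  tor_conj_rootGroup z hu

theorem tor_mem_ZL {J : Set p.I} {z : H} (hz : ∀ i ∈ J, Complex.exp (p.simpleRoot i z) = 1) :
    tor z ∈ p.ZL J :=
  ⟨p.tor_mem_T z, fun i hi => by rw [rootChar_tor, hz i hi]⟩

theorem exists_tor_of_mem_ZL {J : Set p.I} {t : 𝔤 ≃ₗ[ℂ] 𝔤} (ht : t ∈ p.ZL J) :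
    ∃ z : H, t = tor z ∧ ∀ i ∈ J, Complex.exp (p.simpleRoot i z) = 1 := by
  obtain ⟨z, rfl⟩ := p.exists_tor ht.1
  exact ⟨z, rfl, fun i hi => by rw [← rootChar_tor, ht.2 i hi]⟩

theorem tor_eq_of_factorization {u₁ u₂ v₁ v₂ : 𝔤 ≃ₗ[ℂ] 𝔤} (hu₁ : u₁ ∈ p.U) (hu₂ : u₂ ∈ p.U)
    (hv₁ : v₁ ∈ p.U) (hv₂ : v₂ ∈ p.U) {z z' : H} {l : List p.I}
    (h : u₁ * tor z * p.sbarWord l * u₂ = v₁ * tor z' * p.sbarWord l * v₂) :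
    (tor z : 𝔤 ≃ₗ[ℂ] 𝔤) = tor z' := by
  have h1 : (tor (-z') * (v₁⁻¹ * u₁) * (tor (-z'))⁻¹) * tor (z - z') * p.sbarWord l =
      p.sbarWord l * (v₂ * u₂⁻¹) := by
    have e : u₁ * tor z * p.sbarWord l = v₁ * tor z' * p.sbarWord l * v₂ * u₂⁻¹ := by
      rw [← h]; group
    have e2 : (tor (z - z') : 𝔤 ≃ₗ[ℂ] 𝔤) = (tor z')⁻¹ * tor z := by
      rw [sub_eq_neg_add, tor_add, tor_neg]
    rw [e2, tor_neg, inv_inv]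
    calc _ = (tor z')⁻¹ * v₁⁻¹ * (u₁ * tor z * p.sbarWord l) := by group
      _ = _ := by rw [e]; group
  have h2 := p.tor_eq_one_of_mul_sbarWord_eq
    (p.tor_conj_mem_U (-z') (mul_mem (inv_mem hv₁) hu₁)) (mul_mem hv₂ (inv_mem hu₂)) h1
  rw [← sub_add_cancel z z', tor_add, h2, one_mul]

section Crystal

variable {J : Set p.I} {n : ℕ} {ii : Fin n → p.I}

/-- The choice made in the definition of `π` is irrelevant. -/
theorem highestWeight_mul {u₁ u₂ : 𝔤 ≃ₗ[ℂ] 𝔤} (hu₁ : u₁ ∈ p.U) (hu₂ : u₂ ∈ p.U) {z : H}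
    (hz : ∀ i ∈ J, Complex.exp (p.simpleRoot i z) = 1) :
    p.highestWeight J ii (u₁ * tor z * p.wbar ii * u₂) = tor z := by
  have h := Classical.epsilon_spec (p := fun t : 𝔤 ≃ₗ[ℂ] 𝔤 => t ∈ p.ZL J ∧ ∃ v₁ ∈ p.U, ∃ v₂ ∈ p.U,
    u₁ * tor z * p.wbar ii * u₂ = v₁ * t * p.wbar ii * v₂)
    ⟨tor z, p.tor_mem_ZL hz, u₁, hu₁, u₂, hu₂, rfl⟩
  obtain ⟨hZ, v₁, hv₁, v₂, hv₂, h⟩ := h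
  obtain ⟨z', hz', -⟩ := p.exists_tor_of_mem_ZL hZ
  rw [highestWeight, hz']
  rw [hz'] at h
  exact (p.tor_eq_of_factorization hu₁ hu₂ hv₁ hv₂ h).symm

/-- The choice made in the definition of `f` is irrelevant. -/
theorem decoration_mul (hl : p.IsReduced (List.ofFn ii)) (hw : p.weylWord (List.ofFn ii) = p.wP J)
    {u₁ u₂ : 𝔤 ≃ₗ[ℂ] 𝔤} (hu₁ : u₁ ∈ p.U) (hu₂ : u₂ ∈ p.U) {z : H}
    (hz : ∀ i ∈ J, Complex.exp (p.simpleRoot i z) = 1) :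
    p.decoration J ii (u₁ * tor z * p.wbar ii * u₂) = p.chi u₁ + p.chi u₂ := by
  have h := Classical.epsilon_spec (p := fun q : (𝔤 ≃ₗ[ℂ] 𝔤) × (𝔤 ≃ₗ[ℂ] 𝔤) =>
    q.1 ∈ p.U ∧ q.2 ∈ p.U ∧ ∃ t ∈ p.ZL J,
      u₁ * tor z * p.wbar ii * u₂ = q.1 * t * p.wbar ii * q.2)
    ⟨(u₁, u₂), hu₁, hu₂, tor z, p.tor_mem_ZL hz, rfl⟩
  rw [decoration]
  set q := Classical.epsilon fun q : (𝔤 ≃ₗ[ℂ] 𝔤) × (𝔤 ≃ₗ[ℂ] 𝔤) =>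
    q.1 ∈ p.U ∧ q.2 ∈ p.U ∧ ∃ t ∈ p.ZL J,
      u₁ * tor z * p.wbar ii * u₂ = q.1 * t * p.wbar ii * q.2
  obtain ⟨hq₁, hq₂, t, ht, h⟩ := h
  obtain ⟨z', rfl, hz'⟩ := p.exists_tor_of_mem_ZL ht
  change p.chi q.1 + p.chi q.2 = _
  rw [← p.tor_eq_of_factorization hu₁ hu₂ hq₁ hq₂ h] at h
  have h1 : q.1⁻¹ * u₁ * (tor z * p.sbarWord (List.ofFn ii)) =
      tor z * p.sbarWord (List.ofFn ii) * (q.2 * u₂⁻¹) := by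
    change _ * (tor z * p.wbar ii) = tor z * p.wbar ii * _
    calc _ = q.1⁻¹ * (u₁ * tor z * p.wbar ii * u₂) * u₂⁻¹ := by group
      _ = _ := by rw [h]; group
  have h2 := p.chi_eq_chi_of_conj hl hw (mul_mem (inv_mem hq₁) hu₁) (mul_mem hq₂ (inv_mem hu₂))
    hz h1
  have h3 := p.chi_mul hq₁ (mul_mem (inv_mem hq₁) hu₁)
  have h4 := p.chi_mul (mul_mem hq₂ (inv_mem hu₂)) hu₂
  rw [mul_inv_cancel_left] at h3
  rw [inv_mul_cancel_right] at h4
  rw [h3, h4, h2]; ring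

theorem weightMap_mul {u : 𝔤 ≃ₗ[ℂ] 𝔤} (hu : u ∈ p.Uminus) (z : H) :
    p.weightMap (u * tor z) = tor z := by
  have h := Classical.epsilon_spec (p := fun t₀ : 𝔤 ≃ₗ[ℂ] 𝔤 => t₀ ∈ p.T ∧ ∃ u₀ ∈ p.Uminus,
    u * tor z = u₀ * t₀) ⟨tor z, p.tor_mem_T z, u, hu, rfl⟩
  rw [weightMap]
  obtain ⟨hT, u₀, hu₀, h⟩ := h
  obtain ⟨z', hz'⟩ := p.exists_tor hT
  rw [hz'] at h ⊢
  have h1 : (tor (z - z') : 𝔤 ≃ₗ[ℂ] 𝔤) = u⁻¹ * u₀ := by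
    rw [sub_eq_add_neg, tor_add, tor_neg, mul_inv_eq_iff_eq_mul, mul_assoc, eq_inv_mul_iff_mul_eq,
      h]
  have h2 : (tor (z - z') : 𝔤 ≃ₗ[ℂ] 𝔤) = 1 :=
    p.tor_eq_one_of_mem_Uminus (h1 ▸ mul_mem (inv_mem hu) hu₀)
  rw [← sub_add_cancel z z', tor_add, h2, one_mul]

theorem mul_tor_mem_Bminus {m : 𝔤 ≃ₗ[ℂ] 𝔤} (hm : m ∈ p.Uminus) (z : H) : m * tor z ∈ p.Bminus :=
  mul_mem (Subgroup.mem_sup_right hm) (Subgroup.mem_sup_left (p.tor_mem_T z))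

theorem twist_eq {g b u : 𝔤 ≃ₗ[ℂ] 𝔤} (hb : b ∈ p.Bminus) (hu : u ∈ p.U)
    (h : g * p.wbarInv ii = b * u) : p.twist ii g = p.iota b := by
  obtain ⟨hb', u', hu', h'⟩ := Classical.epsilon_spec (p := fun b : 𝔤 ≃ₗ[ℂ] 𝔤 => b ∈ p.Bminus ∧
    ∃ u ∈ p.U, g * p.wbarInv ii = b * u) ⟨b, hb, u, hu, h⟩
  rw [twist]
  congr 1
  set b' := Classical.epsilon fun b : 𝔤 ≃ₗ[ℂ] 𝔤 => b ∈ p.Bminus ∧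
    ∃ u ∈ p.U, g * p.wbarInv ii = b * u
  have h1 : b⁻¹ * b' = u * u'⁻¹ := by
    rw [inv_mul_eq_iff_eq_mul, ← mul_assoc, ← h, h']; group
  have h2 := p.eq_one_of_mem_Bminus_of_mem_U (mul_mem (inv_mem hb) hb')
    (h1 ▸ mul_mem hu (inv_mem hu'))
  exact (inv_mul_eq_one.mp h2).symm

end Crystal

/-! ### The anti-automorphism `ι` -/

/-- An element of `𝔱` on which all simple roots take the value `π i`. -/
def piRho : H := ((Real.pi : ℂ) * Complex.I) • p.rhoCheck

theorem exp_simpleRoot_piRho (i : p.I) : Complex.exp (p.simpleRoot i p.piRho) = -1 := by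
  rw [piRho, map_smul, simpleRoot_rhoCheck, smul_eq_mul, mul_one, Complex.exp_pi_mul_I]

/-- The anti-automorphism `ι` is inversion followed by conjugation by `exp (π i ρ^∨)`. -/
theorem iota_eq (g : 𝔤 ≃ₗ[ℂ] 𝔤) : p.iota g = tor p.piRho * g⁻¹ * (tor p.piRho)⁻¹ := by
  have : p.torusElt (fun _ => -1) = tor p.piRho := by
    have h := p.torusElt_exp p.piRho
    simpa only [exp_simpleRoot_piRho] using h
  rw [iota, this]

theorem iota_one : p.iota 1 = 1 := by rw [iota_eq]; group

theorem iota_mul (g h : 𝔤 ≃ₗ[ℂ] 𝔤) : p.iota (g * h) = p.iota h * p.iota g := by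
  simp only [iota_eq]; group

theorem iota_tor (z : H) : p.iota (tor z) = tor (-z) := by
  rw [iota_eq, ← tor_neg, ← tor_neg, ← tor_add, ← tor_add]; congr 1; abel

theorem iota_x (i : p.I) (a : ℂ) : p.iota (p.x i a) = p.x i a := by
  rw [iota_eq, ← x_neg, tor_conj_x, exp_simpleRoot_piRho]; congr 1; ring

theorem iota_y (i : p.I) (a : ℂ) : p.iota (p.y i a) = p.y i a := by
  rw [iota_eq, ← y_neg, tor_conj_y, Complex.exp_neg, exp_simpleRoot_piRho]; congr 1; ring

theorem iota_sbar (i : p.I) : p.iota (p.sbar i) = p.sbar i := by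
  rw [sbar, iota_mul, iota_mul, iota_x, iota_y, mul_assoc]

theorem iota_prod (l : List (𝔤 ≃ₗ[ℂ] 𝔤)) (h : ∀ g ∈ l, p.iota g = g) :
    p.iota l.prod = l.reverse.prod := by
  induction l with
  | nil => exact p.iota_one
  | cons g l ih =>
    rw [List.prod_cons, iota_mul, ih fun m hm => h m (List.mem_cons_of_mem _ hm),
      h g List.mem_cons_self, List.reverse_cons, List.prod_append, List.prod_singleton]

theorem iota_sbarWord (l : List p.I) : p.iota (p.sbarWord l) = p.sbarWord l.reverse := by
  rw [sbarWord, iota_prod, sbarWord, List.map_reverse]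
  intro g hg
  obtain ⟨i, -, rfl⟩ := List.mem_map.mp hg
  exact p.iota_sbar i

theorem iota_mem_U {u : 𝔤 ≃ₗ[ℂ] 𝔤} (hu : u ∈ p.U) : p.iota u ∈ p.U := by
  rw [iota_eq]; exact p.tor_conj_mem_U _ (inv_mem hu)

theorem chiAt_tor_conj (i : p.I) (z : H) (u : 𝔤 ≃ₗ[ℂ] 𝔤) :
    p.chiAt i (tor z * u * (tor z)⁻¹) = Complex.exp (p.simpleRoot i z) * p.chiAt i u := by
  have h : (tor z * u * (tor z)⁻¹) (p.coweight i : 𝔤) = tor z (u (p.coweight i)) := by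
    rw [LinearEquiv.mul_apply, LinearEquiv.mul_apply, ← tor_neg,
      tor_apply_cartan _ (p.coweight i).2]
  rw [chiAt, h, coeff, killingForm_inv_apply (tor_mem_lieAut z), ← tor_neg,
    tor_apply _ (p.f_mem_wtSpace i), map_smul, LinearMap.neg_apply, map_neg, neg_neg, smul_eq_mul,
    mul_div_assoc, chiAt, coeff]
  ring

theorem chiAt_iota (i : p.I) {u : 𝔤 ≃ₗ[ℂ] 𝔤} (hu : u ∈ p.U) :
    p.chiAt i (p.iota u) = p.chiAt i u := by
  have h := p.chiAt_mul i hu (inv_mem hu)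
  rw [mul_inv_cancel, chiAt_one] at h
  rw [iota_eq, chiAt_tor_conj, exp_simpleRoot_piRho]
  linear_combination h

/-! ### Factorization of positive words -/

section Words

variable {Ω : Type*} [MeasurableSpace Ω]

/-- Words in the letters `I` decorated by positive measurable functions of a parameter. -/
def PosWord (L : List (p.I × (Ω → ℝ))) : Prop :=
  ∀ q ∈ L, Measurable q.2 ∧ ∀ ω, 0 < q.2 ω

/-- Elements of `𝔱` depending on a parameter on which all simple roots are real and measurable. -/
def RealMeas (Z : Ω → H) : Prop :=
  ∀ j, (∀ ω, (p.simpleRoot j (Z ω)).im = 0) ∧ Measurable fun ω => (p.simpleRoot j (Z ω)).re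

/-- The product of the `xᵢ(a)` over the letters of a word. -/
def xWord (L : List (p.I × (Ω → ℝ))) (ω : Ω) : 𝔤 ≃ₗ[ℂ] 𝔤 :=
  (L.map fun q => p.x q.1 (q.2 ω : ℂ)).prod

/-- The product of the `yᵢ(a)` over the letters of a word. -/
def yWord (L : List (p.I × (Ω → ℝ))) (ω : Ω) : 𝔤 ≃ₗ[ℂ] 𝔤 :=
  (L.map fun q => p.y q.1 (q.2 ω : ℂ)).prod

/-- The logarithm `∑ₖ (log aₖ) βₖ^∨` of the torus part of a word; here
`βₖ = s_{i₁} ⋯ s_{iₖ₋₁} α_{iₖ}`. -/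
def zWord : List (p.I × (Ω → ℝ)) → Ω → H
  | [], _ => 0
  | q :: L, ω => (Real.log (q.2 ω) : ℂ) • p.sCoroot q.1 + p.cor q.1 (zWord L ω)

/-- The product over the letters `(iₖ, dₖ)` of a word of the elements `x_{iₖ}(-dₖ)` conjugated by
`s̄_{iₖ₋₁} ⋯ s̄_{i₁}`. -/
def uWord : List (p.I × (Ω → ℝ)) → Ω → 𝔤 ≃ₗ[ℂ] 𝔤
  | [], _ => 1
  | q :: L, ω => p.x q.1 (-(q.2 ω : ℂ)) * ((p.sbar q.1)⁻¹ * uWord L ω * p.sbar q.1)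

variable {p}

theorem PosWord.of_cons {q : p.I × (Ω → ℝ)} {L : List (p.I × (Ω → ℝ))} (h : p.PosWord (q :: L)) :
    (Measurable q.2 ∧ ∀ ω, 0 < q.2 ω) ∧ p.PosWord L :=
  ⟨h q List.mem_cons_self, fun r hr => h r (List.mem_cons_of_mem _ hr)⟩

theorem PosWord.cons {q : p.I × (Ω → ℝ)} {L : List (p.I × (Ω → ℝ))}
    (hq : Measurable q.2 ∧ ∀ ω, 0 < q.2 ω) (h : p.PosWord L) : p.PosWord (q :: L) := by
  intro r hr
  rcases List.mem_cons.mp hr with rfl | hr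
  · exact hq
  · exact h r hr

theorem PosWord.append {L M : List (p.I × (Ω → ℝ))} (hL : p.PosWord L) (hM : p.PosWord M) :
    p.PosWord (L ++ M) := fun q hq => (List.mem_append.mp hq).elim (hL q) (hM q)

theorem posWord_nil : p.PosWord ([] : List (p.I × (Ω → ℝ))) := fun q hq => by simp at hq

theorem RealMeas.add {Z W : Ω → H} (hZ : p.RealMeas Z) (hW : p.RealMeas W) :
    p.RealMeas fun ω => Z ω + W ω := by
  intro j
  refine ⟨fun ω => ?_, ?_⟩
  · rw [map_add, Complex.add_im, (hZ j).1, (hW j).1, add_zero]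
  · simp only [map_add, Complex.add_re]
    exact (hZ j).2.add (hW j).2

theorem RealMeas.neg {Z : Ω → H} (hZ : p.RealMeas Z) : p.RealMeas fun ω => -Z ω := by
  intro j
  refine ⟨fun ω => ?_, ?_⟩
  · rw [map_neg, Complex.neg_im, (hZ j).1, neg_zero]
  · simp only [map_neg, Complex.neg_re]
    exact (hZ j).2.neg

theorem realMeas_smul_sCoroot {F : Ω → ℝ} (hF : Measurable F) (i : p.I) :
    p.RealMeas fun ω => (F ω : ℂ) • p.sCoroot i := by
  intro j
  refine ⟨fun ω => ?_, ?_⟩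
  · rw [map_smul, simpleRoot_sCoroot, smul_eq_mul, Complex.mul_im]; simp
  · simp only [map_smul, simpleRoot_sCoroot, smul_eq_mul, Complex.re_ofReal_mul]
    exact hF.mul_const _

theorem RealMeas.eq_re {Z : Ω → H} (hZ : p.RealMeas Z) (j : p.I) (ω : Ω) :
    p.simpleRoot j (Z ω) = ((p.simpleRoot j (Z ω)).re : ℂ) := by
  apply Complex.ext <;> simp [(hZ j).1]

theorem RealMeas.cor {Z : Ω → H} (hZ : p.RealMeas Z) (i : p.I) :
    p.RealMeas fun ω => p.cor i (Z ω) := by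
  have h := hZ.add (realMeas_smul_sCoroot (p := p) (hZ i).2.neg i)
  convert h using 2 with ω
  rw [cor_apply]
  conv_lhs => rw [hZ.eq_re i ω]
  rw [Pi.neg_apply]
  push_cast; module

theorem realMeas_zWord {L : List (p.I × (Ω → ℝ))} (hL : p.PosWord L) : p.RealMeas (p.zWord L) := by
  induction L with
  | nil =>
    intro j
    simp only [zWord, map_zero, Complex.zero_im, Complex.zero_re, implies_true, true_and]
    exact measurable_const
  | cons q L ih =>
    obtain ⟨⟨hm, -⟩, hL⟩ := hL.of_cons
    exact (realMeas_smul_sCoroot (Real.measurable_log.comp hm) q.1).add ((ih hL).cor q.1)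

/-- A real torus element can be moved past a product of elements `yᵢ` with positive parameters. -/
theorem tor_mul_yWord {Z : Ω → H} (hZ : p.RealMeas Z) {L : List (p.I × (Ω → ℝ))}
    (hL : p.PosWord L) : ∃ M, p.PosWord M ∧
      ∀ ω, tor (Z ω) * p.yWord L ω = p.yWord M ω * tor (Z ω) := by
  induction L with
  | nil => exact ⟨[], posWord_nil, fun ω => by simp [yWord]⟩
  | cons q L ih =>
    obtain ⟨⟨hm, hp⟩, hL⟩ := hL.of_cons
    obtain ⟨M, hM, h⟩ := ih hL
    refine ⟨(q.1, fun ω => Real.exp (-(p.simpleRoot q.1 (Z ω)).re) * q.2 ω) :: M,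
      PosWord.cons ⟨(Real.measurable_exp.comp (hZ q.1).2.neg).mul hm, fun ω =>
        mul_pos (Real.exp_pos _) (hp ω)⟩ hM, fun ω => ?_⟩
    have e := p.tor_conj_y q.1 (Z ω) (q.2 ω)
    rw [hZ.eq_re q.1 ω, ← Complex.ofReal_neg, ← Complex.ofReal_exp, ← Complex.ofReal_mul,
      mul_inv_eq_iff_eq_mul] at e
    change _ * (p.y q.1 (q.2 ω) * p.yWord L ω) = p.y q.1 _ * p.yWord M ω * _
    rw [← mul_assoc, e, mul_assoc, h, mul_assoc]

/-- An element `xᵢ(a)`, `a > 0`, can be moved past a product of elements `yⱼ` with positive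
parameters, at the cost of a torus element and of new positive parameters. -/
theorem x_mul_yWord (i : p.I) {L : List (p.I × (Ω → ℝ))} (hL : p.PosWord L) : ∀ {a : Ω → ℝ},
    Measurable a → (∀ ω, 0 < a ω) → ∃ (M : List (p.I × (Ω → ℝ))) (D : Ω → ℝ), p.PosWord M ∧
      Measurable D ∧ (∀ ω, 0 < D ω) ∧ ∀ ω, p.x i (a ω) * p.yWord L ω =
        p.yWord M ω * tor ((Real.log (D ω) : ℂ) • p.sCoroot i) * p.x i ((a ω / D ω : ℝ) : ℂ) := by
  induction L with
  | nil =>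
    intro a ha hp
    exact ⟨[], fun _ => 1, posWord_nil, measurable_const, fun _ => one_pos, fun ω => by
      simp [yWord, tor_zero]⟩
  | cons q L ih =>
    intro a ha hp
    obtain ⟨⟨hqm, hqp⟩, hL⟩ := hL.of_cons
    by_cases hi : i = q.1
    · set E : Ω → ℝ := fun ω => 1 + a ω * q.2 ω with hE
      have hEm : Measurable E := measurable_const.add (ha.mul hqm)
      have hEp : ∀ ω, 0 < E ω := fun ω => by
        have := mul_pos (hp ω) (hqp ω)
        simp only [hE]; linarith
      obtain ⟨M, D, hM, hDm, hDp, h⟩ := ih hL (ha.div hEm) fun ω => div_pos (hp ω) (hEp ω)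
      have hRM := realMeas_smul_sCoroot (p := p) (Real.measurable_log.comp hEm) i
      obtain ⟨M', hM', h'⟩ := tor_mul_yWord hRM hM
      refine ⟨(i, fun ω => q.2 ω / E ω) :: M', fun ω => E ω * D ω,
        PosWord.cons ⟨hqm.div hEm, fun ω => div_pos (hqp ω) (hEp ω)⟩ hM', hEm.mul hDm,
        fun ω => mul_pos (hEp ω) (hDp ω), fun ω => ?_⟩
      have e1 := p.x_mul_y_self i (hp ω) (hqp ω)
      have e2 := h ω
      have e3 := h' ω
      simp only [Function.comp_apply, Pi.div_apply] at e2 e3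
      change _ * (p.y q.1 (q.2 ω) * p.yWord L ω) = p.y i _ * p.yWord M' ω * _ * _
      rw [← hi, ← mul_assoc, e1]
      change p.y i ((q.2 ω / E ω : ℝ) : ℂ) * tor ((Real.log (E ω) : ℂ) • p.sCoroot i) *
        p.x i ((a ω / E ω : ℝ) : ℂ) * p.yWord L ω = _
      rw [mul_assoc, e2, Real.log_mul (hEp ω).ne' (hDp ω).ne', Complex.ofReal_add, add_smul,
        tor_add, ← div_div]
      calc _ = p.y i ((q.2 ω / E ω : ℝ) : ℂ) * (tor ((Real.log (E ω) : ℂ) • p.sCoroot i) *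
            p.yWord M ω) * tor ((Real.log (D ω) : ℂ) • p.sCoroot i) *
            p.x i ((a ω / E ω / D ω : ℝ) : ℂ) := by group
        _ = _ := by rw [e3]; group
    · obtain ⟨M, D, hM, hDm, hDp, h⟩ := ih hL ha hp
      refine ⟨q :: M, D, PosWord.cons ⟨hqm, hqp⟩ hM, hDm, hDp, fun ω => ?_⟩
      change _ * (p.y q.1 (q.2 ω) * p.yWord L ω) = p.y q.1 (q.2 ω) * p.yWord M ω * _ * _
      rw [← mul_assoc, p.x_mul_y_of_ne hi, mul_assoc, h]
      group

/-- The factorization `x_{i₁}(a₁) ⋯ x_{iₙ}(aₙ) s̄_{iₙ} ⋯ s̄_{i₁} ∈ U⁻ T U`: the factor in `U⁻` is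
totally positive, and the factor in `U` has only non-positive parameters. -/
theorem xWord_mul_sbarWord {Q : List (p.I × (Ω → ℝ))} (hQ : p.PosWord Q) :
    ∃ L D : List (p.I × (Ω → ℝ)), p.PosWord L ∧ p.PosWord D ∧ D.map Prod.fst = Q.map Prod.fst ∧
      ∀ ω, p.xWord Q ω * p.sbarWord (Q.map Prod.fst).reverse =
        p.yWord L ω * tor (p.zWord Q ω) * p.uWord D ω := by
  induction Q with
  | nil =>
    exact ⟨[], [], posWord_nil, posWord_nil, rfl, fun ω => by
      simp [xWord, yWord, zWord, uWord, tor_zero, sbarWord_nil]⟩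
  | cons q Q ih =>
    have hzm := realMeas_zWord hQ.of_cons.2
    obtain ⟨⟨hqm, hqp⟩, hQ⟩ := hQ.of_cons
    obtain ⟨L, D, hL, hD, hDQ, h⟩ := ih hQ
    obtain ⟨M, E, hM, hEm, hEp, h1⟩ := x_mul_yWord q.1 hL hqm hqp
    obtain ⟨i, a⟩ := q
    set b : Ω → ℝ := fun ω => Real.exp (-(p.simpleRoot i (p.zWord Q ω)).re) * (a ω / E ω) with hb
    have hbm : Measurable b := (Real.measurable_exp.comp (hzm i).2.neg).mul (hqm.div hEm)
    have hbp : ∀ ω, 0 < b ω := fun ω => mul_pos (Real.exp_pos _) (div_pos (hqp ω) (hEp ω))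
    have hRM := (realMeas_smul_sCoroot (p := p) (Real.measurable_log.comp hEm) i).add hzm
    obtain ⟨N, hN, h2⟩ := tor_mul_yWord hRM (L := [(i, fun ω => (b ω)⁻¹)])
      (PosWord.cons ⟨hbm.inv, fun ω => inv_pos.mpr (hbp ω)⟩ posWord_nil)
    -- The letter `xᵢ(a)` is moved past the `U⁻`-factor and the torus factor of the remaining word,
    -- where it becomes `xᵢ(b)`; then `xᵢ(b) s̄ᵢ` is factored in `U⁻ T U`.
    refine ⟨M ++ N, (i, fun ω => (b ω)⁻¹) :: D, hM.append hN,
      PosWord.cons ⟨hbm.inv, fun ω => inv_pos.mpr (hbp ω)⟩ hD, by simp [hDQ], fun ω => ?_⟩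
    have e1 : p.x i ((a ω / E ω : ℝ) : ℂ) * tor (p.zWord Q ω) =
        tor (p.zWord Q ω) * p.x i (b ω) := by
      have e := p.tor_conj_x i (-p.zWord Q ω) ((a ω / E ω : ℝ) : ℂ)
      rw [map_neg, hzm.eq_re i ω, ← Complex.ofReal_neg, ← Complex.ofReal_exp,
        ← Complex.ofReal_mul, tor_neg, inv_inv] at e
      rw [hb, ← e]; group
    have e2 := p.x_mul_sbar i (hbp ω)
    have e3 := h2 ω
    have e4 := h ω
    have e5 := h1 ω
    simp only [Function.comp_apply] at e3
    have e3' : tor ((Real.log (E ω) : ℂ) • p.sCoroot i) * tor (p.zWord Q ω) *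
        p.y i (b ω : ℂ)⁻¹ = p.yWord N ω * (tor ((Real.log (E ω) : ℂ) • p.sCoroot i) *
          tor (p.zWord Q ω)) := by
      rw [← tor_add, ← e3]
      simp [yWord]
    have e6 : tor ((Real.log (E ω) : ℂ) • p.sCoroot i) * tor (p.zWord Q ω) *
        tor ((Real.log (b ω) : ℂ) • p.sCoroot i) =
        (tor (p.zWord ((i, a) :: Q) ω) : 𝔤 ≃ₗ[ℂ] 𝔤) := by
      rw [← tor_add, ← tor_add, zWord, cor_apply]
      congr 1
      have hlb : Real.log (b ω) = -(p.simpleRoot i (p.zWord Q ω)).re +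
          (Real.log (a ω) - Real.log (E ω)) := by
        rw [hb, Real.log_mul (Real.exp_pos _).ne' (div_pos (hqp ω) (hEp ω)).ne', Real.log_exp,
          Real.log_div (hqp ω).ne' (hEp ω).ne']
      rw [hlb, hzm.eq_re i ω]
      push_cast; module
    change p.x i (a ω) * p.xWord Q ω * p.sbarWord (i :: Q.map Prod.fst).reverse = _
    have e7 : p.yWord (M ++ N) ω = p.yWord M ω * p.yWord N ω := by simp [yWord]
    rw [List.reverse_cons, sbarWord_append, sbarWord_cons, sbarWord_nil, mul_one, e7, ← e6, uWord]
    rw [Complex.ofReal_inv]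
    calc _ = p.x i (a ω) * (p.xWord Q ω * p.sbarWord (Q.map Prod.fst).reverse) * p.sbar i := by
          group
      _ = (p.x i (a ω) * p.yWord L ω) * tor (p.zWord Q ω) * p.uWord D ω * p.sbar i := by
          rw [e4]; group
      _ = p.yWord M ω * tor ((Real.log (E ω) : ℂ) • p.sCoroot i) *
          (p.x i ((a ω / E ω : ℝ) : ℂ) * tor (p.zWord Q ω)) * p.uWord D ω * p.sbar i := by
          rw [e5]; group
      _ = p.yWord M ω * tor ((Real.log (E ω) : ℂ) • p.sCoroot i) * tor (p.zWord Q ω) *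
          (p.x i (b ω) * p.sbar i) * ((p.sbar i)⁻¹ * p.uWord D ω * p.sbar i) := by
          rw [e1]; group
      _ = p.yWord M ω * (tor ((Real.log (E ω) : ℂ) • p.sCoroot i) * tor (p.zWord Q ω) *
          p.y i (b ω : ℂ)⁻¹) * tor ((Real.log (b ω) : ℂ) • p.sCoroot i) * p.x i (-(b ω : ℂ)⁻¹) *
          ((p.sbar i)⁻¹ * p.uWord D ω * p.sbar i) := by
          rw [e2]; group
      _ = _ := by rw [e3']; group

end Words

/-! ### Reduced words and their reversals -/

variable {p}

theorem length_inv (w : Equiv.Perm H.root) : p.length w⁻¹ = p.length w := by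
  have key : ∀ w : Equiv.Perm H.root, {m | ∃ l : List p.I, p.weylWord l = w ∧ l.length = m} ⊆
      {m | ∃ l : List p.I, p.weylWord l = w⁻¹ ∧ l.length = m} := by
    rintro w m ⟨l, rfl, rfl⟩
    exact ⟨l.reverse, p.weylWord_reverse l, l.length_reverse⟩
  refine congrArg sInf (Set.Subset.antisymm ?_ (key w))
  have := key w⁻¹
  rwa [inv_inv] at this

theorem IsReduced.reverse {l : List p.I} (h : p.IsReduced l) : p.IsReduced l.reverse := by
  rw [IsReduced, ← length_weylWord, weylWord_reverse, length_inv, length_weylWord, h,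
    List.length_reverse]

theorem IsReduced.of_append_right {l m : List p.I} (h : p.IsReduced (l ++ m)) : p.IsReduced m := by
  induction l with
  | nil => exact h
  | cons i l ih => exact ih h.of_cons.1

theorem IsReduced.of_append_left {l m : List p.I} (h : p.IsReduced (l ++ m)) :
    p.IsReduced l.reverse := by
  have := h.reverse
  rw [List.reverse_append] at this
  exact this.of_append_right

section Words

variable {Ω : Type*} [MeasurableSpace Ω]

/-- For a prefix `C` of a reduced word, the remaining part of the `U`-factor in
`xWord_mul_sbarWord`, conjugated by the representative of the reversed prefix, lies in `U` and has
non-positive values `χᵢ`. The `k`-th letter contributes a root vector of weight `βₖ`, hence it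
contributes to `χᵢ` only if `βₖ = αᵢ`, and then without a sign change by `sbarWord_apply_e`. -/
theorem chiAt_conj_uWord {D : List (p.I × (Ω → ℝ))} (hD : p.PosWord D) (i : p.I) :
    ∀ {C : List p.I}, p.IsReduced (C ++ D.map Prod.fst) → ∃ r : Ω → ℝ, Measurable r ∧
      (∀ ω, 0 ≤ r ω) ∧ (i.1 ∉ (p.betas (D.map Prod.fst)).map (p.weylWord C) → ∀ ω, r ω = 0) ∧
      ∀ ω, (p.sbarWord C.reverse)⁻¹ * p.uWord D ω * p.sbarWord C.reverse ∈ p.U ∧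
        p.chiAt i ((p.sbarWord C.reverse)⁻¹ * p.uWord D ω * p.sbarWord C.reverse) = -(r ω : ℂ) := by
  classical
  induction D with
  | nil =>
    intro C _
    refine ⟨fun _ => 0, measurable_const, fun _ => le_rfl, fun _ _ => rfl, fun ω => ?_⟩
    have : (p.sbarWord C.reverse)⁻¹ * p.uWord ([] : List (p.I × (Ω → ℝ))) ω *
        p.sbarWord C.reverse = 1 := by rw [uWord]; group
    rw [this]
    exact ⟨one_mem _, by rw [chiAt_one]; simp⟩
  | cons q D ih =>
    intro C hC
    obtain ⟨⟨hqm, hqp⟩, hD'⟩ := hD.of_cons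
    obtain ⟨k, d⟩ := q
    have hC' : p.IsReduced (C ++ [k] ++ D.map Prod.fst) := by simpa using hC
    obtain ⟨r, hrm, hr0, hrv, hr⟩ := ih hD' hC'
    set g := p.sbarWord C.reverse with hg
    have hlie : g ∈ lieAut 𝔤 := p.sbarWord_mem_lieAut _
    have hinv : (p.weylWord C.reverse)⁻¹ = p.weylWord C := by rw [weylWord_reverse, inv_inv]
    set β := p.weylWord C k.1 with hβ
    have hgβ : g⁻¹ (p.e k) ∈ wtSpace H (p.rt β) := by
      have := p.sbarWord_inv_apply_root C.reverse (β := k.1) (p.e_mem_wtSpace k)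
      rwa [hinv] at this
    have hβpos : β ∈ p.posRoots := by
      have h1 : β ∈ p.betas (C ++ ((k, d) :: D).map Prod.fst) := by
        rw [betas_append, List.mem_append]
        exact Or.inr (by simp [betas, hβ])
      exact (p.mem_invSet.mp ((p.mem_betas hC β).mp h1)).1
    have hx : ∀ c : ℂ, g⁻¹ * p.x k c * g = expAd (c • g⁻¹ (p.e k)) := by
      intro c
      have := conj_expAd (inv_mem hlie) (p.isNilpotent_ad_smul_e k c)
      rw [inv_inv, map_smul] at this
      exact this
    have hgrev : p.sbarWord (C ++ [k]).reverse = p.sbar k * g := by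
      rw [List.reverse_append]
      simp [sbarWord, hg]
    have hfac : ∀ ω, g⁻¹ * p.uWord ((k, d) :: D) ω * g =
        expAd (-(d ω : ℂ) • g⁻¹ (p.e k)) * ((p.sbarWord (C ++ [k]).reverse)⁻¹ * p.uWord D ω *
          p.sbarWord (C ++ [k]).reverse) := by
      intro ω
      rw [← hx, hgrev, uWord]; group
    have hmem : ∀ ω, expAd (-(d ω : ℂ) • g⁻¹ (p.e k)) ∈ p.U := fun ω =>
      p.mem_rootGroup hβpos (Submodule.smul_mem _ _ hgβ)
    have hchi : ∀ ω, p.chiAt i (expAd (-(d ω : ℂ) • g⁻¹ (p.e k))) =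
        -((if β = i.1 then d ω else 0 : ℝ) : ℂ) := by
      intro ω
      rw [p.chiAt_expAd i (Submodule.smul_mem _ _ hgβ)]
      split_ifs with h
      · -- The representative of the reversed prefix carries `eᵢ` to `eₖ` without a sign.
        have h1 : p.weylWord C.reverse i.1 = k.1 := by
          rw [← h, hβ, weylWord_reverse, perm_inv_apply]
        have h2 := p.sbarWord_apply_e _ rfl hC.of_append_left h1
        rw [← h2, inv_apply_apply, coeff_smul_e]
      · rw [p.coeff_eq_zero_of_mem_wtSpace i (fun h' => h (p.rt_injective h'))
          (Submodule.smul_mem _ _ hgβ)]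
        simp
    refine ⟨fun ω => (if β = i.1 then d ω else 0) + r ω, ?_, ?_, ?_, ?_⟩
    · split_ifs
      · exact hqm.add hrm
      · exact measurable_const.add hrm
    · intro ω
      have : 0 ≤ if β = i.1 then d ω else 0 := by split_ifs; exacts [(hqp ω).le, le_rfl]
      exact add_nonneg this (hr0 ω)
    · intro hi ω
      simp only [List.map_cons, betas, List.mem_cons, not_or] at hi
      have hne : β ≠ i.1 := Ne.symm hi.1
      simp only [if_neg hne, zero_add]
      refine hrv ?_ ω
      intro h3
      refine hi.2 ?_
      simpa [weylWord_append, weylWord_cons, weylWord_nil] using h3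
    · intro ω
      rw [hfac]
      refine ⟨mul_mem (hmem ω) (hr ω).1, ?_⟩
      rw [p.chiAt_mul i (hmem ω) (hr ω).1, hchi, (hr ω).2]
      push_cast; ring

end Words

variable (p)

/-! ### The torus chart -/

/-- The roots `βₖ = s_{i₁} ⋯ s_{iₖ₋₁} α_{iₖ}` attached to a word `(i₁, …, iₙ)`. -/
def betaFn : (n : ℕ) → (Fin n → p.I) → Fin n → H.root
  | 0, _ => Fin.elim0
  | n + 1, ii => Fin.cons (ii 0).1 fun k =>
      p.simpleReflection (ii 0) (betaFn n (fun k => ii k.succ) k)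

theorem betas_ofFn : ∀ {n : ℕ} (ii : Fin n → p.I),
    p.betas (List.ofFn ii) = List.ofFn (p.betaFn n ii)
  | 0, _ => by simp [betas]
  | n + 1, ii => by
    rw [List.ofFn_succ, List.ofFn_succ, betas, betas_ofFn, List.map_ofFn]
    rfl

theorem cor_coroot (i : p.I) (β : H.root) :
    p.cor i (coroot β.1) = coroot (p.simpleReflection i β).1 :=
  ((rootSystem H).coroot_reflectionPerm i.1 β).symm

theorem zWord_ofFn {Ω : Type*} [MeasurableSpace Ω] (ω : Ω) : ∀ {n : ℕ} (ii : Fin n → p.I)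
    (A : Fin n → Ω → ℝ), p.zWord (List.ofFn fun k => (ii k, A k)) ω =
      ∑ k, (Real.log (A k ω) : ℂ) • (coroot (p.betaFn n ii k).1 : H)
  | 0, _, _ => by simp [zWord]
  | n + 1, ii, A => by
    rw [List.ofFn_succ, zWord, zWord_ofFn ω (fun k => ii k.succ), map_sum, Fin.sum_univ_succ]
    congr 1
    refine Finset.sum_congr rfl fun k _ => ?_
    rw [map_smul, cor_coroot]; rfl

theorem chi_list_prod (l : List (𝔤 ≃ₗ[ℂ] 𝔤)) (h : ∀ g ∈ l, g ∈ p.U) :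
    p.chi l.prod = (l.map p.chi).sum := by
  induction l with
  | nil =>
    have : p.chi (1 : 𝔤 ≃ₗ[ℂ] 𝔤) = 0 := Finset.sum_eq_zero fun i _ => p.chiAt_one i
    simp [this]
  | cons g l ih =>
    have hl : ∀ m ∈ l, m ∈ p.U := fun m hm => h m (List.mem_cons_of_mem _ hm)
    rw [List.prod_cons, p.chi_mul (h g List.mem_cons_self) (list_prod_mem hl), ih hl,
      List.map_cons, List.sum_cons]

theorem Tpos_le_Gnonneg : p.Tpos ≤ p.Gnonneg :=
  Submonoid.closure_mono fun _ ⟨i, a, ha, h⟩ => ⟨i, a, ha, Or.inl h⟩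

/-- The coordinate `aₖ` on the positive orthant, extended by `1`. -/
def posCoord {n : ℕ} (k : Fin n) (a : Fin n → ℝ) : ℝ := if 0 < a k then a k else 1

theorem measurable_posCoord {n : ℕ} (k : Fin n) : Measurable (posCoord k) :=
  Measurable.ite (measurableSet_lt measurable_const (measurable_pi_apply k)) (measurable_pi_apply k)
    measurable_const

theorem posCoord_pos {n : ℕ} (k : Fin n) (a : Fin n → ℝ) : 0 < posCoord k a := by
  unfold posCoord
  split_ifs with h
  exacts [h, one_pos]

/-- The decoration and the weight map in the torus chart: on the fiber over `exp z` the decoration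
is `∑ₖ aₖ + ∑ᵢ αᵢ(exp z) rᵢ(a)`, where the functions `rᵢ ≥ 0` do not depend on `z` and vanish for
`i ∈ I_P`. -/
theorem exists_chart_formula [Nonempty p.I] {J : Set p.I} {n : ℕ} {ii : Fin n → p.I}
    (hl : p.IsReduced (List.ofFn ii)) (hw : p.weylWord (List.ofFn ii) = p.wP J) :
    ∃ r : p.I → (Fin n → ℝ) → ℝ, (∀ i, Measurable (r i)) ∧ (∀ i a, 0 ≤ r i a) ∧
      (∀ i ∈ J, ∀ a, r i a = 0) ∧
      ∀ z : H, (∀ i, (p.simpleRoot i z).im = 0) → (∀ i ∈ J, p.simpleRoot i z = 0) →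
      ∀ a : Fin n → ℝ, (∀ k, 0 < a k) →
        p.chart ii (tor z) (fun k => (a k : ℂ)) ∈ p.XposFiber J ii (tor z) ∧
        p.decoration J ii (p.chart ii (tor z) (fun k => (a k : ℂ))) =
          ((∑ k, a k + ∑ i, Real.exp (p.simpleRoot i z).re * r i a : ℝ) : ℂ) ∧
        p.logT (p.weightMap (p.chart ii (tor z) (fun k => (a k : ℂ)))) =
          z - ∑ k, (Real.log (a k) : ℂ) • (coroot (p.betaFn n ii k).1 : H) := by
  set Q : List (p.I × ((Fin n → ℝ) → ℝ)) := List.ofFn fun k => (ii k, posCoord k) with hQdef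
  have hQfst : Q.map Prod.fst = List.ofFn ii := by rw [hQdef, List.map_ofFn]; rfl
  have hQ : p.PosWord Q := by
    intro q hq
    obtain ⟨k, rfl⟩ := (List.mem_ofFn' _ _).mp hq
    exact ⟨measurable_posCoord k, posCoord_pos k⟩
  obtain ⟨L, D, hL, hD, hDQ, hfac⟩ := xWord_mul_sbarWord hQ
  rw [hQfst] at hDQ
  have hr := fun i => chiAt_conj_uWord hD i (C := []) (by rw [hDQ]; exact hl)
  choose r hrm hr0 hrv hr using hr
  have hrJ : ∀ i ∈ J, ∀ a, r i a = 0 := by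
    intro i hi
    refine hrv i fun h => ?_
    have h1 : i.1 ∈ p.betas (List.ofFn ii) := by
      rw [hDQ, weylWord_nil] at h
      simpa using h
    rw [p.mem_betas hl, hw, invSet_wP, mem_outside_iff] at h1
    exact h1.2 (p.simple_mem_posRootsP hi)
  refine ⟨r, hrm, hr0, hrJ, fun z hzim hzJ a ha => ?_⟩
  have hexpJ : ∀ i ∈ J, Complex.exp (p.simpleRoot i z) = 1 := fun i hi => by
    rw [hzJ i hi, Complex.exp_zero]
  set w := p.zWord Q a with hwdef
  have hwsum : w = ∑ k, (Real.log (a k) : ℂ) • (coroot (p.betaFn n ii k).1 : H) := by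
    rw [hwdef, hQdef, zWord_ofFn]
    refine Finset.sum_congr rfl fun k _ => ?_
    rw [posCoord, if_pos (ha k)]
  have hwim : ∀ i, (p.simpleRoot i w).im = 0 := fun i => (realMeas_zWord hQ i).1 a
  set lx : List (𝔤 ≃ₗ[ℂ] 𝔤) := List.ofFn fun k => p.x (ii k) (a k) with hlx
  have hlxU : ∀ g ∈ lx, g ∈ p.U := by
    intro g hg
    obtain ⟨k, rfl⟩ := (List.mem_ofFn' _ _).mp hg
    exact p.x_mem_U _ _
  have hxQ : p.xWord Q a = lx.prod := by
    rw [xWord, hQdef, List.map_ofFn, hlx]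
    congr 2
    funext k
    simp only [Function.comp_apply, posCoord, if_pos (ha k)]
  set ly : List (𝔤 ≃ₗ[ℂ] 𝔤) := L.map fun q => p.y q.1 (q.2 a : ℂ) with hly
  have hlyU : ∀ g ∈ ly, g ∈ p.Uminus := by
    intro g hg
    obtain ⟨q, -, rfl⟩ := List.mem_map.mp hg
    exact p.y_mem_Uminus _ _
  have hlypos : ∀ g ∈ ly, g ∈ p.Gnonneg := by
    intro g hg
    obtain ⟨q, hq, rfl⟩ := List.mem_map.mp hg
    exact Submonoid.subset_closure ⟨q.1, q.2 a, (hL q hq).2 a, Or.inr (Or.inr rfl)⟩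
  set u := p.uWord D a with hu
  have hconj : ∀ g : 𝔤 ≃ₗ[ℂ] 𝔤,
      (p.sbarWord ([] : List p.I).reverse)⁻¹ * g * p.sbarWord ([] : List p.I).reverse = g := by
    intro g
    rw [List.reverse_nil, sbarWord_nil]; group
  have huU : u ∈ p.U := by
    obtain ⟨i⟩ := ‹Nonempty p.I›
    have := (hr i a).1
    rwa [hconj] at this
  have huchi : ∀ i, p.chiAt i u = -(r i a : ℂ) := fun i => by
    have := (hr i a).2
    rwa [hconj] at this
  have hfac' : lx.prod * p.wbarInv ii = ly.prod * tor w * u := by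
    have := hfac a
    rwa [hQfst, hxQ] at this
  have hbB : ly.prod * tor w ∈ p.Bminus := p.mul_tor_mem_Bminus (list_prod_mem hlyU) w
  have htw : p.twist ii lx.prod = p.iota (ly.prod * tor w) := p.twist_eq hbB huU hfac'
  -- The two factorizations of the twist: in `T U⁻` and in `U w̄ U`.
  have htw1 : p.twist ii lx.prod = tor (-w) * ly.reverse.prod := by
    rw [htw, iota_mul, iota_tor, p.iota_prod ly]
    intro g hg
    obtain ⟨q, -, rfl⟩ := List.mem_map.mp hg
    exact p.iota_y _ _
  have htw2 : p.twist ii lx.prod = p.iota u⁻¹ * p.wbar ii * lx.reverse.prod := by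
    have e : ly.prod * tor w = lx.prod * p.wbarInv ii * u⁻¹ := by rw [hfac']; group
    rw [htw, e, iota_mul, iota_mul, wbarInv, iota_sbarWord, List.reverse_reverse, p.iota_prod lx]
    · rw [wbar, mul_assoc]
    intro g hg
    obtain ⟨k, rfl⟩ := (List.mem_ofFn' _ _).mp hg
    exact p.iota_x _ _
  have hyr : ly.reverse.prod ∈ p.Uminus :=
    list_prod_mem fun g hg => hlyU g (List.mem_reverse.mp hg)
  have hxr : lx.reverse.prod ∈ p.U := list_prod_mem fun g hg => hlxU g (List.mem_reverse.mp hg)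
  have hchart : p.chart ii (tor z) (fun k => (a k : ℂ)) = tor z * p.twist ii lx.prod := rfl
  have hιu : p.iota u⁻¹ ∈ p.U := p.iota_mem_U (inv_mem huU)
  have hc1 : p.chart ii (tor z) (fun k => (a k : ℂ)) =
      tor (z - w) * ly.reverse.prod * (tor (z - w))⁻¹ * tor (z - w) := by
    rw [hchart, htw1, sub_eq_add_neg, tor_add]; group
  have hc2 : p.chart ii (tor z) (fun k => (a k : ℂ)) =
      tor z * p.iota u⁻¹ * (tor z)⁻¹ * tor z * p.wbar ii * lx.reverse.prod := by
    rw [hchart, htw2]; group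
  have hzw : ∀ i, (p.simpleRoot i (z - w)).im = 0 := fun i => by
    rw [map_sub, Complex.sub_im, hzim, hwim, sub_zero]
  have hu₁ := p.tor_conj_mem_U z hιu
  refine ⟨⟨⟨?_, ?_⟩, ?_, ?_⟩, ?_, ?_⟩
  · rw [hc1]
    exact p.mul_tor_mem_Bminus (p.tor_conj_mem_Uminus _ hyr) _
  · exact ⟨_, hu₁, tor z, p.tor_mem_ZL hexpJ, _, hxr, hc2⟩
  · rw [hc2, p.highestWeight_mul hu₁ hxr hexpJ]
  · refine Set.mul_mem_mul ⟨p.tor_mem_ZL hexpJ, p.tor_mem_Tpos hzim⟩ ⟨?_, ?_, ?_⟩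
    · change p.twist ii lx.prod ∈ p.Bminus
      rw [htw1]
      exact mul_mem (Subgroup.mem_sup_left (p.tor_mem_T _)) (Subgroup.mem_sup_right hyr)
    · exact ⟨_, hιu, _, hxr, htw2⟩
    · change p.twist ii lx.prod ∈ p.Gnonneg
      rw [htw1]
      refine mul_mem (p.Tpos_le_Gnonneg (p.tor_mem_Tpos fun i => ?_))
        (list_prod_mem fun g hg => hlypos g (List.mem_reverse.mp hg))
      rw [map_neg, Complex.neg_im, hwim, neg_zero]
  · rw [hc2, p.decoration_mul hl hw hu₁ hxr hexpJ]
    have h1 : p.chi lx.reverse.prod = ((∑ k, a k : ℝ) : ℂ) := by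
      rw [p.chi_list_prod _ fun g hg => hlxU g (List.mem_reverse.mp hg), List.map_reverse,
        List.sum_reverse, hlx, List.map_ofFn, List.sum_ofFn, Complex.ofReal_sum]
      exact Finset.sum_congr rfl fun k _ => p.chi_x _ _
    have h2 : ∀ i, p.chiAt i (tor z * p.iota u⁻¹ * (tor z)⁻¹) =
        ((Real.exp (p.simpleRoot i z).re * r i a : ℝ) : ℂ) := by
      intro i
      have h3 := p.chiAt_mul i huU (inv_mem huU)
      rw [mul_inv_cancel, chiAt_one, huchi] at h3
      have h4 : p.simpleRoot i z = ((p.simpleRoot i z).re : ℂ) := by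
        apply Complex.ext <;> simp [hzim]
      rw [chiAt_tor_conj, p.chiAt_iota i (inv_mem huU), h4, Complex.ofReal_mul, Complex.ofReal_exp,
        Complex.ofReal_re]
      linear_combination (Complex.exp ((p.simpleRoot i z).re : ℂ)) * (-h3)
    rw [h1, chi, Finset.sum_congr rfl fun i _ => h2 i, Complex.ofReal_add, add_comm,
      ← Complex.ofReal_sum]
  · rw [hc1, p.weightMap_mul (p.tor_conj_mem_Uminus _ hyr), p.logT_tor hzw, hwsum]

end Pinning

/-! ### Products of Gamma integrals -/

theorem integrableOn_cpow_mul_exp {c : ℂ} (hc : 0 < c.re) {b : ℝ} (hb : 0 < b) :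
    IntegrableOn (fun x : ℝ => (x : ℂ) ^ (c - 1) * Complex.exp (-(b * x : ℂ))) (Set.Ioi 0) := by
  have h := integrableOn_rpow_mul_exp_neg_mul_rpow (s := c.re - 1) (by linarith) one_pos hb
  refine h.mono' ?_ ?_
  · refine ContinuousOn.aestronglyMeasurable ?_ measurableSet_Ioi
    refine ContinuousOn.mul (fun x hx => ?_) (by fun_prop)
    exact (Complex.continuous_ofReal.continuousAt.cpow continuousAt_const
      (Complex.ofReal_mem_slitPlane.mpr hx)).continuousWithinAt
  · refine (ae_restrict_iff' measurableSet_Ioi).mpr (Eventually.of_forall fun x hx => ?_)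
    rw [norm_mul, Complex.norm_cpow_eq_rpow_re_of_pos hx, Complex.norm_exp, Real.rpow_one]
    simp

/-- The open positive orthant. -/
def orthant (n : ℕ) : Set (Fin n → ℝ) := {a | ∀ k, 0 < a k}

theorem orthant_eq (n : ℕ) : orthant n = Set.univ.pi fun _ => Set.Ioi 0 := by
  ext a; simp [orthant]

theorem measurableSet_orthant (n : ℕ) : MeasurableSet (orthant n) := by
  rw [orthant_eq]; exact MeasurableSet.univ_pi fun _ => measurableSet_Ioi

theorem volume_restrict_orthant (n : ℕ) : (volume : Measure (Fin n → ℝ)).restrict (orthant n) =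
    Measure.pi fun _ : Fin n => (volume : Measure ℝ).restrict (Set.Ioi 0) := by
  rw [orthant_eq, volume_pi, Measure.restrict_pi_pi]

/-- The integrand of a product of Gamma integrals. -/
def gammaIntegrand {n : ℕ} (c : Fin n → ℂ) (b : ℝ) (a : Fin n → ℝ) : ℂ :=
  ∏ k, (a k : ℂ) ^ (c k - 1) * Complex.exp (-(b * a k : ℂ))

theorem integrableOn_gammaIntegrand {n : ℕ} {c : Fin n → ℂ} (hc : ∀ k, 0 < (c k).re) {b : ℝ}
    (hb : 0 < b) : IntegrableOn (gammaIntegrand c b) (orthant n) := by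
  rw [IntegrableOn, volume_restrict_orthant]
  exact Integrable.fintype_prod
    (f := fun k (x : ℝ) => (x : ℂ) ^ (c k - 1) * Complex.exp (-(b * x : ℂ)))
    fun k => integrableOn_cpow_mul_exp (hc k) hb

theorem setIntegral_gammaIntegrand {n : ℕ} {c : Fin n → ℂ} (hc : ∀ k, 0 < (c k).re) {b : ℝ}
    (hb : 0 < b) : ∫ a in orthant n, gammaIntegrand c b a =
      ∏ k, (1 / (b : ℂ)) ^ c k * Complex.Gamma (c k) := by
  rw [volume_restrict_orthant]
  refine (integral_fintype_prod_eq_prod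
    (fun k (x : ℝ) => (x : ℂ) ^ (c k - 1) * Complex.exp (-(b * x : ℂ)))).trans ?_
  exact Finset.prod_congr rfl fun k _ => Complex.integral_cpow_mul_exp_neg_mul_Ioi (hc k) hb

theorem norm_exp_neg_mul_le {x : ℝ} (hx : 0 ≤ x) (y : ℂ) : ‖Complex.exp (-(x : ℂ)) * y‖ ≤ ‖y‖ := by
  rw [norm_mul, Complex.norm_exp]
  have : Real.exp (-(x : ℂ)).re ≤ 1 := Real.exp_le_one_iff.mpr (by simpa using hx)
  exact mul_le_of_le_one_left (norm_nonneg _) this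

section Damping

variable {ι : Type*} [Fintype ι] {n : ℕ} {r : ι → (Fin n → ℝ) → ℝ} {c : Fin n → ℂ} {b : ℝ}

theorem aestronglyMeasurable_damped (hr : ∀ i, Measurable (r i)) (hc : ∀ k, 0 < (c k).re)
    (hb : 0 < b) (ε : ι → ℝ) :
    AEStronglyMeasurable (fun a => Complex.exp (-((b * ∑ i, ε i * r i a : ℝ) : ℂ)) *
      gammaIntegrand c b a) (volume.restrict (orthant n)) := by
  refine AEStronglyMeasurable.mul (Measurable.aestronglyMeasurable ?_)
    (integrableOn_gammaIntegrand hc hb).aestronglyMeasurable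
  refine Complex.measurable_exp.comp (Complex.measurable_ofReal.comp ?_).neg
  exact (Finset.measurable_sum _ fun i _ => (hr i).const_mul (ε i)).const_mul b

theorem integrableOn_damped (hr : ∀ i, Measurable (r i)) (hr0 : ∀ i a, 0 ≤ r i a)
    (hc : ∀ k, 0 < (c k).re) (hb : 0 < b) {ε : ι → ℝ} (hε : ∀ i, 0 ≤ ε i) :
    IntegrableOn (fun a => Complex.exp (-((b * ∑ i, ε i * r i a : ℝ) : ℂ)) *
      gammaIntegrand c b a) (orthant n) := by
  refine (integrableOn_gammaIntegrand hc hb).norm.mono' (aestronglyMeasurable_damped hr hc hb ε)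
    (Eventually.of_forall fun a => ?_)
  exact norm_exp_neg_mul_le (mul_nonneg hb.le
    (Finset.sum_nonneg fun i _ => mul_nonneg (hε i) (hr0 i a))) _

/-- Dominated convergence: the damping factors `exp (-b ∑ᵢ εᵢ rᵢ)` are bounded by one and tend to
one pointwise. -/
theorem tendsto_setIntegral_damped (hr : ∀ i, Measurable (r i)) (hr0 : ∀ i a, 0 ≤ r i a)
    (hc : ∀ k, 0 < (c k).re) (hb : 0 < b) {ε : ℝ → ι → ℝ} (hε : ∀ s i, 0 ≤ ε s i) {l : Filter ℝ}
    [l.IsCountablyGenerated] (hlim : ∀ i a, Tendsto (fun s => ε s i * r i a) l (𝓝 0)) :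
    Tendsto (fun s => ∫ a in orthant n, Complex.exp (-((b * ∑ i, ε s i * r i a : ℝ) : ℂ)) *
      gammaIntegrand c b a) l (𝓝 (∫ a in orthant n, gammaIntegrand c b a)) := by
  refine tendsto_integral_filter_of_dominated_convergence (fun a => ‖gammaIntegrand c b a‖)
    (Eventually.of_forall fun s => aestronglyMeasurable_damped hr hc hb (ε s))
    (Eventually.of_forall fun s => Eventually.of_forall fun a => ?_)
    (integrableOn_gammaIntegrand hc hb).norm (Eventually.of_forall fun a => ?_)
  · exact norm_exp_neg_mul_le (mul_nonneg hb.le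
      (Finset.sum_nonneg fun i _ => mul_nonneg (hε s i) (hr0 i a))) _
  · have h1 : Tendsto (fun s => b * ∑ i, ε s i * r i a) l (𝓝 0) := by
      simpa using (tendsto_finsetSum Finset.univ fun i _ => hlim i a).const_mul b
    have h2 := ((Complex.continuous_exp.comp Complex.continuous_ofReal.neg).tendsto 0).comp h1
    simpa using h2.mul_const (gammaIntegrand c b a)

end Damping

namespace Pinning

variable (p : Pinning H)

/-! ### The integral in the torus chart -/

section Integral

variable {J : Set p.I} {n : ℕ} {ii : Fin n → p.I}

theorem IsReducedDecomposition.isReduced {w : Equiv.Perm H.root}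
    (h : p.IsReducedDecomposition w ii) : p.IsReduced (List.ofFn ii) := by
  rw [IsReduced, ← length_weylWord, h.1, h.2, List.length_ofFn]

theorem betaFn_mem_posRoots (hl : p.IsReduced (List.ofFn ii)) (k : Fin n) :
    p.betaFn n ii k ∈ p.posRoots := by
  have h : p.betaFn n ii k ∈ p.betas (List.ofFn ii) := by
    rw [betas_ofFn]
    exact (List.mem_ofFn' _ _).mpr ⟨k, rfl⟩
  exact (p.mem_invSet.mp ((p.mem_betas hl _).mp h)).1

theorem prod_betaFn (hl : p.IsReduced (List.ofFn ii)) (hw : p.weylWord (List.ofFn ii) = p.wP J)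
    (F : H.root → ℂ) : ∏ k, F (p.betaFn n ii k) = ∏ α ∈ p.posRootsOutside J, F α := by
  rw [← invSet_wP, ← hw, ← p.prod_betas hl, betas_ofFn, List.map_ofFn, List.prod_ofFn]
  rfl

theorem tLam_eq {lam : H} (hlamJ : ∀ i ∈ J, p.simpleRoot i lam = 0) {s : ℝ} (hs : 0 < s) :
    p.tLam J lam s = tor ((Real.log s : ℂ) • lam) := by
  rw [tLam, ← torusElt_exp]
  congr 1
  funext i
  rw [map_smul, smul_eq_mul]
  split_ifs with hi
  · rw [hlamJ i hi, mul_zero, Complex.exp_zero]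
  · rw [Complex.cpow_def_of_ne_zero (by exact_mod_cast hs.ne'), Complex.ofReal_log hs.le]

theorem prod_cpow_eq {ħ : ℝ} (hħ : 0 < ħ) (S : Finset H.root) (F : H.root → ℂ) :
    ∏ α ∈ S, (ħ : ℂ) ^ (-F α / ħ) = (ħ : ℂ) ^ (-(∑ α ∈ S, F α) / ħ) := by
  have h0 : (ħ : ℂ) ≠ 0 := by exact_mod_cast hħ.ne'
  simp only [Complex.cpow_def_of_ne_zero h0]
  rw [← Complex.exp_sum, ← Finset.mul_sum, ← Finset.sum_div, Finset.sum_neg_distrib]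

/-- The exponents `-β^∨(h) / ħ` of the coordinates in the chart. -/
def chartExponent (ii : Fin n → p.I) (ħ : ℝ) (h : Dual ℂ H) (k : Fin n) : ℂ :=
  -h (coroot (p.betaFn n ii k).1) / ħ

theorem chartExponent_re_pos (hl : p.IsReduced (List.ofFn ii)) {ħ : ℝ} (hħ : 0 < ħ) {h : Dual ℂ H}
    (hh : ∀ α ∈ p.posRoots, (h (coroot α.1)).re < 0) (k : Fin n) :
    0 < (p.chartExponent ii ħ h k).re := by
  rw [chartExponent, Complex.div_ofReal_re, Complex.neg_re]
  exact div_pos (neg_pos.mpr (hh _ (p.betaFn_mem_posRoots hl k))) hħ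

theorem gammaIntegrand_eq {c : Fin n → ℂ} {b : ℝ} {a : Fin n → ℝ} (ha : ∀ k, 0 < a k) :
    gammaIntegrand c b a = Complex.exp (∑ k, (Real.log (a k) : ℂ) * c k) * (∏ k, (a k : ℂ)⁻¹) *
      Complex.exp (-((b * ∑ k, a k : ℝ) : ℂ)) := by
  have h1 : ∀ k, (a k : ℂ) ^ (c k - 1) * Complex.exp (-(b * a k : ℂ)) =
      Complex.exp ((Real.log (a k) : ℂ) * c k) * (a k : ℂ)⁻¹ * Complex.exp (-(b * a k : ℂ)) := by
    intro k
    have h0 : (a k : ℂ) ≠ 0 := by exact_mod_cast (ha k).ne'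
    rw [Complex.cpow_sub _ _ h0, Complex.cpow_one, Complex.cpow_def_of_ne_zero h0,
      Complex.ofReal_log (ha k).le, div_eq_mul_inv]
  rw [gammaIntegrand, Finset.prod_congr rfl fun k _ => h1 k, Finset.prod_mul_distrib,
    Finset.prod_mul_distrib, ← Complex.exp_sum, ← Complex.exp_sum, Finset.sum_neg_distrib,
    ← Finset.mul_sum]
  push_cast
  rfl

/-- In the torus chart the integrand is a product of Gamma integrands multiplied by a damping
factor and by `exp (⟨h, z⟩ / ħ)`. -/
theorem integrand_eq {ω : (𝔤 ≃ₗ[ℂ] 𝔤) → 𝔤 [⋀^Fin n]→ₗ[ℂ] ℂ} (hω : p.IsVolumeForm J ii ω) (ħ : ℝ)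
    (h : Dual ℂ H) {z : H} (hz : ∀ i ∈ J, p.simpleRoot i z = 0) {a : Fin n → ℝ}
    (ha : ∀ k, 0 < a k) {q : ℝ} (hdec : p.decoration J ii
      (p.chart ii (tor z) (fun k => (a k : ℂ))) = ((∑ k, a k + q : ℝ) : ℂ))
    (hlog : p.logT (p.weightMap (p.chart ii (tor z) (fun k => (a k : ℂ)))) =
      z - ∑ k, (Real.log (a k) : ℂ) • (coroot (p.betaFn n ii k).1 : H)) :
    p.integrand J ii ω ħ h (tor z) a = Complex.exp (h z / ħ) *
      (Complex.exp (-((ħ⁻¹ * q : ℝ) : ℂ)) * gammaIntegrand (p.chartExponent ii ħ h) ħ⁻¹ a) := by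
  have hZ : tor z ∈ p.ZL J := p.tor_mem_ZL fun i hi => by rw [hz i hi, Complex.exp_zero]
  have h1 := hω.normalized _ hZ (fun k => (a k : ℂ)) fun k => by exact_mod_cast (ha k).ne'
  have h2 : h (z - ∑ k, (Real.log (a k) : ℂ) • (coroot (p.betaFn n ii k).1 : H)) / ħ =
      h z / ħ + ∑ k, (Real.log (a k) : ℂ) * p.chartExponent ii ħ h k := by
    rw [map_sub, sub_div, map_sum, Finset.sum_div, sub_eq_add_neg, ← Finset.sum_neg_distrib]
    congr 1
    refine Finset.sum_congr rfl fun k _ => ?_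
    rw [map_smul, smul_eq_mul, chartExponent]; ring
  have h3 : Complex.exp (-((∑ k, a k + q : ℝ) : ℂ) / ħ) =
      Complex.exp (-((ħ⁻¹ * q : ℝ) : ℂ)) * Complex.exp (-((ħ⁻¹ * ∑ k, a k : ℝ) : ℂ)) := by
    rw [← Complex.exp_add]
    congr 1
    push_cast; ring
  simp only [integrand]
  rw [hdec, hlog, h1, h2, Complex.exp_add, h3, gammaIntegrand_eq ha]
  ring

/-- The integral representation of `I_B` in the torus chart, and its limit. -/
theorem integral_asymptotics (hJ : J ≠ Set.univ) (hii : p.IsReducedDecomposition (p.wP J) ii)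
    {ω : (𝔤 ≃ₗ[ℂ] 𝔤) → 𝔤 [⋀^Fin n]→ₗ[ℂ] ℂ} (hω : p.IsVolumeForm J ii ω) {ħ : ℝ} (hħ : 0 < ħ)
    {h : Dual ℂ H} (hh : ∀ α ∈ p.posRoots, (h (coroot α.1)).re < 0) {lam : H}
    (hlam : ∀ i ∉ J, (p.simpleRoot i lam).im = 0 ∧ 0 < (p.simpleRoot i lam).re)
    (hlamJ : ∀ i ∈ J, p.simpleRoot i lam = 0) :
    (∀ s : ℝ, 0 < s →
      IntegrableOn (p.integrand J ii ω ħ h (p.tLam J lam s))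
        (p.chartDomain J ii (p.tLam J lam s))) ∧
    Tendsto
      (fun s : ℝ => (s : ℂ) ^ (-(h lam) / ħ) * p.IB J ii ω ħ h (p.tLam J lam s))
      (𝓝[>] 0)
      (𝓝 ((ħ : ℂ) ^ (-(∑ α ∈ p.posRootsOutside J, h (coroot α.1)) / ħ) *
        ∏ α ∈ p.posRootsOutside J, Complex.Gamma (h (coroot (-α.1)) / ħ))) := by
  have hl : p.IsReduced (List.ofFn ii) := IsReducedDecomposition.isReduced p hii
  have hw := hii.1
  obtain ⟨i₀, hi₀⟩ := (Set.ne_univ_iff_exists_notMem J).mp hJ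
  have : Nonempty p.I := ⟨i₀⟩
  obtain ⟨r, hrm, hr0, hrJ, hform⟩ := p.exists_chart_formula hl hw
  have hc := p.chartExponent_re_pos hl hħ hh
  have hb : 0 < ħ⁻¹ := inv_pos.mpr hħ
  set z : ℝ → H := fun s => (Real.log s : ℂ) • lam with hz
  have hzJ : ∀ s, ∀ i ∈ J, p.simpleRoot i (z s) = 0 := fun s i hi => by
    rw [hz, map_smul, hlamJ i hi, smul_zero]
  have hzim : ∀ s i, (p.simpleRoot i (z s)).im = 0 := fun s i => by
    by_cases hi : i ∈ J
    · rw [hzJ s i hi, Complex.zero_im]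
    · rw [hz, map_smul, smul_eq_mul, Complex.im_ofReal_mul, (hlam i hi).1, mul_zero]
  set ε : ℝ → p.I → ℝ := fun s i => Real.exp (p.simpleRoot i (z s)).re with hε
  have hε0 : ∀ s i, 0 ≤ ε s i := fun s i => (Real.exp_pos _).le
  -- The chart parametrizes the positive part of the fiber by the whole positive orthant.
  have hdom : ∀ s, p.chartDomain J ii (tor (z s)) = orthant n := fun s =>
    Set.ext fun a => ⟨fun ha => ha.1, fun ha => ⟨ha, (hform _ (hzim s) (hzJ s) a ha).1⟩⟩
  have hint : ∀ s, ∀ a ∈ orthant n, p.integrand J ii ω ħ h (tor (z s)) a =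
      Complex.exp (h (z s) / ħ) * (Complex.exp (-((ħ⁻¹ * ∑ i, ε s i * r i a : ℝ) : ℂ)) *
        gammaIntegrand (p.chartExponent ii ħ h) ħ⁻¹ a) := fun s a ha =>
    p.integrand_eq hω ħ h (hzJ s) ha (hform _ (hzim s) (hzJ s) a ha).2.1
      (hform _ (hzim s) (hzJ s) a ha).2.2
  constructor
  · intro s hs
    rw [p.tLam_eq hlamJ hs, hdom]
    exact IntegrableOn.congr_fun (Integrable.const_mul (integrableOn_damped hrm hr0 hc hb (hε0 s))
      (Complex.exp (h (z s) / ħ))) (fun a ha => (hint s a ha).symm) (measurableSet_orthant n)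
  · have hlim : ∀ i a, Tendsto (fun s => ε s i * r i a) (𝓝[>] 0) (𝓝 0) := by
      intro i a
      by_cases hi : i ∈ J
      · simp only [hrJ i hi a, mul_zero]
        exact tendsto_const_nhds
      · have h1 : Tendsto (fun s => (p.simpleRoot i (z s)).re) (𝓝[>] 0) atBot := by
          simp only [hz, map_smul, smul_eq_mul, Complex.re_ofReal_mul]
          exact Real.tendsto_log_nhdsGT_zero.atBot_mul_const (hlam i hi).2
        simpa using (Real.tendsto_exp_atBot.comp h1).mul_const (r i a)
    have hmain := tendsto_setIntegral_damped hrm hr0 hc hb hε0 hlim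
    have hval : ∫ a in orthant n, gammaIntegrand (p.chartExponent ii ħ h) ħ⁻¹ a =
        (ħ : ℂ) ^ (-(∑ α ∈ p.posRootsOutside J, h (coroot α.1)) / ħ) *
          ∏ α ∈ p.posRootsOutside J, Complex.Gamma (h (coroot (-α.1)) / ħ) := by
      rw [setIntegral_gammaIntegrand hc hb, ← prod_cpow_eq hħ (p.posRootsOutside J)
        fun α => h (coroot α.1), ← Finset.prod_mul_distrib, ← p.prod_betaFn hl hw]
      refine Finset.prod_congr rfl fun k _ => ?_
      rw [coroot_neg, map_neg, chartExponent]
      congr 2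
      push_cast
      simp
    rw [← hval]
    refine hmain.congr' ?_
    filter_upwards [self_mem_nhdsWithin] with s hs
    have hs0 : (s : ℂ) ≠ 0 := by exact_mod_cast (ne_of_gt hs)
    rw [p.tLam_eq hlamJ hs, IB, hdom, setIntegral_congr_fun (measurableSet_orthant n) (hint s),
      integral_const_mul, ← mul_assoc]
    have h1 : (s : ℂ) ^ (-(h lam) / ħ) * Complex.exp (h (z s) / ħ) = 1 := by
      rw [Complex.cpow_def_of_ne_zero hs0, ← Complex.exp_add, hz, map_smul, smul_eq_mul,
        Complex.ofReal_log (le_of_lt hs)]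
      rw [← Complex.exp_zero]
      congr 1
      ring
    rw [h1, one_mul]

end Integral

end Pinning

end RietschMirror

end

open RietschMirror LieAlgebra.IsKilling in
theorem mainTheorem10 {𝔤 : Type*} [LieRing 𝔤] [LieAlgebra ℂ 𝔤] [FiniteDimensional ℂ 𝔤]
    [LieAlgebra.IsSimple ℂ 𝔤] (H : LieSubalgebra ℂ 𝔤) [H.IsCartanSubalgebra]
    (p : Pinning H) (J : Set p.I) (hJ : J ≠ Set.univ)
    {n : ℕ} (ii : Fin n → p.I) (hii : p.IsReducedDecomposition (p.wP J) ii)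
    (ω : (𝔤 ≃ₗ[ℂ] 𝔤) → 𝔤 [⋀^Fin n]→ₗ[ℂ] ℂ) (hω : p.IsVolumeForm J ii ω)
    (ħ : ℝ) (hħ : 0 < ħ) (h : Dual ℂ H)
    (hh : ∀ α ∈ p.posRoots, (h (coroot α.1)).re < 0)
    (lam : H)
    (hlam : ∀ i ∉ J, (p.simpleRoot i lam).im = 0 ∧ 0 < (p.simpleRoot i lam).re)
    (hlamJ : ∀ i ∈ J, p.simpleRoot i lam = 0) :
    (∀ s : ℝ, 0 < s →
      IntegrableOn (p.integrand J ii ω ħ h (p.tLam J lam s))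
        (p.chartDomain J ii (p.tLam J lam s))) ∧
    Tendsto
      (fun s : ℝ => (s : ℂ) ^ (-(h lam) / ħ) * p.IB J ii ω ħ h (p.tLam J lam s))
      (𝓝[>] 0)
      (𝓝 ((ħ : ℂ) ^ (-(∑ α ∈ p.posRootsOutside J, h (coroot α.1)) / ħ) *
        ∏ α ∈ p.posRootsOutside J, Complex.Gamma (h (coroot (-α.1)) / ħ))) := by
  exact p.integral_asymptotics hJ hii hω hħ hh hlam hlamJ
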